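/- All graphs are nonempty, finite, undirected, connected and simple. **The game.** A *hunter strategy* in $G=(V,E)$ is a finite sequence $\mathcal S=(S_1,\dots,S_\ell)$ of nonempty subsets of $V$; it *uses at most $k$ hunters* if $|S_i|\le k$ for all $i$. It is *winning* if for every walk $(r_0,\dots,r_\ell)$ in $G$ (so $r_{i-1}r_i\in E$ for $1\le i\le \ell$) there is $0\le j<\ell$ with $r_j\in S_{j+1}$. Put $Z_0=V$ and $Z_i=\{x\in V:\exists y\in Z_{i-1}\setminus S_i,\ xy\in E\}$ for $1\le i\le\ell$. A vertex $v$ is *cleared* at round $i\geq 1$ if $v\in S_i$, or if $N(v)\cap Z_{i-1}\neq\emptyset$ and $N(v)\cap Z_{i-1}\subseteq S_i$. The strategy is *monotone* if whenever $v$ is cleared at round $i$, $i\le j<\ell$ and $v\in Z_j$, then $v\in S_{j+1}$. The *monotone hunter number* $mh(G)$ is the least $k$ such that $G$ has a monotone winning hunter strategy using at most $k$ hunters; by convention $mh(G)=0$ if $|V|=1$. A *star* is a tree with at least two vertices and at most one vertex of degree at least two. A *branch* at a vertex $v$ of a tree $T$ is a connected component of $T-v$. **Theorem.** (A) The monotone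 hunter number of any tree can be computed in polynomial time: there are a program for the random access machine (registers and arrays of natural numbers, unit-cost assignment, addition, truncated subtraction, array access and zero test) and a polynomial $q$ such that, given the adjacency matrix of any tree $T$ with $n$ vertices, the program halts within $q(n)$ steps and outputs $mh(T)$. (B) For every tree $T=(V,E)$: - $mh(T)=0$ if and only if $|V|=1$; - $mh(T)=1$ if and only if $T$ is a star; - $mh(T)=2$ if and only if $|V|\neq 1$, $T$ is not a star, and $T$ contains a path $P$ such that every connected component of $T\setminus P$ is a star or an isolated vertex; - for every $k\ge 3$, $mh(T)\ge k$ if and only if there is a vertex $v$ such that at least three branches at $v$ have monotone hunter number at least $k-1$. (C) Root a tree $T$ at a vertex $r$. For $u\in V$, let $T[u]$ be the subtree induced by $u$ and its descendants, and $T[u,x_1,\dots,x_i]$ the subtree obtained from $T[u]$ by deleting the vertices of $T[x_1],\dots,T[x_i]$. In a rooted tree $R$, a vertex $x$ is *$k$-critical* if $mh(R[x])=k$ and, for $k\ge2$, $x$ has two distinct children $v_1,v_2$ in $R$ with $mh(R[v_1])=mh(R[v_2])=k$; for $k=1$, $x$ has a unique child $v$ in $R$ with $mh(R[v])=1$. There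 are no $0$-critical vertices. A *label* of $u$ is a list of integers $(a_1,\dots,a_p)$, $p\ge1$, with $a_1>\dots>a_p\ge0$, where $a_p$ may be marked with a star, such that there are vertices $\ell_1,\dots,\ell_p$ with: $\ell_i\ne u$ for $i<p$ and $\ell_p=u$; $mh(T[u,\ell_1,\dots,\ell_{i-1}])=a_i$ for $1\le i\le p$; $\ell_i$ is $a_i$-critical in $T[u,\ell_1,\dots,\ell_{i-1}]$ for $1\le i<p$; and, in $T[u,\ell_1,\dots,\ell_{p-1}]$, the vertex $u$ is $a_p$-critical if $a_p$ is starred, and there is no $a_p$-critical vertex if $a_p$ is not starred. Let $\mathrm{Alg}(\lambda_1,\dots,\lambda_d)$ be the following procedure on labels. If $d=0$, return $(0)$. Otherwise let $\lambda=()$ and let $k$ be the largest integer occurring in the $\lambda_i$. For $m=0,1,\dots,k$, let $n(m)$ be the number of $i$ such that $m$ or $m^*$ is in $\lambda_i$, let $c(m)$ be the assertion that for some $i$ the integer $m$ is an entry of $\lambda_i$ other than the last one, or the last entry of $\lambda_i$ is $m^*$, and update $\lambda$ as follows: - $m=0$: $\lambda\gets(1)$ if $n(0)\ge1$, otherwise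 $\lambda\gets(0)$. - $m=1$: if $n(1)=1$, not $c(1)$ and $\lambda=(0)$, then $\lambda\gets(1^*)$; else if $n(1)\ge1$, then $\lambda\gets(2)$. - $m\ge2$: if $n(m)\ge3$, then $\lambda\gets(m+1)$; if $n(m)=2$ and $c(m)$, then $\lambda\gets(m+1)$; if $n(m)=2$ and not $c(m)$, then $\lambda\gets(m^*)$; if $n(m)=1$, $c(m)$ and $\lambda$ contains $m$ or $m^*$, then $\lambda\gets(m+1)$; if $n(m)=1$, $c(m)$ and $\lambda$ contains neither, then $m$ is prepended to $\lambda$ (keeping the mark of its last entry); if $n(m)=1$ and not $c(m)$, then $\lambda\gets(m)$. In all other cases $\lambda$ is unchanged. After the loop, return $\lambda$. Then for every vertex $v$ with children $v_1,\dots,v_d$ and labels $\lambda_i$ of $v_i$, the list $\mathrm{Alg}(\lambda_1,\dots,\lambda_d)$ is a label of $v$. Consequently, running $\mathrm{Alg}$ bottom-up from the leaves gives a label of every vertex, and the first entry of the list obtained at the root $r$ is $mh(T)$. -/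

import Mathlib

namespace HuntersRabbit

universe u

section Game

variable {V : Type u}

/-- A hunter strategy `(S_1, …, S_ℓ)`: a finite sequence of nonempty finite sets of vertices.
Only the values `shot i` with `1 ≤ i ≤ length` matter. -/
structure HunterStrategy (V : Type u) where
  length : ℕ
  shot : ℕ → Finset V
  shot_nonempty : ∀ i, 1 ≤ i → i ≤ length → (shot i).Nonempty

namespace HunterStrategy

/-- At most `k` vertices are shot in every round. -/
def UsesAtMost (S : HunterStrategy V) (k : ℕ) : Prop :=
  ∀ i, 1 ≤ i → i ≤ S.length → (S.shot i).card ≤ k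

/-- The strategy is winning: along every walk `r_0, …, r_ℓ` of the rabbit there is some `j < ℓ`
with `r_j ∈ S_{j+1}`. -/
def IsWinning (G : SimpleGraph V) (S : HunterStrategy V) : Prop :=
  ∀ r : ℕ → V, (∀ i, i < S.length → G.Adj (r i) (r (i + 1))) →
    ∃ j, j < S.length ∧ r j ∈ S.shot (j + 1)

/-- The set `Z_i` of contaminated vertices after round `i`. -/
def contaminated (G : SimpleGraph V) (S : HunterStrategy V) : ℕ → Set V
  | 0 => Set.univ
  | i + 1 => {x | ∃ y ∈ contaminated G S i, y ∉ S.shot (i + 1) ∧ G.Adj x y}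

/-- The vertex `v` is cleared at round `i` (where `1 ≤ i`). -/
def ClearedAt (G : SimpleGraph V) (S : HunterStrategy V) (v : V) (i : ℕ) : Prop :=
  v ∈ S.shot i ∨
    ((G.neighborSet v ∩ S.contaminated G (i - 1)).Nonempty ∧
      ∀ w ∈ G.neighborSet v ∩ S.contaminated G (i - 1), w ∈ S.shot i)

/-- The strategy is monotone: no vertex is recontaminated, i.e. a vertex that was cleared at some
round `i ≤ j` and is contaminated after round `j` is shot at round `j + 1`. -/
def IsMonotone (G : SimpleGraph V) (S : HunterStrategy V) : Prop :=
  ∀ v i j, 1 ≤ i → i ≤ j → j < S.length → S.ClearedAt G v i →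
    v ∈ S.contaminated G j → v ∈ S.shot (j + 1)

end HunterStrategy

open Classical in
/-- The monotone hunter number `mh(G)`; it is `0` by convention on a one-vertex graph. -/
noncomputable def monotoneHunterNumber (G : SimpleGraph V) : ℕ :=
  if Nat.card V = 1 then 0
  else sInf {k | ∃ S : HunterStrategy V, S.IsWinning G ∧ S.IsMonotone G ∧ S.UsesAtMost k}

end Game

section Trees

variable {V : Type u}

/-- A star: a tree with at least two vertices, at most one of which has degree at least two. -/
def IsStar (G : SimpleGraph V) : Prop :=
  G.IsTree ∧ 2 ≤ Nat.card V ∧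
    ∀ x y, 2 ≤ (G.neighborSet x).ncard → 2 ≤ (G.neighborSet y).ncard → x = y

/-- A branch at `v`: a connected component of `G - v`. -/
abbrev Branch (G : SimpleGraph V) (v : V) : Type u :=
  (G.induce {w | w ≠ v}).ConnectedComponent

/-- The set `V(T[x])`: `x` and its descendants, in the tree `T` rooted at `r`. -/
def descendants (T : SimpleGraph V) (r x : V) : Set V :=
  {w | ∃ p : T.Walk r w, p.IsPath ∧ x ∈ p.support}

/-- `c` is a child of `x` in the tree `T` rooted at `r`. -/
def IsChild (T : SimpleGraph V) (r x c : V) : Prop :=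
  T.Adj x c ∧ c ∈ descendants T r x

/-- The monotone hunter number of the subgraph induced by a set of vertices. -/
noncomputable def mhOn (T : SimpleGraph V) (A : Set V) : ℕ :=
  monotoneHunterNumber (T.induce A)

/-- Let `A` be the vertex set of a subtree `T[u, x_1, …, x_p]` of the rooted tree `T`, so that the
subtree of it rooted at a vertex `x` has vertex set `descendants T r x ∩ A`.  The vertex `x` is
`k`-critical in this subtree.  There are no `0`-critical vertices. -/
def IsCritical (T : SimpleGraph V) (r : V) (A : Set V) (k : ℕ) (x : V) : Prop :=
  x ∈ A ∧ mhOn T (descendants T r x ∩ A) = k ∧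
    ((2 ≤ k ∧ ∃ v₁ v₂, v₁ ≠ v₂ ∧
        (IsChild T r x v₁ ∧ v₁ ∈ A ∧ mhOn T (descendants T r v₁ ∩ A) = k) ∧
        (IsChild T r x v₂ ∧ v₂ ∈ A ∧ mhOn T (descendants T r v₂ ∩ A) = k)) ∨
      (k = 1 ∧ ∃! v, IsChild T r x v ∧ v ∈ A ∧ mhOn T (descendants T r v ∩ A) = 1))

/-- A list `(a_1, …, a_p)` of integers, whose last entry may be marked with a star. -/
structure Label where
  entries : List ℕ
  starred : Bool

/-- `V(T[u, ℓ_0, …, ℓ_{i-1}])`. -/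
def prunedSubtree (T : SimpleGraph V) (r u : V) (l : ℕ → V) (i : ℕ) : Set V :=
  {w | w ∈ descendants T r u ∧ ∀ j < i, w ∉ descendants T r (l j)}

/-- `L` is the label of the vertex `u` of the tree `T` rooted at `r`.  Entries and associated
vertices are indexed from `0`: the vertex associated to the entry number `i` is `l i`.  The
condition `l i ≠ u` before the last index says that the trees `T[u, ℓ_0, …, ℓ_{i-1}]` whose
monotone hunter numbers are the entries are nonempty. -/
def IsLabel (T : SimpleGraph V) (r u : V) (L : Label) : Prop :=
  L.entries ≠ [] ∧ L.entries.Pairwise (· > ·) ∧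
  ∃ l : ℕ → V,
    (∀ i (h : i < L.entries.length),
      mhOn T (prunedSubtree T r u l i) = L.entries[i]) ∧
    (∀ i (h : i + 1 < L.entries.length),
      l i ≠ u ∧ IsCritical T r (prunedSubtree T r u l i) L.entries[i] (l i)) ∧
    (∀ i (h : i + 1 = L.entries.length),
      l i = u ∧
      (L.starred = false → ∀ x, ¬ IsCritical T r (prunedSubtree T r u l i) L.entries[i] x) ∧
      (L.starred = true → IsCritical T r (prunedSubtree T r u l i) L.entries[i] u))

end Trees

section Algorithm

namespace Label

/-- `m` or `m*` is in the label. -/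
def contains (m : ℕ) (L : Label) : Bool := decide (m ∈ L.entries)

/-- `m` is in the prefix (all entries but the last) of the label, or its tail is `m*`. -/
def hasCritical (m : ℕ) (L : Label) : Bool :=
  decide (m ∈ L.entries.dropLast) || (decide (L.entries.getLast? = some m) && L.starred)

end Label

/-- One iteration (for the value `m`) of the loop of the labelling algorithm; `ls` is the list of
the labels of the children, `L` the current label. -/
def labelStep (ls : List Label) (L : Label) (m : ℕ) : Label :=
  let n : ℕ := ls.countP (Label.contains m)
  let crit : Bool := ls.any (Label.hasCritical m)
  if m = 0 then
    if 1 ≤ n then ⟨[1], false⟩ else ⟨[0], false⟩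
  else if m = 1 then
    if n = 1 ∧ crit = false ∧ L.entries = [0] ∧ L.starred = false then ⟨[1], true⟩
    else if 1 ≤ n then ⟨[2], false⟩
    else L
  else
    if 3 ≤ n then ⟨[m + 1], false⟩
    else if n = 2 ∧ crit = true then ⟨[m + 1], false⟩
    else if n = 2 ∧ crit = false then ⟨[m], true⟩
    else if n = 1 ∧ crit = true ∧ L.contains m = true then ⟨[m + 1], false⟩
    else if n = 1 ∧ crit = true ∧ L.contains m = false then ⟨m :: L.entries, L.starred⟩
    else if n = 1 ∧ crit = false then ⟨[m], false⟩
    else L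

/-- The labelling algorithm: from the labels of the children of a vertex to its own label. -/
def labelAlgorithm (ls : List Label) : Label :=
  if ls.isEmpty then ⟨[0], false⟩
  else
    let k : ℕ := (ls.flatMap Label.entries).foldr max 0
    (List.range (k + 1)).foldl (labelStep ls) ⟨[], false⟩

end Algorithm

section Machine

/-- The memory of a random access machine with natural number registers and arrays.  A program
mentions only finitely many registers and arrays. -/
structure Memory where
  reg : ℕ → ℕ
  arr : ℕ → ℕ → ℕ

/-- The elementary instructions.  There is no multiplication, so that the bit length of every stored
number grows by at most one per step (beyond that of the input and of the constants of the program),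
and unit cost is polynomially equivalent to Turing machine time. -/
inductive Instr where
  /-- `reg x := c` -/
  | const (x c : ℕ)
  /-- `reg x := reg y` -/
  | copy (x y : ℕ)
  /-- `reg x := reg y + reg z` -/
  | add (x y z : ℕ)
  /-- `reg x := max (reg y - reg z) 0` -/
  | sub (x y z : ℕ)
  /-- `reg x := arr a [reg y]` -/
  | load (x a y : ℕ)
  /-- `arr a [reg x] := reg y` -/
  | store (a x y : ℕ)

/-- The effect of an elementary instruction. -/
def Instr.apply : Instr → Memory → Memory
  | .const x c, σ => { σ with reg := Function.update σ.reg x c }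
  | .copy x y, σ => { σ with reg := Function.update σ.reg x (σ.reg y) }
  | .add x y z, σ => { σ with reg := Function.update σ.reg x (σ.reg y + σ.reg z) }
  | .sub x y z, σ => { σ with reg := Function.update σ.reg x (σ.reg y - σ.reg z) }
  | .load x a y, σ => { σ with reg := Function.update σ.reg x (σ.arr a (σ.reg y)) }
  | .store a x y, σ =>
      { σ with arr := Function.update σ.arr a (Function.update (σ.arr a) (σ.reg x) (σ.reg y)) }

/-- Programs: elementary instructions, composition, conditionals and loops with tests
`reg x ≠ 0`. -/
inductive Program where
  | skip
  | instr (i : Instr)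
  | seq (p q : Program)
  /-- if `reg x ≠ 0` then `p` else `q` -/
  | cond (x : ℕ) (p q : Program)
  /-- while `reg x ≠ 0` do `p` -/
  | loop (x : ℕ) (p : Program)

/-- `Exec p σ t σ'`: started in the memory `σ`, the program `p` halts after exactly `t` steps in
the memory `σ'`.  Every elementary instruction and every test costs one step. -/
inductive Exec : Program → Memory → ℕ → Memory → Prop
  | skip (σ : Memory) : Exec .skip σ 0 σ
  | instr (i : Instr) (σ : Memory) : Exec (.instr i) σ 1 (i.apply σ)
  | seq {p q : Program} {σ₁ σ₂ σ₃ : Memory} {s t : ℕ} :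
      Exec p σ₁ s σ₂ → Exec q σ₂ t σ₃ → Exec (.seq p q) σ₁ (s + t) σ₃
  | cond_nonzero {x : ℕ} {p q : Program} {σ σ' : Memory} {t : ℕ} :
      σ.reg x ≠ 0 → Exec p σ t σ' → Exec (.cond x p q) σ (t + 1) σ'
  | cond_zero {x : ℕ} {p q : Program} {σ σ' : Memory} {t : ℕ} :
      σ.reg x = 0 → Exec q σ t σ' → Exec (.cond x p q) σ (t + 1) σ'
  | loop_zero {x : ℕ} {p : Program} {σ : Memory} :
      σ.reg x = 0 → Exec (.loop x p) σ 1 σ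
  | loop_nonzero {x : ℕ} {p : Program} {σ₁ σ₂ σ₃ : Memory} {s t : ℕ} :
      σ₁.reg x ≠ 0 → Exec p σ₁ s σ₂ → Exec (.loop x p) σ₂ t σ₃ →
      Exec (.loop x p) σ₁ (s + t + 1) σ₃

open Classical in
/-- The input memory of a graph on the vertices `0, …, n - 1`: register `0` holds `n`, array `0`
holds the adjacency matrix row by row, everything else is `0`. -/
noncomputable def inputMemory {n : ℕ} (G : SimpleGraph (Fin n)) : Memory where
  reg := fun x => if x = 0 then n else 0
  arr := fun a k =>
    if a = 0 ∧ ∃ i j : Fin n, k = i.val * n + j.val ∧ G.Adj i j then 1 else 0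

/-- The program `P` computes the graph parameter `f` on the graphs of the class `C` in polynomial
time: for one polynomial `q`, on every graph in `C` with vertex set `Fin n` it halts within `q n`
steps with the value of `f` in register `0`. -/
def ComputesInPolyTime (P : Program) (C : ∀ n, SimpleGraph (Fin n) → Prop)
    (f : ∀ n, SimpleGraph (Fin n) → ℕ) : Prop :=
  ∃ q : Polynomial ℕ, ∀ (n : ℕ) (G : SimpleGraph (Fin n)), C n G →
    ∃ (t : ℕ) (σ : Memory), Exec P (inputMemory G) t σ ∧ t ≤ q.eval n ∧ σ.reg 0 = f n G

end Machine

end HuntersRabbit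

/-! Monotone play has a static description. In a monotone strategy, a vertex that is no longer both
contaminated and unshot never becomes so again; let `s v` be the first time at which `v` has stopped
in this sense. At time `t` every stopped vertex with a neighbour `y` such that `t ≤ s y` has to be
shot. Conversely, shooting exactly these active vertices wins monotonically once `s` has been chosen
with minimal sum. So `mh(G) ≤ k` says that some `s` never has more than `k` active vertices
(`monotoneHunterNumber_le_iff`), a condition that passes to subsets and makes sense for every vertex
set.

For trees this gives a Parsons criterion. If three branches at a vertex each need more than `m`
hunters, then in a layout with at most `m + 1` active vertices each branch has a moment at which it
holds all of them; at the middle moment the other two branches and the vertex form a connected set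
without crossing edge, yet with parts on both sides in time (`not_layable_of_three_branches`). If no
vertex has three such branches, the heavy branches can be followed along a path whose removal leaves
only light pieces, and `m + 1` hunters suffice: walk along the path and treat the attached pieces
while standing at their vertex (`layable_of_path`). Moving along the path takes two hunters, which
is why `m ≥ 1` is needed and stars are treated by hand.

For the labels, a label of a child `c` is unfolded into a chain of sets `B c m` of width at most
`m`: what is left of the subtree at `c` once the critical subtrees of the entries above `m` are
removed (`Truncation`). Let `merged m` be `u` with the sets `B c m` of its children. The invariant
of the loop is that after iteration `m` the list is a label of `u` in `merged m`; for large `m` this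
is the whole subtree. Each case of an iteration is the Parsons criterion at `u` or at the unique
critical vertex below `u` (`hasLabel_labelStep`); iterations 0 and 1 are about single vertices and
stars.

For the running time, the algorithm only asks which numbers are entries and which of them are
critical, so two bit tables suffice. The program is written in a small language whose loops all run
`n` times, and which compiles to the machine with a polynomial cost. It needs no orientation of the
tree: it keeps a row for each pair (vertex, possible parent) and recomputes all rows `n` times, and
the rows of true pairs become correct in order of subtree size. -/

namespace HuntersRabbit

open Set

/-! ### Layouts, active vertices and connectedness by cuts -/

section Layout

universe u v

variable {V : Type u} {W : Type v}

/-- The vertices of `A` which are active at time `t`, when `s` is the time from which on a vertex is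
no longer contaminated: those past their own time that have a neighbour in `A` still waiting. -/
def activeSet (G : SimpleGraph V) (A : Set V) (s : V → ℕ) (t : ℕ) : Set V :=
  {x | x ∈ A ∧ s x ≤ t ∧ ∃ y ∈ A, G.Adj x y ∧ t ≤ s y}

/-- The subgraph induced by `A` has a layout in which at most `k` vertices are active at any time. -/
def Layable (G : SimpleGraph V) (A : Set V) (k : ℕ) : Prop :=
  ∃ s : V → ℕ, ∀ t, (activeSet G A s t).ncard ≤ k

theorem activeSet_mono {G : SimpleGraph V} {A B : Set V} (h : A ⊆ B) (s : V → ℕ) (t : ℕ) :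
    activeSet G A s t ⊆ activeSet G B s t := by
  rintro x ⟨hx, hs, y, hy, hxy, ht⟩
  exact ⟨h hx, hs, y, h hy, hxy, ht⟩

theorem Layable.mono [Finite V] {G : SimpleGraph V} {A B : Set V} {k l : ℕ} (h : Layable G B k)
    (hAB : A ⊆ B) (hkl : k ≤ l) : Layable G A l := by
  obtain ⟨s, hs⟩ := h
  exact ⟨s, fun t => (ncard_le_ncard (activeSet_mono hAB s t) (toFinite _)).trans ((hs t).trans hkl)⟩

theorem Layable.comap [Finite W] {G : SimpleGraph V} {H : SimpleGraph W} {A : Set V} {B : Set W}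
    {k : ℕ} (h : Layable G A k) (f : W → V) (hf : InjOn f B) (hB : MapsTo f B A)
    (hadj : ∀ x ∈ B, ∀ y ∈ B, H.Adj x y → G.Adj (f x) (f y)) (hA : A.Finite) : Layable H B k := by
  obtain ⟨s, hs⟩ := h
  refine ⟨s ∘ f, fun t => le_trans ?_ (hs t)⟩
  refine ncard_le_ncard_of_injOn f ?_ ?_ (hA.subset fun x hx => hx.1)
  · rintro x ⟨hx, hsx, y, hy, hxy, ht⟩
    exact ⟨hB hx, hsx, f y, hB hy, hadj x hx y hy hxy, ht⟩
  · exact hf.mono fun x hx => hx.1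

theorem layable_induce_iff [Finite V] {G : SimpleGraph V} {A : Set V} {k : ℕ} :
    Layable (G.induce A) univ k ↔ Layable G A k := by
  constructor
  · rcases A.eq_empty_or_nonempty with rfl | ⟨a, ha⟩
    · exact fun _ => ⟨fun _ => 0, fun t => by simp [activeSet]⟩
    · intro h
      classical
      refine h.comap (fun v => if hv : v ∈ A then ⟨v, hv⟩ else ⟨a, ha⟩) ?_ (mapsTo_univ _ _) ?_
        (toFinite _)
      · intro x hx y hy hxy
        simpa [hx, hy] using hxy
      · intro x hx y hy hxy
        simpa [hx, hy] using hxy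
  · intro h
    exact h.comap Subtype.val Subtype.val_injective.injOn (fun x _ => x.2) (fun _ _ _ _ h => h)
      (toFinite _)

theorem layable_card [Finite V] (G : SimpleGraph V) (A : Set V) : Layable G A (Nat.card V) :=
  ⟨fun _ => 0, fun _ => by
    rw [← ncard_univ]; exact ncard_le_ncard (subset_univ _) (toFinite _)⟩

/-- Every partition of `A` into two nonempty parts is crossed by an edge. -/
def Linked (G : SimpleGraph V) (A : Set V) : Prop :=
  ∀ p : V → Prop, (∃ x ∈ A, p x) → (∃ y ∈ A, ¬ p y) → ∃ a ∈ A, ∃ b ∈ A, G.Adj a b ∧ p a ∧ ¬ p b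

theorem linked_iff_preconnected {G : SimpleGraph V} {A : Set V} :
    Linked G A ↔ (G.induce A).Preconnected := by
  constructor
  · intro h x y
    by_contra hxy
    obtain ⟨a, ha, b, hb, hab, ⟨_, hpa⟩, hpb⟩ :=
      h (fun z => ∃ hz : z ∈ A, (G.induce A).Reachable x ⟨z, hz⟩) ⟨x, x.2, x.2, .refl _⟩
        ⟨y, y.2, fun ⟨_, h⟩ => hxy h⟩
    exact hpb ⟨hb, hpa.trans (SimpleGraph.Adj.reachable (by simpa using hab))⟩
  · rintro h p ⟨x, hx, hpx⟩ ⟨y, hy, hpy⟩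
    obtain ⟨w⟩ := h ⟨x, hx⟩ ⟨y, hy⟩
    obtain ⟨d, -, h1, h2⟩ := w.exists_boundary_dart {z | p z.1} hpx hpy
    exact ⟨d.fst, d.fst.2, d.snd, d.snd.2, by simpa using d.adj, h1, h2⟩

theorem linked_univ {G : SimpleGraph V} (h : G.Preconnected) : Linked G univ := by
  rintro p ⟨x, -, hpx⟩ ⟨y, -, hpy⟩
  obtain ⟨w⟩ := h x y
  obtain ⟨d, -, h1, h2⟩ := w.exists_boundary_dart {z | p z} hpx hpy
  exact ⟨d.fst, trivial, d.snd, trivial, d.adj, h1, h2⟩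

end Layout

/-! ### Monotone strategies are layouts -/

section Game

universe u

variable {V : Type u} {G : SimpleGraph V}

open HunterStrategy

theorem mem_contaminated_of_walk {S : HunterStrategy V} (r : ℕ → V) (l : ℕ)
    (hr : ∀ i < l, G.Adj (r i) (r (i + 1))) (hS : ∀ j < l, r j ∉ S.shot (j + 1)) :
    ∀ j ≤ l, r j ∈ S.contaminated G j := by
  intro j
  induction j with
  | zero => intro _; trivial
  | succ j ih => exact fun hj => ⟨r j, ih (by omega), hS j (by omega), (hr j (by omega)).symm⟩

theorem exists_walk_of_mem_contaminated {S : HunterStrategy V} (l : ℕ) :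
    ∀ x ∈ S.contaminated G l, ∃ r : ℕ → V, r l = x ∧ (∀ i < l, G.Adj (r i) (r (i + 1))) ∧
      ∀ j < l, r j ∉ S.shot (j + 1) := by
  induction l with
  | zero => exact fun x _ => ⟨fun _ => x, rfl, by simp, by simp⟩
  | succ l ih =>
    rintro x ⟨y, hy, hyS, hxy⟩
    obtain ⟨r, hr, hadj, hS⟩ := ih y hy
    refine ⟨fun i => if i ≤ l then r i else x, by simp, fun i hi => ?_, fun j hj => ?_⟩
    · rcases Nat.lt_succ_iff_lt_or_eq.mp hi with h | rfl
      · simpa [h.le, Nat.succ_le_of_lt h] using hadj i h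
      · simpa [hr] using hxy.symm
    · rcases Nat.lt_succ_iff_lt_or_eq.mp hj with h | rfl
      · simpa [h.le] using hS j h
      · simpa [hr] using hyS

theorem isWinning_iff_contaminated_eq_empty {S : HunterStrategy V} :
    S.IsWinning G ↔ S.contaminated G S.length = ∅ := by
  constructor
  · intro h
    by_contra hne
    obtain ⟨x, hx⟩ := nonempty_iff_ne_empty.mpr hne
    obtain ⟨r, -, hadj, hS⟩ := exists_walk_of_mem_contaminated _ x hx
    obtain ⟨j, hj, hjS⟩ := h r hadj
    exact hS j hj hjS
  · intro h r hr
    by_contra hne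
    push Not at hne
    have := mem_contaminated_of_walk r S.length hr hne _ le_rfl
    simp [h] at this

/-- The claim about a contaminated neighbour keeps the induction going: it excludes the vacuous case
in the definition of clearing, and an uncleared vertex and such a neighbour recontaminate each
other. -/
theorem mem_contaminated_of_not_clearedAt (hG : ∀ v, ∃ w, G.Adj v w) {S : HunterStrategy V}
    {v : V} (i : ℕ) (h : ∀ j, 1 ≤ j → j ≤ i → ¬ S.ClearedAt G v j) :
    v ∈ S.contaminated G i ∧ ∃ w, G.Adj v w ∧ w ∈ S.contaminated G i := by
  induction i with
  | zero => exact ⟨trivial, (hG v).imp fun w hw => ⟨hw, trivial⟩⟩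
  | succ i ih =>
    obtain ⟨hv, w, hvw, hw⟩ := ih fun j h1 h2 => h j h1 (by omega)
    have hc := h (i + 1) (by omega) le_rfl
    simp only [ClearedAt, not_or, not_and, not_forall] at hc
    obtain ⟨hvS, hc⟩ := hc
    obtain ⟨y, hy, hyS⟩ := hc ⟨w, hvw, hw⟩
    exact ⟨⟨y, hy.2, hyS, hy.1⟩, w, hvw, v, hv, hvS, hvw.symm⟩

/-- The layout records the first time at which `y` is not a source, that is, not contaminated and
unshot. An active vertex at time `t` is contaminated through its waiting neighbour but is no source,
so it lies in the shot of round `t + 1`. -/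
theorem layable_of_strategy [Finite V] (hG : ∀ v, ∃ w, G.Adj v w) {S : HunterStrategy V} {k : ℕ}
    (hwin : S.IsWinning G) (hmono : S.IsMonotone G) (hk : S.UsesAtMost k) :
    Layable G univ k := by
  classical
  rw [isWinning_iff_contaminated_eq_empty] at hwin
  let src (y : V) (i : ℕ) : Prop := i < S.length ∧ y ∈ S.contaminated G i ∧ y ∉ S.shot (i + 1)
  -- This is where monotonicity enters: a source at time `i + 1` cannot have been cleared before, so
  -- it was contaminated and unshot all along. Sources therefore form an initial interval of times.
  have hsrc : ∀ y i, src y (i + 1) → src y i := by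
    rintro y i ⟨hi, hy, hyS⟩
    have hnc : ∀ j, 1 ≤ j → j ≤ i + 1 → ¬ S.ClearedAt G y j := fun j h1 h2 hc =>
      hyS (hmono y j (i + 1) h1 h2 hi hc hy)
    refine ⟨by omega,
      (mem_contaminated_of_not_clearedAt hG i fun j h1 h2 => hnc j h1 (by omega)).1, fun h => ?_⟩
    exact hnc (i + 1) (by omega) le_rfl (Or.inl h)
  have hex : ∀ y, ∃ i, ¬ src y i := fun y => ⟨S.length, fun h => lt_irrefl _ h.1⟩
  have hlt : ∀ y i, src y i ↔ i < Nat.find (hex y) := by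
    intro y i
    constructor
    · intro h
      by_contra hle
      have : ∀ j, src y (Nat.find (hex y) + j) → src y (Nat.find (hex y)) := by
        intro j
        induction j with
        | zero => exact id
        | succ j ih => exact fun h => ih (hsrc _ _ h)
      refine Nat.find_spec (hex y) (this (i - Nat.find (hex y)) ?_)
      rwa [Nat.add_sub_cancel' (not_lt.mp hle)]
    · intro h
      by_contra hn
      exact Nat.find_min (hex y) h hn
  refine ⟨fun y => Nat.find (hex y), fun t => ?_⟩
  rcases (activeSet G univ (fun y => Nat.find (hex y)) t).eq_empty_or_nonempty with he | hne
  · simp [he]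
  have hmem : ∀ x, x ∈ activeSet G univ (fun y => Nat.find (hex y)) t →
      x ∈ S.contaminated G t ∧ t ≤ S.length := by
    rintro x ⟨-, -, y, -, hxy, ht⟩
    rcases t with _ | t
    · exact ⟨trivial, Nat.zero_le _⟩
    · obtain ⟨h1, h2, h3⟩ := (hlt y t).mpr ht
      exact ⟨⟨y, h2, h3, hxy⟩, h1⟩
  -- Active vertices are contaminated, and nothing is contaminated at the end, so round `t + 1`
  -- exists.
  have ht : t < S.length := by
    obtain ⟨x, hx⟩ := hne
    obtain ⟨h1, h2⟩ := hmem x hx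
    refine lt_of_le_of_ne h2 ?_
    rintro rfl
    simp [hwin] at h1
  refine le_trans ?_ (hk (t + 1) (by omega) ht)
  rw [← ncard_coe_finset]
  refine ncard_le_ncard (fun x hx => ?_) (toFinite _)
  by_contra hxS
  have := (hlt x t).mp ⟨ht, (hmem x hx).1, hxS⟩
  exact absurd hx.2.1 (not_le.mpr this)

/-- Take a layout with the least sum of times. If all times were positive, all could be lowered by
one; if `s y` exceeded the times of all its neighbours by more than one, `s y` alone could be
lowered. Tightness ensures that a vertex waiting in the layout is really still contaminated. -/
theorem exists_tight_layout [Finite V] (hG : ∀ v, ∃ w, G.Adj v w) [Nonempty V] {k : ℕ}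
    (h : Layable G univ k) : ∃ s : V → ℕ, (∀ t, (activeSet G univ s t).ncard ≤ k) ∧
      (∃ x, s x = 0) ∧ ∀ y, ∃ x, G.Adj y x ∧ s y ≤ s x + 1 := by
  classical
  have := Fintype.ofFinite V
  have hex : ∃ n, ∃ s : V → ℕ, (∀ t, (activeSet G univ s t).ncard ≤ k) ∧ ∑ v, s v = n := by
    obtain ⟨s, hs⟩ := h
    exact ⟨_, s, hs, rfl⟩
  obtain ⟨s, hs, hsum⟩ := Nat.find_spec hex
  have hmin : ∀ s' : V → ℕ, (∀ t, (activeSet G univ s' t).ncard ≤ k) → ∑ v, s v ≤ ∑ v, s' v := by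
    intro s' hs'
    rw [hsum]
    exact Nat.find_min' hex ⟨s', hs', rfl⟩
  refine ⟨s, hs, ?_, ?_⟩
  · by_contra! hpos
    refine absurd (hmin (fun v => s v - 1) fun t => le_trans ?_ (hs (t + 1))) ?_
    · refine ncard_le_ncard ?_ (toFinite _)
      rintro x ⟨-, hx, y, -, hxy, hy⟩
      have h1 := hpos x
      have h2 := hpos y
      dsimp only at hx hy
      exact ⟨trivial, by omega, y, trivial, hxy, by omega⟩
    · rw [not_le]
      obtain ⟨v⟩ := ‹Nonempty V›
      exact Finset.sum_lt_sum (fun i _ => Nat.sub_le _ _)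
        ⟨v, Finset.mem_univ _, by have := hpos v; omega⟩
  · intro y
    by_contra! hy
    -- After the change `y` is still later than all its neighbours and hence never active; no other
    -- vertex becomes active, since no time has grown.
    refine absurd (hmin (Function.update s y (s y - 1)) fun t => le_trans ?_ (hs t)) ?_
    · refine ncard_le_ncard ?_ (toFinite _)
      rintro x ⟨-, hx, z, -, hxz, hz⟩
      have hle : ∀ v, Function.update s y (s y - 1) v ≤ s v := by
        intro v
        by_cases hv : v = y
        · subst hv; simp
        · simp [hv]
      refine ⟨trivial, ?_, z, trivial, hxz, hz.trans (hle z)⟩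
      by_cases hxy : x = y
      · subst hxy
        have h1 := hy z hxz
        have h2 := hle z
        simp only [Function.update_self] at hx
        omega
      · simpa [hxy] using hx
    · rw [not_le]
      obtain ⟨w, hw⟩ := hG y
      have h1 := hy w hw
      refine Finset.sum_lt_sum (fun v _ => ?_) ⟨y, Finset.mem_univ _, ?_⟩
      · by_cases hv : v = y
        · subst hv; simp
        · simp [hv]
      · simp only [Function.update_self]
        omega

/-- Round `i` shoots the vertices active at time `i - 1`. For a tight layout the contaminated
vertices after round `i` are then exactly those having a neighbour `y` with `i ≤ s y`. -/
theorem exists_strategy_of_layable [Finite V] (hG : ∀ v, ∃ w, G.Adj v w) (hc : G.Connected) {k : ℕ}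
    (h : Layable G univ k) :
    ∃ S : HunterStrategy V, S.IsWinning G ∧ S.IsMonotone G ∧ S.UsesAtMost k := by
  classical
  have := Fintype.ofFinite V
  have := hc.nonempty
  obtain ⟨s, hs, ⟨x₀, hx₀⟩, htight⟩ := exists_tight_layout hG h
  obtain ⟨m, hm⟩ := Finite.exists_max s
  let S : HunterStrategy V :=
    { length := s m + 1
      shot := fun i => Finset.univ.filter fun x => s x < i ∧ ∃ y, G.Adj x y ∧ i ≤ s y + 1
      shot_nonempty := by
        intro i h1 h2
        -- Shots are nonempty because an edge crosses the cut `s x < i`; in the last round the cut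
        -- is trivial, and a neighbour of the latest vertex `m` serves.
        rcases Nat.lt_or_eq_of_le h2 with h2 | rfl
        · obtain ⟨a, -, b, -, hab, ha, hb⟩ := linked_univ hc.preconnected (fun x => s x < i)
            ⟨x₀, trivial, by omega⟩ ⟨m, trivial, by omega⟩
          exact ⟨a, by simpa using ⟨ha, b, hab, by omega⟩⟩
        · obtain ⟨w, hw⟩ := hG m
          exact ⟨w, by simpa using ⟨by have := hm w; omega, m, hw.symm, le_rfl⟩⟩ }
  have hmem : ∀ i x, x ∈ S.shot i ↔ s x < i ∧ ∃ y, G.Adj x y ∧ i ≤ s y + 1 := by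
    intro i x
    simp [S]
  have hcont : ∀ i x, x ∈ S.contaminated G i ↔ ∃ y, G.Adj x y ∧ i ≤ s y := by
    intro i
    induction i with
    | zero => exact fun x => ⟨fun _ => (hG x).imp fun w hw => ⟨hw, Nat.zero_le _⟩, fun _ => trivial⟩
    | succ i ih =>
      intro x
      constructor
      · rintro ⟨y, hy, hyS, hxy⟩
        refine ⟨y, hxy, ?_⟩
        obtain ⟨z, hz, hiz⟩ := (ih y).mp hy
        by_contra hlt
        exact hyS ((hmem _ _).mpr ⟨by omega, z, hz, by omega⟩)
      · rintro ⟨y, hxy, hy⟩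
        obtain ⟨z, hyz, hz⟩ := htight y
        refine ⟨y, (ih y).mpr ⟨z, hyz, by omega⟩, fun hyS => ?_, hxy⟩
        have := ((hmem _ _).mp hyS).1
        omega
  refine ⟨S, ?_, ?_, ?_⟩
  · rw [isWinning_iff_contaminated_eq_empty, eq_empty_iff_forall_notMem]
    intro x hx
    obtain ⟨y, -, hy⟩ := (hcont _ _).mp hx
    have := hm y
    simp only [S] at hy
    omega
  · rintro v i j h1 hij hj hcl hv
    obtain ⟨y, hvy, hy⟩ := (hcont _ _).mp hv
    refine (hmem _ _).mpr ⟨?_, y, hvy, by omega⟩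
    rcases hcl with hcl | ⟨-, hcl⟩
    · have := ((hmem _ _).mp hcl).1
      omega
    -- The neighbour `y` that keeps `v` contaminated was contaminated when `v` was cleared, hence
    -- shot then, which forces `s y < i`.
    · exfalso
      obtain ⟨z, hyz, hz⟩ := htight y
      have := (hmem _ _).mp (hcl y ⟨hvy, (hcont _ _).mpr ⟨z, hyz, by omega⟩⟩)
      omega
  · intro i h1 h2
    refine le_trans ?_ (hs (i - 1))
    rw [← ncard_coe_finset]
    refine ncard_le_ncard (fun x hx => ?_) (toFinite _)
    obtain ⟨h3, y, hxy, hy⟩ := (hmem _ _).mp hx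
    exact ⟨trivial, by omega, y, trivial, hxy, by omega⟩

/-- On one vertex the conventional value 0 agrees with layouts, because without edges nothing is
ever active. -/
theorem monotoneHunterNumber_le_iff [Finite V] (hc : G.Connected) {k : ℕ} :
    monotoneHunterNumber G ≤ k ↔ Layable G univ k := by
  have := hc.nonempty
  by_cases h1 : Nat.card V = 1
  · have hsub : Subsingleton V := (Nat.card_eq_one_iff_unique.mp h1).1
    simp only [monotoneHunterNumber, h1, if_true, Nat.zero_le, true_iff]
    refine ⟨fun _ => 0, fun t => ?_⟩
    rw [(eq_empty_iff_forall_notMem (s := activeSet G univ _ t)).mpr]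
    · simp
    · rintro x ⟨-, -, y, -, hxy, -⟩
      exact hxy.ne (Subsingleton.elim _ _)
  · have hnt : Nontrivial V :=
      Finite.one_lt_card_iff_nontrivial.mp (by have := Nat.card_pos (α := V); omega)
    have hG : ∀ v, ∃ w, G.Adj v w := fun v => hc.preconnected.exists_adj_of_nontrivial v
    simp only [monotoneHunterNumber, h1, if_false]
    constructor
    · intro h
      obtain ⟨S, h2, h3, h4⟩ := Nat.sInf_mem
        (s := {k | ∃ S : HunterStrategy V, S.IsWinning G ∧ S.IsMonotone G ∧ S.UsesAtMost k})
        ⟨_, exists_strategy_of_layable hG hc (layable_card G univ)⟩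
      exact layable_of_strategy hG h2 h3 fun i hi hi' => (h4 i hi hi').trans h
    · exact fun h => Nat.sInf_le (exists_strategy_of_layable hG hc h)

end Game

end HuntersRabbit

namespace HuntersRabbit

open Set

/-! ### Descendants and rooted subtrees -/

section RootedTree

universe u

variable {V : Type u} {T : SimpleGraph V} {r : V}

theorem mem_descendants_self (hT : T.IsTree) (x : V) : x ∈ descendants T r x := by
  obtain ⟨p, hp, -⟩ := hT.existsUnique_path r x
  exact ⟨p, hp, p.end_mem_support⟩

theorem mem_descendants_iff (hT : T.IsTree) {x w : V} {p : T.Walk r w} (hp : p.IsPath) :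
    w ∈ descendants T r x ↔ x ∈ p.support := by
  constructor
  · rintro ⟨q, hq, hx⟩
    rwa [(hT.existsUnique_path r w).unique hp hq]
  · exact fun h => ⟨p, hp, h⟩

theorem isChild_or_isChild (hT : T.IsTree) {x y : V} (h : T.Adj x y) :
    IsChild T r x y ∨ IsChild T r y x := by
  obtain ⟨p, hp, -⟩ := hT.existsUnique_path r x
  obtain ⟨q, hq, -⟩ := hT.existsUnique_path r y
  by_cases hx : x ∈ q.support
  · exact Or.inl ⟨h, q, hq, hx⟩
  · exact Or.inr ⟨h.symm, p, hp,
      hT.isAcyclic.mem_support_of_ne_mem_support_of_adj_of_isPath hp hq h hx⟩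

namespace IsChild

/-- The root path of `c` is that of `x` followed by `c`. With `child_induction` this replaces
reasoning on paths in most of what follows. -/
theorem mem_descendants_iff (hT : T.IsTree) {x c : V} (h : IsChild T r x c) (z : V) :
    c ∈ descendants T r z ↔ x ∈ descendants T r z ∨ z = c := by
  obtain ⟨hadj, q, hq, hx⟩ := h
  obtain ⟨p, hp, -⟩ := hT.existsUnique_path r x
  rw [HuntersRabbit.mem_descendants_iff hT hp, HuntersRabbit.mem_descendants_iff hT hq,
    hT.isAcyclic.path_concat hp hq hadj hx, SimpleGraph.Walk.support_concat]
  simp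

theorem notMem_descendants (hT : T.IsTree) {x c : V} (h : IsChild T r x c) :
    x ∉ descendants T r c := by
  obtain ⟨hadj, q, hq, hx⟩ := h
  obtain ⟨p, hp, -⟩ := hT.existsUnique_path r x
  rw [HuntersRabbit.mem_descendants_iff hT hp]
  exact hT.isAcyclic.ne_mem_support_of_support_of_adj_of_isPath hq hp hadj.symm hx

theorem ne {x c : V} (h : IsChild T r x c) : x ≠ c := h.1.ne

end IsChild

theorem child_induction (hT : T.IsTree) {P : V → Prop} (hr : P r)
    (hc : ∀ x c, IsChild T r x c → P x → P c) (w : V) : P w := by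
  have key : ∀ (u w : V) (p : T.Walk u w), u = r → p.IsPath → P w := by
    intro u w p
    induction p using SimpleGraph.Walk.concatRec with
    | Hnil => rintro rfl _; exact hr
    | Hconcat p' h ih =>
      rintro rfl hp
      refine hc _ _ ⟨h, _, hp, ?_⟩ (ih rfl ?_)
      · exact SimpleGraph.Walk.support_subset_support_concat _ h (SimpleGraph.Walk.end_mem_support _)
      · exact ((SimpleGraph.Walk.concat_isPath_iff h).mp hp).1
  obtain ⟨p, hp, -⟩ := hT.existsUnique_path r w
  exact key r w p rfl hp

theorem root_mem_descendants_iff (hT : T.IsTree) {x : V} : r ∈ descendants T r x ↔ x = r := by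
  rw [mem_descendants_iff hT SimpleGraph.Walk.IsPath.nil]
  simp

theorem descendants_root (hT : T.IsTree) : descendants T r r = univ :=
  eq_univ_of_forall <| child_induction hT (mem_descendants_self hT r) fun _ _ h hx =>
    (h.mem_descendants_iff hT r).mpr (Or.inl hx)

theorem descendants_trans (hT : T.IsTree) {x y w : V} (h : w ∈ descendants T r y)
    (hy : y ∈ descendants T r x) : w ∈ descendants T r x := by
  revert h
  refine child_induction (r := r) hT (P := fun w => w ∈ descendants T r y → w ∈ descendants T r x) ?_ ?_ w
  · intro h
    rwa [(root_mem_descendants_iff hT).mp h] at hy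
  · intro z c hc ih h
    rw [hc.mem_descendants_iff hT] at h ⊢
    rcases h with h | rfl
    · exact Or.inl (ih h)
    · exact (hc.mem_descendants_iff hT x).mp hy

theorem descendants_subset (hT : T.IsTree) {x y : V} (hy : y ∈ descendants T r x) :
    descendants T r y ⊆ descendants T r x := fun _ h => descendants_trans hT h hy

theorem descendants_antisymm (hT : T.IsTree) {x y : V} (h : x ∈ descendants T r y)
    (h' : y ∈ descendants T r x) : x = y := by
  revert h h'
  refine child_induction (r := r) hT
    (P := fun x => x ∈ descendants T r y → y ∈ descendants T r x → x = y) ?_ ?_ x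
  · exact fun h _ => ((root_mem_descendants_iff hT).mp h).symm
  · intro z c hc _ h h'
    rcases (hc.mem_descendants_iff hT y).mp h with h | rfl
    · exact absurd (descendants_trans hT h h') (hc.notMem_descendants hT)
    · rfl

theorem descendants_chain (hT : T.IsTree) {x y w : V} (hx : w ∈ descendants T r x)
    (hy : w ∈ descendants T r y) : x ∈ descendants T r y ∨ y ∈ descendants T r x := by
  revert hx hy
  refine child_induction (r := r) hT (P := fun w => w ∈ descendants T r x → w ∈ descendants T r y →
    x ∈ descendants T r y ∨ y ∈ descendants T r x) ?_ ?_ w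
  · intro hx hy
    rw [root_mem_descendants_iff hT] at hx hy
    subst hx hy
    exact Or.inl (mem_descendants_self hT _)
  · intro z c hc ih hx hy
    rcases (hc.mem_descendants_iff hT x).mp hx with hx' | rfl
    · rcases (hc.mem_descendants_iff hT y).mp hy with hy' | rfl
      · exact ih hx' hy'
      · exact Or.inr hx
    · exact Or.inl hy

theorem exists_isChild_mem_descendants (hT : T.IsTree) {x w : V} (h : w ∈ descendants T r x)
    (hne : w ≠ x) : ∃ c, IsChild T r x c ∧ w ∈ descendants T r c := by
  revert h hne
  refine child_induction (r := r) hT (P := fun w => w ∈ descendants T r x → w ≠ x →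
    ∃ c, IsChild T r x c ∧ w ∈ descendants T r c) ?_ ?_ w
  · exact fun h hne => absurd ((root_mem_descendants_iff hT).mp h).symm hne
  · intro z c hc ih h hne
    rcases (hc.mem_descendants_iff hT x).mp h with h | rfl
    · by_cases hz : z = x
      · subst hz
        exact ⟨c, hc, mem_descendants_self hT c⟩
      · obtain ⟨d, hd, hzd⟩ := ih h hz
        exact ⟨d, hd, (hc.mem_descendants_iff hT d).mpr (Or.inl hzd)⟩
    · exact absurd rfl hne

namespace IsChild

theorem mem_iff_of_ne (hT : T.IsTree) {x c z : V} (h : IsChild T r x c) (hz : z ≠ c) :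
    c ∈ descendants T r z ↔ x ∈ descendants T r z := by
  rw [h.mem_descendants_iff hT]
  simp [hz]

theorem eq_of_mem_descendants (hT : T.IsTree) {x c d w : V} (hc : IsChild T r x c)
    (hd : IsChild T r x d) (h : w ∈ descendants T r c) (h' : w ∈ descendants T r d) : c = d := by
  by_contra hne
  rcases descendants_chain hT h h' with h | h
  · exact hd.notMem_descendants hT ((hc.mem_iff_of_ne hT (Ne.symm hne)).mp h)
  · exact hc.notMem_descendants hT ((hd.mem_iff_of_ne hT hne).mp h)

theorem parent_unique (hT : T.IsTree) {x y c : V} (hx : IsChild T r x c) (hy : IsChild T r y c) :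
    x = y := by
  have h1 := (hx.mem_iff_of_ne hT hy.ne).mp hy.2
  have h2 := (hy.mem_iff_of_ne hT hx.ne).mp hx.2
  exact descendants_antisymm hT h1 h2

theorem disjoint (hT : T.IsTree) {x c d : V} (hc : IsChild T r x c) (hd : IsChild T r x d)
    (hne : c ≠ d) : Disjoint (descendants T r c) (descendants T r d) :=
  Set.disjoint_left.mpr fun _ h h' => hne (hc.eq_of_mem_descendants hT hd h h')

end IsChild

theorem exists_parent (hT : T.IsTree) {w : V} (h : w ≠ r) : ∃ x, IsChild T r x w := by
  revert h
  exact child_induction (r := r) hT (P := fun w => w ≠ r → ∃ x, IsChild T r x w) (fun h => absurd rfl h)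
    (fun x c hc _ _ => ⟨x, hc⟩) w

/-- The only edge leaving the subtree at `x` joins `x` to its parent. -/
theorem isChild_of_adj_of_notMem (hT : T.IsTree) {x y z : V} (hadj : T.Adj y z)
    (hy : y ∈ descendants T r x) (hz : z ∉ descendants T r x) : y = x ∧ IsChild T r z x := by
  rcases isChild_or_isChild (r := r) hT hadj with h | h
  · exact absurd ((h.mem_descendants_iff hT x).mpr (Or.inl hy)) hz
  · rcases (h.mem_descendants_iff hT x).mp hy with h' | rfl
    · exact absurd h' hz
    · exact ⟨rfl, h⟩

/-- `A` is the vertex set of a subtree with top vertex `u` of the rooted tree. -/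
structure Rooted (T : SimpleGraph V) (r u : V) (A : Set V) : Prop where
  top_mem : u ∈ A
  subset : A ⊆ descendants T r u
  parent_mem : ∀ x w, IsChild T r x w → w ∈ A → w ≠ u → x ∈ A

theorem rooted_descendants (hT : T.IsTree) (u : V) : Rooted T r u (descendants T r u) where
  top_mem := mem_descendants_self hT u
  subset := subset_rfl
  parent_mem _ _ h hw hne := (h.mem_iff_of_ne hT hne.symm).mp hw

namespace Rooted

variable {u : V} {A : Set V}

theorem inter_descendants (hT : T.IsTree) (hA : Rooted T r u A) {x : V} (hx : x ∈ A) :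
    Rooted T r x (descendants T r x ∩ A) where
  top_mem := ⟨mem_descendants_self hT x, hx⟩
  subset := inter_subset_left
  parent_mem y w h hw hne := by
    refine ⟨(h.mem_iff_of_ne hT hne.symm).mp hw.1, hA.parent_mem y w h hw.2 ?_⟩
    rintro rfl
    exact hne (descendants_antisymm hT hw.1 (hA.subset hx))

theorem diff_descendants (hT : T.IsTree) (hA : Rooted T r u A) {x : V} (hx : x ∈ A) (hxu : x ≠ u) :
    Rooted T r u (A \ descendants T r x) where
  top_mem := ⟨hA.top_mem, fun h => hxu (descendants_antisymm hT (hA.subset hx) h)⟩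
  subset := sdiff_subset.trans hA.subset
  parent_mem y w h hw hne := ⟨hA.parent_mem y w h hw.1 hne, fun hy =>
    hw.2 ((h.mem_descendants_iff hT x).mpr (Or.inl hy))⟩

/-- Induction over the vertices of a subtree, from its top to the leaves. -/
theorem induction (hT : T.IsTree) (hA : Rooted T r u A) {P : V → Prop} (hu : P u)
    (hc : ∀ x c, IsChild T r x c → x ∈ A → c ∈ A → P x → P c) (w : V) (hw : w ∈ A) : P w := by
  revert hw
  refine child_induction (r := r) hT (P := fun w => w ∈ A → P w) ?_ ?_ w
  · intro hr
    rwa [(root_mem_descendants_iff hT).mp (hA.subset hr)] at hu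
  · intro x c h ih hcA
    by_cases hcu : c = u
    · rwa [hcu]
    · have hx := hA.parent_mem x c h hcA hcu
      exact hc x c h hx hcA (ih hx)

theorem linked (hT : T.IsTree) (hA : Rooted T r u A) : Linked T A := by
  have key : ∀ p : V → Prop, p u → (∃ y ∈ A, ¬ p y) →
      ∃ a ∈ A, ∃ b ∈ A, T.Adj a b ∧ p a ∧ ¬ p b := by
    rintro p hu ⟨y, hy, hpy⟩
    by_contra! hno
    exact hpy (hA.induction hT hu (fun x c h hx hc hpx => hno x hx c hc h.1 hpx) y hy)
  intro p hx hy
  by_cases hu : p u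
  · exact key p hu hy
  · obtain ⟨a, ha, b, hb, hab, h1, h2⟩ := key (fun v => ¬ p v) hu (by simpa using hx)
    exact ⟨b, hb, a, ha, hab.symm, by simpa using h2, h1⟩

theorem connected (hT : T.IsTree) (hA : Rooted T r u A) : (T.induce A).Connected :=
  { preconnected := linked_iff_preconnected.mp (hA.linked hT)
    nonempty := ⟨⟨u, hA.top_mem⟩⟩ }

theorem exists_child (hT : T.IsTree) (hA : Rooted T r u A) {w : V} (hw : w ∈ A) (hwu : w ≠ u) :
    ∃ c ∈ A, IsChild T r u c ∧ w ∈ descendants T r c := by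
  revert hwu
  refine hA.induction hT (P := fun w => w ≠ u → ∃ c ∈ A, IsChild T r u c ∧ w ∈ descendants T r c)
    (fun h => absurd rfl h) ?_ w hw
  intro x c hc _ hcA ih _
  by_cases hx : x = u
  · subst hx
    exact ⟨c, hcA, hc, mem_descendants_self hT c⟩
  · obtain ⟨d, hd, h1, h2⟩ := ih hx
    exact ⟨d, hd, h1, (hc.mem_descendants_iff hT d).mpr (Or.inl h2)⟩

theorem not_isChild_top (hT : T.IsTree) (hA : Rooted T r u A) {x : V} (hx : x ∈ A) :
    ¬ IsChild T r x u := fun h => h.notMem_descendants hT (hA.subset hx)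

theorem ne_top_of_isChild (hT : T.IsTree) (hA : Rooted T r u A) {x c : V} (h : IsChild T r x c)
    (hx : x ∈ A) : c ≠ u := by
  rintro rfl
  exact hA.not_isChild_top hT hx h

theorem linked_insert_child (hT : T.IsTree) (hA : Rooted T r u A) {x c : V} (h : IsChild T r x c)
    (hc : c ∈ A) : Linked T (insert x (descendants T r c ∩ A)) := by
  have hl := (hA.inter_descendants hT hc).linked hT
  have hcm : c ∈ descendants T r c ∩ A := ⟨mem_descendants_self hT c, hc⟩
  intro p hp hq
  by_cases h1 : ∃ a ∈ descendants T r c ∩ A, p a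
  · by_cases h2 : ∃ b ∈ descendants T r c ∩ A, ¬ p b
    · obtain ⟨a, ha, b, hb, hab⟩ := hl p h1 h2
      exact ⟨a, Or.inr ha, b, Or.inr hb, hab⟩
    · push Not at h2
      obtain ⟨y, rfl | hy, hpy⟩ := hq
      · exact ⟨c, Or.inr hcm, y, Or.inl rfl, h.1.symm, h2 c hcm, hpy⟩
      · exact absurd (h2 y hy) hpy
  · push Not at h1
    obtain ⟨y, rfl | hy, hpy⟩ := hp
    · exact ⟨y, Or.inl rfl, c, Or.inr hcm, h.1, hpy, h1 c hcm⟩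
    · exact absurd hpy (h1 y hy)

theorem linked_insert_diff (hT : T.IsTree) (hA : Rooted T r u A) {x : V} (hx : x ∈ A)
    (hxu : x ≠ u) : Linked T (insert x (A \ descendants T r x)) := by
  obtain ⟨y, hy⟩ := exists_parent (r := r) (w := x) hT (by
    rintro rfl
    exact hxu ((root_mem_descendants_iff hT).mp (hA.subset hx)).symm)
  have hyA := hA.parent_mem y x hy hx hxu
  refine Rooted.linked (r := r) (u := u) hT ⟨?_, ?_, ?_⟩
  · exact Or.inr (hA.diff_descendants hT hx hxu).top_mem
  · exact insert_subset (hA.subset hx) (sdiff_subset.trans hA.subset)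
  · rintro z w h (rfl | hw) hne
    · rw [h.parent_unique hT hy]
      exact Or.inr ⟨hyA, hy.notMem_descendants hT⟩
    · exact Or.inr ((hA.diff_descendants hT hx hxu).parent_mem z w h hw hne)

end Rooted

end RootedTree

end HuntersRabbit

namespace HuntersRabbit

open Set

/-! ### Lower and upper bounds for layouts -/

section LayoutBounds

universe u

variable {V : Type u} [Finite V] {T : SimpleGraph V} {A : Set V}

/-- Each branch has a moment at which it contains all active vertices of `A`. The three moments
differ because the branches are disjoint. At the middle one, no edge of the other two branches or
from them to `v` may cross, although one of them has a vertex already past and the other a vertex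
still waiting. -/
theorem not_layable_of_three_branches {m : ℕ} {v : V} (B : Fin 3 → Set V) (hv : v ∈ A)
    (hBA : ∀ i, B i ⊆ A) (hvB : ∀ i, v ∉ B i) (hdisj : ∀ i j, i ≠ j → Disjoint (B i) (B j))
    (hl : ∀ i, Linked T (insert v (B i))) (hB : ∀ i, ¬ Layable T (B i) m) :
    ¬ Layable T A (m + 1) := by
  rintro ⟨s, hs⟩
  -- Some time has more than `m` active vertices inside `B i`, while `A` allows only `m + 1` in all;
  -- so none lies elsewhere.
  have hex : ∀ i, ∃ t, activeSet T A s t ⊆ activeSet T (B i) s t ∧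
      (activeSet T (B i) s t).Nonempty := by
    intro i
    by_contra! hno
    refine hB i ⟨s, fun t => ?_⟩
    by_contra hlt
    have hsub := activeSet_mono (G := T) (hBA i) s t
    have heq := eq_of_subset_of_ncard_le hsub (by have := hs t; omega) (toFinite _)
    have := hno t heq.ge
    simp [this] at hlt
  choose t hsub hne using hex
  have hinj : ∀ i j, i ≠ j → t i ≠ t j := by
    intro i j hij h
    obtain ⟨x, hx⟩ := hne i
    have hx' := hsub j (h ▸ activeSet_mono (hBA i) s _ hx)
    exact disjoint_left.mp (hdisj i j hij) hx.1 hx'.1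
  have key : ∀ i j k, i ≠ j → k ≠ j → ¬ (t i < t j ∧ t j < t k) := by
    rintro i j k hij hkj ⟨h1, h2⟩
    have no : ∀ l, l ≠ j → ∀ a ∈ insert v (B l), ∀ b ∈ insert v (B l), T.Adj a b → s a ≤ t j →
        ¬ t j ≤ s b := by
      intro l hl a ha b hb hab hsa hsb
      have hA : insert v (B l) ⊆ A := insert_subset hv (hBA l)
      have hmem := (hsub j ⟨hA ha, hsa, b, hA hb, hab, hsb⟩).1
      rcases ha with rfl | ha
      · exact hvB j hmem
      · exact disjoint_left.mp (hdisj l j hl) ha hmem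
    obtain ⟨x, hx, hsx, -⟩ := hne i
    obtain ⟨-, -, -, y, hy, -, hsy⟩ := hne k
    -- Whichever side of `t j` the vertex `v` is on, it is linked through its branch to a vertex on
    -- the other side, and an edge has to cross.
    by_cases hsv : s v ≤ t j
    · obtain ⟨a, ha, b, hb, hab, h3, h4⟩ := hl k (fun w => s w ≤ t j) ⟨v, Or.inl rfl, hsv⟩
        ⟨y, Or.inr hy, by omega⟩
      exact no k hkj a ha b hb hab h3 (by omega)
    · obtain ⟨a, ha, b, hb, hab, h3, h4⟩ := hl i (fun w => s w ≤ t j) ⟨x, Or.inr hx, by omega⟩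
        ⟨v, Or.inl rfl, hsv⟩
      exact no i hij a ha b hb hab h3 (by omega)
  have h01 := hinj 0 1 (by decide)
  have h02 := hinj 0 2 (by decide)
  have h12 := hinj 1 2 (by decide)
  have k1 := key 0 1 2 (by decide) (by decide)
  have k2 := key 2 1 0 (by decide) (by decide)
  have k3 := key 1 0 2 (by decide) (by decide)
  have k4 := key 2 0 1 (by decide) (by decide)
  have k5 := key 0 2 1 (by decide) (by decide)
  have k6 := key 1 2 0 (by decide) (by decide)
  omega

/-- Compare `s b` and `s c`. If `s c ≤ s b`, then at time `s b` the vertex `c` is active, and so is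
`a` or `b` according to the order of `s a` and `s b`; the other case is symmetric. -/
theorem not_layable_one_of_path {a b c d : V} (ha : a ∈ A) (hb : b ∈ A) (hc : c ∈ A) (hd : d ∈ A)
    (hab : T.Adj a b) (hbc : T.Adj b c) (hcd : T.Adj c d) (hac : a ≠ c) (hbd : b ≠ d) :
    ¬ Layable T A 1 := by
  rintro ⟨s, hs⟩
  have key : ∀ t, ∀ x ∈ A, ∀ y ∈ A, ∀ x' ∈ A, ∀ y' ∈ A, x ≠ x' → T.Adj x y → T.Adj x' y' →
      ¬ ((s x ≤ t ∧ t ≤ s y) ∧ s x' ≤ t ∧ t ≤ s y') := by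
    rintro t x hx y hy x' hx' y' hy' hne h1 h2 ⟨⟨h3, h4⟩, h5, h6⟩
    refine hne ((ncard_le_one (toFinite _)).mp (hs t) x ⟨hx, h3, y, hy, h1, h4⟩ x'
      ⟨hx', h5, y', hy', h2, h6⟩)
  have k1 := key (s b) a ha b hb c hc b hb hac hab hbc.symm
  have k2 := key (s c) b hb c hc d hd c hc hbd hbc hcd.symm
  have k3 := key (s b) b hb a ha c hc b hb hbc.ne hab.symm hbc.symm
  have k4 := key (s c) b hb c hc c hc d hd hbc.ne hbc hcd
  omega

theorem not_layable_zero_of_adj {a b : V} (ha : a ∈ A) (hb : b ∈ A) (hab : T.Adj a b) :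
    ¬ Layable T A 0 := by
  rintro ⟨s, hs⟩
  have h0 : ∀ t, activeSet T A s t = ∅ := fun t =>
    (ncard_eq_zero (toFinite _)).mp (Nat.le_zero.mp (hs t))
  rcases le_total (s a) (s b) with h | h
  · exact (h0 (s a)).le ⟨ha, le_rfl, b, hb, hab, h⟩
  · exact (h0 (s b)).le ⟨hb, le_rfl, a, ha, hab.symm, h⟩

/-- With the centre at time 0 and everything else at time 1, only the centre is ever active. -/
theorem layable_one_of_center (c : V) (h : ∀ a ∈ A, ∀ b ∈ A, T.Adj a b → a = c ∨ b = c) :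
    Layable T A 1 := by
  classical
  refine ⟨fun v => if v = c then 0 else 1, fun t => (ncard_le_one (toFinite _)).mpr ?_⟩
  have key : ∀ x ∈ activeSet T A (fun v => if v = c then 0 else 1) t, x = c := by
    rintro x ⟨hx, hsx, y, hy, hxy, hsy⟩
    by_contra hne
    rcases h x hx y hy hxy with rfl | rfl
    · exact hne rfl
    · simp [hne] at hsx hsy
      omega
  intro x hx y hy
  rw [key x hx, key y hy]

/-- Run through `L` first and through the rest of `M` afterwards; no edge connects the two phases.
-/
theorem Layable.union {L M : Set V} {k : ℕ} (hL : Layable T L k) (hM : Layable T M k)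
    (hno : ∀ a ∈ L, ∀ b ∈ M, ¬ T.Adj a b) : Layable T (L ∪ M) k := by
  classical
  obtain ⟨s, hs⟩ := hL
  obtain ⟨s', hs'⟩ := hM
  cases isEmpty_or_nonempty V
  · exact ⟨fun _ => 0, fun t => by rw [eq_empty_of_isEmpty (activeSet T _ _ t)]; simp⟩
  obtain ⟨N, hN⟩ := Finite.exists_max s
  refine ⟨fun v => if v ∈ L then s v else s N + 1 + s' v, fun t => ?_⟩
  by_cases ht : t ≤ s N
  · refine le_trans (ncard_le_ncard ?_ (toFinite _)) (hs t)
    rintro x ⟨hx, hsx, y, hy, hxy, hsy⟩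
    have hxL : x ∈ L := by
      by_contra hn
      simp only [hn, if_false] at hsx
      omega
    have hyL : y ∈ L := by
      rcases hy with hy | hy
      · exact hy
      · exact absurd hxy (hno x hxL y hy)
    simp only [hxL, hyL, if_true] at hsx hsy
    exact ⟨hxL, hsx, y, hyL, hxy, hsy⟩
  · refine le_trans (ncard_le_ncard ?_ (toFinite _)) (hs' (t - (s N + 1)))
    rintro x ⟨hx, hsx, y, hy, hxy, hsy⟩
    have hyL : y ∉ L := by
      intro hyL
      simp only [hyL, if_true] at hsy
      have := hN y
      omega
    have hyM := hy.resolve_left hyL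
    have hxL : x ∉ L := fun hxL => hno x hxL y hyM hxy
    simp only [hxL, hyL, if_false] at hsx hsy
    exact ⟨hx.resolve_left hxL, by omega, y, hyM, hxy, by omega⟩

theorem layable_of_cover {k : ℕ} (h : ∀ w ∈ A, ∃ L, w ∈ L ∧ Layable T L k ∧
    ∀ a ∈ L, ∀ b ∈ A, T.Adj a b → b ∈ L) : Layable T A k := by
  induction hn : A.ncard using Nat.strong_induction_on generalizing A with
  | _ n ih =>
    rcases A.eq_empty_or_nonempty with rfl | ⟨w, hw⟩
    · exact ⟨fun _ => 0, fun t => by simp [activeSet]⟩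
    · obtain ⟨L, hwL, hL, hcl⟩ := h w hw
      have h1 : Layable T (A \ L) k := by
        refine ih _ ?_ (fun x hx => ?_) rfl
        · rw [← hn]
          exact ncard_lt_ncard ⟨sdiff_subset, fun h => (h hw).2 hwL⟩ (toFinite _)
        · obtain ⟨M, hxM, hM, hclM⟩ := h x hx.1
          exact ⟨M, hxM, hM, fun a ha b hb hab => hclM a ha b hb.1 hab⟩
      refine (hL.union h1 fun a ha b hb hab => hb.2 (hcl a ha b hb.1 hab)).mono ?_ le_rfl
      intro x hx
      by_cases hxL : x ∈ L
      · exact Or.inl hxL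
      · exact Or.inr ⟨hx, hxL⟩

theorem mul_add_le_mul_add_iff {N a b c d : ℕ} (hb : b < N) (hd : d < N) :
    a * N + b ≤ c * N + d ↔ a < c ∨ a = c ∧ b ≤ d := by
  rcases lt_trichotomy a c with h | rfl | h
  · have := Nat.mul_le_mul_right N (Nat.succ_le_of_lt h)
    rw [Nat.succ_mul] at this
    constructor
    · exact fun _ => Or.inl h
    · intro _; omega
  · simp
  · have := Nat.mul_le_mul_right N (Nat.succ_le_of_lt h)
    rw [Nat.succ_mul] at this
    constructor
    · intro _; omega
    · intro _; omega

/-- A layout obtained by walking along the vertices of `P`, in the order given by `j`, and running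
through everything attached to a vertex of `P` while standing there. -/
theorem layable_of_spine {m : ℕ} (hm : 1 ≤ m) (P : Set V) (j : V → ℕ)
    (h1 : ∀ a b, T.Adj a b → (a ∉ P ∨ b ∉ P) → j a = j b)
    (h2 : ∀ a ∈ P, ∀ b ∈ P, T.Adj a b → j b ≤ j a + 1)
    (h3 : ∀ a ∈ P, ∀ b ∈ P, j a = j b → a = b) (hP : Layable T (A \ P) m) :
    Layable T A (m + 1) := by
  classical
  obtain ⟨s, hs⟩ := hP
  cases isEmpty_or_nonempty V
  · exact ⟨fun _ => 0, fun t => by rw [eq_empty_of_isEmpty (activeSet T _ _ t)]; simp⟩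
  obtain ⟨M, hM⟩ := Finite.exists_max s
  -- Times are two-digit numbers in base `N`: the first digit is the position along the spine, the
  -- second is 0 on the spine and the shifted layout time off it.
  set N := s M + 2 with hN
  let o (v : V) : ℕ := if v ∈ P then 0 else s v + 1
  have ho : ∀ v, o v < N := by
    intro v
    have := hM v
    simp only [o]
    split <;> omega
  have hoP : ∀ v ∈ P, o v = 0 := fun v hv => by simp [o, hv]
  have hoN : ∀ v ∉ P, o v = s v + 1 := fun v hv => by simp [o, hv]
  refine ⟨fun v => j v * N + o v, fun t => ?_⟩
  obtain ⟨J, q, hq, rfl⟩ : ∃ J q, q < N ∧ t = J * N + q :=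
    ⟨t / N, t % N, Nat.mod_lt _ (by omega), by rw [mul_comm]; exact (Nat.div_add_mod t N).symm⟩
  -- A vertex off the spine is never active because of a spine neighbour, which comes earlier in the
  -- same block.
  have hact : ∀ x ∈ activeSet T A (fun v => j v * N + o v) (J * N + q),
      (x ∈ P ∧ (j x = J ∨ q = 0 ∧ j x + 1 = J)) ∨
      (0 < q ∧ x ∈ activeSet T (A \ P) s (q - 1)) := by
    rintro x ⟨hx, hsx, y, hy, hxy, hsy⟩
    rw [mul_add_le_mul_add_iff (ho _) hq] at hsx
    rw [mul_add_le_mul_add_iff hq (ho _)] at hsy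
    by_cases hxP : x ∈ P
    · left
      refine ⟨hxP, ?_⟩
      rw [hoP x hxP] at hsx
      by_cases hyP : y ∈ P
      · have := h2 x hxP y hyP hxy
        rw [hoP y hyP] at hsy
        omega
      · have := h1 x y hxy (Or.inr hyP)
        omega
    · right
      have hj := h1 x y hxy (Or.inl hxP)
      rw [hoN x hxP] at hsx
      by_cases hyP : y ∈ P
      · rw [hoP y hyP] at hsy
        omega
      · rw [hoN y hyP] at hsy
        exact ⟨by omega, ⟨hx, hxP⟩, by omega, y, ⟨hy, hyP⟩, hxy, by omega⟩
  have hone : ∀ i, (P ∩ {x | j x = i}).ncard ≤ 1 := fun i =>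
    (ncard_le_one (toFinite _)).mpr fun a ha b hb => h3 a ha.1 b hb.1 (ha.2.trans hb.2.symm)
  -- At the start of a block up to two consecutive spine vertices are active, and `2 ≤ m + 1` needs
  -- `1 ≤ m`. Later in the block one spine vertex accompanies at most `m` attached ones.
  rcases Nat.eq_zero_or_pos q with rfl | hq0
  · calc _ ≤ ((P ∩ {x | j x = J}) ∪ (P ∩ {x | j x = J - 1})).ncard := by
          refine ncard_le_ncard (fun x hx => ?_) (toFinite _)
          rcases hact x hx with ⟨hxP, h | ⟨-, h⟩⟩ | ⟨h, -⟩
          · exact Or.inl ⟨hxP, h⟩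
          · exact Or.inr ⟨hxP, show j x = J - 1 by omega⟩
          · omega
      _ ≤ 1 + 1 := (ncard_union_le _ _).trans (add_le_add (hone _) (hone _))
      _ ≤ m + 1 := by omega
  · calc _ ≤ ((P ∩ {x | j x = J}) ∪ activeSet T (A \ P) s (q - 1)).ncard := by
          refine ncard_le_ncard (fun x hx => ?_) (toFinite _)
          rcases hact x hx with ⟨hxP, h | ⟨h, -⟩⟩ | ⟨-, h⟩
          · exact Or.inl ⟨hxP, h⟩
          · omega
          · exact Or.inr h
      _ ≤ 1 + m := (ncard_union_le _ _).trans (add_le_add (hone _) (hs _))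
      _ = m + 1 := add_comm _ _

/-- Root the tree at the start `x` of the path. The position of a vertex is the number of path
vertices among its ancestors, itself included; it is constant on whatever hangs off the path and
injective on the path, whose vertices are all ancestors of `y`. -/
theorem layable_of_path (hT : T.IsTree) {m : ℕ} (hm : 1 ≤ m) {x y : V} {p : T.Walk x y}
    (hp : p.IsPath) (h : Layable T (A \ {w | w ∈ p.support}) m) : Layable T A (m + 1) := by
  set P : Set V := {w | w ∈ p.support} with hP
  have hanc : ∀ q ∈ P, ∀ z, q ∈ descendants T x z → z ∈ P := by
    classical
    intro q hq z hz
    rw [mem_descendants_iff hT (hp.takeUntil hq)] at hz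
    exact p.support_takeUntil_subset_support hq hz
  let anc (w : V) : Set V := {z | z ∈ P ∧ w ∈ descendants T x z}
  have hanc_child : ∀ a c, IsChild T x a c → c ∉ P → anc a = anc c := by
    intro a c hc hcP
    ext z
    refine and_congr_right fun hz => ?_
    rw [hc.mem_descendants_iff hT]
    exact ⟨Or.inl, fun h => h.resolve_right (by rintro rfl; exact hcP hz)⟩
  have hparent : ∀ a c, IsChild T x a c → c ∈ P → a ∈ P := fun a c hc hcP => hanc c hcP a hc.2
  refine layable_of_spine hm P (fun w => (anc w).ncard) ?_ ?_ ?_ h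
  · intro a b hab hor
    rcases isChild_or_isChild (r := x) hT hab with hc | hc
    · have hb : b ∉ P := fun hb => hor.elim (fun h => h (hparent a b hc hb)) (fun h => h hb)
      simp only [hanc_child a b hc hb]
    · have ha : a ∉ P := fun ha => hor.elim (fun h => h ha) (fun h => h (hparent b a hc ha))
      simp only [hanc_child b a hc ha]
  · intro a ha b hb hab
    rcases isChild_or_isChild (r := x) hT hab with hc | hc
    · refine (ncard_le_ncard (t := insert b (anc a)) ?_ (toFinite _)).trans (ncard_insert_le _ _)
      rintro z ⟨hz, hbz⟩
      rcases (hc.mem_descendants_iff hT z).mp hbz with h | h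
      · exact Or.inr ⟨hz, h⟩
      · exact Or.inl h
    · refine (ncard_le_ncard ?_ (toFinite _)).trans (Nat.le_succ _)
      exact fun z hz => ⟨hz.1, (hc.mem_descendants_iff hT z).mpr (Or.inl hz.2)⟩
  · have key : ∀ a ∈ P, ∀ b ∈ P, a ∈ descendants T x b → (anc a).ncard = (anc b).ncard → a = b := by
      intro a ha b hb hab hcard
      have hsub : anc b ⊆ anc a := fun z hz => ⟨hz.1, descendants_trans hT hab hz.2⟩
      have heq := eq_of_subset_of_ncard_le hsub hcard.le (toFinite _)
      have : a ∈ anc b := heq ▸ ⟨ha, mem_descendants_self hT a⟩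
      exact descendants_antisymm hT hab this.2
    intro a ha b hb hcard
    have hya : y ∈ descendants T x a := (mem_descendants_iff hT hp).mpr ha
    have hyb : y ∈ descendants T x b := (mem_descendants_iff hT hp).mpr hb
    rcases descendants_chain hT hya hyb with h | h
    · exact key a ha b hb h hcard
    · exact (key b hb a ha h hcard.symm).symm

end LayoutBounds

end HuntersRabbit

namespace HuntersRabbit

open Set

/-! ### The Parsons criterion on rooted subtrees -/

section Forks

universe u

variable {V : Type u} {T : SimpleGraph V} {r u : V} {A : Set V} {m : ℕ}

/-- `c` is a child of `x` in the rooted subtree `A`, and the subtree at `c` has no layout with `m`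
active vertices. -/
def IsHeavyChild (T : SimpleGraph V) (r : V) (A : Set V) (m : ℕ) (x c : V) : Prop :=
  c ∈ A ∧ IsChild T r x c ∧ ¬ Layable T (descendants T r c ∩ A) m

/-- Some vertex has at least three branches in the subtree `A` with top `u` which have no layout
with `m` active vertices. -/
def HasFork (T : SimpleGraph V) (r u : V) (A : Set V) (m : ℕ) : Prop :=
  ∃ x ∈ A, (∃ c₁ c₂ c₃, c₁ ≠ c₂ ∧ c₁ ≠ c₃ ∧ c₂ ≠ c₃ ∧ IsHeavyChild T r A m x c₁ ∧
      IsHeavyChild T r A m x c₂ ∧ IsHeavyChild T r A m x c₃) ∨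
    (x ≠ u ∧ (∃ c₁ c₂, c₁ ≠ c₂ ∧ IsHeavyChild T r A m x c₁ ∧ IsHeavyChild T r A m x c₂) ∧
      ¬ Layable T (A \ descendants T r x) m)

theorem HasFork.not_layable [Finite V] (hT : T.IsTree) (hA : Rooted T r u A)
    (h : HasFork T r u A m) : ¬ Layable T A (m + 1) := by
  have hnot : ∀ {x c}, IsHeavyChild T r A m x c → x ∉ descendants T r c ∩ A := fun h hx =>
    h.2.1.notMem_descendants hT hx.1
  have hdis : ∀ {x c d}, IsHeavyChild T r A m x c → IsHeavyChild T r A m x d → c ≠ d →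
      Disjoint (descendants T r c ∩ A) (descendants T r d ∩ A) := fun hc hd hne =>
    (hc.2.1.disjoint hT hd.2.1 hne).mono inter_subset_left inter_subset_left
  obtain ⟨x, hx, ⟨c₁, c₂, c₃, h12, h13, h23, h1, h2, h3⟩ | ⟨hxu, ⟨c₁, c₂, h12, h1, h2⟩, htop⟩⟩ := h
  · refine not_layable_of_three_branches (v := x)
      ![descendants T r c₁ ∩ A, descendants T r c₂ ∩ A, descendants T r c₃ ∩ A] hx ?_ ?_ ?_ ?_ ?_
    · simp [Fin.forall_fin_succ]
    · simp only [Fin.forall_fin_succ, IsEmpty.forall_iff]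
      exact ⟨hnot h1, hnot h2, hnot h3, trivial⟩
    · have d12 := hdis h1 h2 h12
      have d13 := hdis h1 h3 h13
      have d23 := hdis h2 h3 h23
      simp [Fin.forall_fin_succ, d12, d13, d23, d12.symm, d13.symm, d23.symm]
    · simp only [Fin.forall_fin_succ, IsEmpty.forall_iff]
      exact ⟨hA.linked_insert_child hT h1.2.1 h1.1, hA.linked_insert_child hT h2.2.1 h2.1,
        hA.linked_insert_child hT h3.2.1 h3.1, trivial⟩
    · simp only [Fin.forall_fin_succ, IsEmpty.forall_iff]
      exact ⟨h1.2.2, h2.2.2, h3.2.2, trivial⟩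
  · have hup : ∀ {c}, IsHeavyChild T r A m x c →
        Disjoint (descendants T r c ∩ A) (A \ descendants T r x) := fun hc =>
      disjoint_left.mpr fun y hy hy' => hy'.2 (descendants_trans hT hy.1 hc.2.1.2)
    refine not_layable_of_three_branches (v := x)
      ![descendants T r c₁ ∩ A, descendants T r c₂ ∩ A, A \ descendants T r x] hx ?_ ?_ ?_ ?_ ?_
    · simp [Fin.forall_fin_succ]
    · simp only [Fin.forall_fin_succ, IsEmpty.forall_iff]
      exact ⟨hnot h1, hnot h2, fun h => h.2 (mem_descendants_self hT x), trivial⟩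
    · have d12 := hdis h1 h2 h12
      have d13 := hup h1
      have d23 := hup h2
      simp [Fin.forall_fin_succ, d12, d13, d23, d12.symm, d13.symm, d23.symm]
    · simp only [Fin.forall_fin_succ, IsEmpty.forall_iff]
      exact ⟨hA.linked_insert_child hT h1.2.1 h1.1, hA.linked_insert_child hT h2.2.1 h2.1,
        hA.linked_insert_diff hT hx hxu, trivial⟩
    · simp only [Fin.forall_fin_succ, IsEmpty.forall_iff]
      exact ⟨h1.2.2, h2.2.2, htop, trivial⟩

/-- Off `P`, the set `A` falls into the part above `z` and the subtrees at children of `P` outside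
`P`. No edge of `A \ P` joins different parts, so the layouts of the parts combine. -/
theorem layable_diff_spine [Finite V] (hT : T.IsTree) (hA : Rooted T r u A) {P : Set V} {z : V}
    (hzP : z ∈ P) (hzA : z ∈ A) (htop : Layable T (A \ descendants T r z) m)
    (hside : ∀ q ∈ P, ∀ c, c ∉ P → ¬ IsHeavyChild T r A m q c) : Layable T (A \ P) m := by
  refine layable_of_cover fun w hw => ?_
  by_cases hwz : w ∈ descendants T r z
  · have key : w ∈ P ∨ ∃ q ∈ P, ∃ c ∈ A, c ∉ P ∧ IsChild T r q c ∧ w ∈ descendants T r c := by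
      refine (hA.inter_descendants hT hzA).induction hT (P := fun w => w ∈ P ∨
        ∃ q ∈ P, ∃ c ∈ A, c ∉ P ∧ IsChild T r q c ∧ w ∈ descendants T r c) (Or.inl hzP) ?_ w
        ⟨hwz, hw.1⟩
      rintro x d hd - hdA (hxP | ⟨q, hq, c, hc, hcP, hqc, hxc⟩)
      · by_cases hdP : d ∈ P
        · exact Or.inl hdP
        · exact Or.inr ⟨x, hxP, d, hdA.2, hdP, hd, mem_descendants_self hT d⟩
      · exact Or.inr ⟨q, hq, c, hc, hcP, hqc, (hd.mem_descendants_iff hT c).mpr (Or.inl hxc)⟩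
    obtain ⟨q, hq, c, hc, hcP, hqc, hwc⟩ := key.resolve_left hw.2
    refine ⟨descendants T r c ∩ A, ⟨hwc, hw.1⟩, ?_, fun a ha b hb hab => ?_⟩
    · by_contra hno
      exact hside q hq c hcP ⟨hc, hqc, hno⟩
    · refine ⟨?_, hb.1⟩
      by_contra hbc
      have := (isChild_of_adj_of_notMem hT hab ha.1 hbc).2
      rw [this.parent_unique hT hqc] at hb
      exact hb.2 hq
  · refine ⟨A \ descendants T r z, ⟨hw.1, hwz⟩, htop, fun a ha b hb hab => ⟨hb.1, fun hbz => ?_⟩⟩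
    have := (isChild_of_adj_of_notMem hT hab.symm hbz ha.2).1
    rw [this] at hb
    exact hb.2 hzP

/-- Keep moving to the heavy child, unique by hypothesis, until there is none; all children left
aside are light. -/
theorem exists_downward_path [Finite V] (hT : T.IsTree) (A : Set V) (m : ℕ) (x : V) (hx : x ∈ A)
    (h : ∀ y ∈ descendants T r x, ∀ c₁ c₂, IsHeavyChild T r A m y c₁ →
      IsHeavyChild T r A m y c₂ → c₁ = c₂) :
    ∃ (e : V) (p : T.Walk x e), p.IsPath ∧ (∀ q ∈ p.support, q ∈ descendants T r x) ∧
      ∀ q ∈ p.support, ∀ c, c ∉ p.support → ¬ IsHeavyChild T r A m q c := by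
  induction hn : (descendants T r x).ncard using Nat.strong_induction_on generalizing x with
  | _ n ih =>
    by_cases hc : ∃ c, IsHeavyChild T r A m x c
    · obtain ⟨c, hc⟩ := hc
      have hlt : (descendants T r c).ncard < n := by
        rw [← hn]
        exact ncard_lt_ncard ⟨descendants_subset hT hc.2.1.2, fun hs =>
          hc.2.1.notMem_descendants hT (hs (mem_descendants_self hT x))⟩ (toFinite _)
      obtain ⟨e, p, hp, hsub, hlight⟩ := ih _ hlt c hc.1
        (fun y hy => h y (descendants_trans hT hy hc.2.1.2)) rfl
      refine ⟨e, .cons hc.2.1.1 p, ?_, ?_, ?_⟩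
      · rw [SimpleGraph.Walk.cons_isPath_iff]
        exact ⟨hp, fun hxp => hc.2.1.notMem_descendants hT (hsub x hxp)⟩
      · simp only [SimpleGraph.Walk.support_cons, List.mem_cons, forall_eq_or_imp]
        exact ⟨mem_descendants_self hT x, fun q hq => descendants_trans hT (hsub q hq) hc.2.1.2⟩
      · simp only [SimpleGraph.Walk.support_cons, List.mem_cons, forall_eq_or_imp, not_or]
        refine ⟨fun d hd hxd => hd.2 ?_, fun q hq d hd => hlight q hq d hd.2⟩
        rw [h x (mem_descendants_self hT x) d c hxd hc]
        exact p.start_mem_support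
    · push Not at hc
      refine ⟨x, .nil, .nil, ?_, ?_⟩
      · simpa using mem_descendants_self hT x
      · simpa using fun c _ => hc c

/-- Let `z` be a lowest vertex with two heavy children. The two downward paths through these are
joined at `z`; without a fork, `z` has no third heavy child and the part above it is light. If no
such `z` exists, one downward path from `u` does it. -/
theorem exists_path_of_not_hasFork [Finite V] (hT : T.IsTree) (hA : Rooted T r u A)
    (h : ¬ HasFork T r u A m) :
    ∃ (a b : V) (p : T.Walk a b), p.IsPath ∧ Layable T (A \ {w | w ∈ p.support}) m := by
  by_cases hz : ∃ z, z ∈ A ∧ ∃ c₁ c₂, c₁ ≠ c₂ ∧ IsHeavyChild T r A m z c₁ ∧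
      IsHeavyChild T r A m z c₂
  · obtain ⟨z, ⟨hzA, c₁, c₂, h12, h1, h2⟩, hmin⟩ := exists_min_image
      {z | z ∈ A ∧ ∃ c₁ c₂, c₁ ≠ c₂ ∧ IsHeavyChild T r A m z c₁ ∧ IsHeavyChild T r A m z c₂}
      (fun z => (descendants T r z).ncard) (toFinite _) hz
    -- By minimality of the subtree at `z`, no vertex below it has two heavy children.
    have hbelow : ∀ c, IsHeavyChild T r A m z c → ∀ y ∈ descendants T r c, ∀ d₁ d₂,
        IsHeavyChild T r A m y d₁ → IsHeavyChild T r A m y d₂ → d₁ = d₂ := by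
      intro c hc y hy d₁ d₂ hd₁ hd₂
      by_contra hne
      have hyu : d₁ ≠ u := by
        rintro rfl
        have := descendants_antisymm hT (hA.subset hc.1) (descendants_trans hT hd₁.2.1.2 hy)
        rw [this] at hc
        exact hA.not_isChild_top hT hzA hc.2.1
      have hyA := hA.parent_mem y d₁ hd₁.2.1 hd₁.1 hyu
      refine absurd (hmin y ⟨hyA, d₁, d₂, hne, hd₁, hd₂⟩) (not_le.mpr ?_)
      have hyz := descendants_trans hT hy hc.2.1.2
      refine ncard_lt_ncard ⟨descendants_subset hT hyz, fun hs => ?_⟩ (toFinite _)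
      exact hc.2.1.notMem_descendants hT
        (descendants_trans hT (hs (mem_descendants_self hT z)) hy)
    obtain ⟨e₁, p₁, hp₁, hs₁, hl₁⟩ := exists_downward_path hT A m c₁ h1.1 (hbelow c₁ h1)
    obtain ⟨e₂, p₂, hp₂, hs₂, hl₂⟩ := exists_downward_path hT A m c₂ h2.1 (hbelow c₂ h2)
    let p := (SimpleGraph.Walk.cons h1.2.1.1 p₁).reverse.append (.cons h2.2.1.1 p₂)
    have hsupp : p.support = p₁.support.reverse ++ z :: p₂.support := by
      simp [p, SimpleGraph.Walk.support_append]
    have hz₁ : z ∉ p₁.support := fun h => h1.2.1.notMem_descendants hT (hs₁ z h)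
    have hz₂ : z ∉ p₂.support := fun h => h2.2.1.notMem_descendants hT (hs₂ z h)
    refine ⟨e₁, e₂, p, ?_, ?_⟩
    · rw [SimpleGraph.Walk.isPath_def, hsupp, List.nodup_append]
      refine ⟨List.nodup_reverse.mpr hp₁.support_nodup,
        List.nodup_cons.mpr ⟨hz₂, hp₂.support_nodup⟩, ?_⟩
      rintro a ha b hb rfl
      rw [List.mem_reverse] at ha
      rcases List.mem_cons.mp hb with rfl | hb
      · exact hz₁ ha
      · exact h12 (h1.2.1.eq_of_mem_descendants hT h2.2.1 (hs₁ a ha) (hs₂ a hb))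
    · refine layable_diff_spine hT hA (z := z) ?_ hzA ?_ ?_
      · simp [hsupp]
      · by_cases hzu : z = u
        · subst hzu
          rw [sdiff_eq_empty.mpr hA.subset]
          exact ⟨fun _ => 0, fun t => by simp [activeSet]⟩
        · by_contra htop
          exact h ⟨z, hzA, Or.inr ⟨hzu, ⟨c₁, c₂, h12, h1, h2⟩, htop⟩⟩
      · intro q hq c hcP hqc
        simp only [hsupp, List.mem_append, List.mem_reverse, List.mem_cons, mem_ofPred_eq,
          not_or] at hq hcP
        rcases hq with hq | rfl | hq
        · exact hl₁ q hq c hcP.1 hqc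
        · refine h ⟨q, hzA, Or.inl ⟨c₁, c₂, c, h12, ?_, ?_, h1, h2, hqc⟩⟩
          · rintro rfl
            exact hcP.1 p₁.start_mem_support
          · rintro rfl
            exact hcP.2.2 p₂.start_mem_support
        · exact hl₂ q hq c hcP.2.2 hqc
  · push Not at hz
    obtain ⟨e, p, hp, hs, hl⟩ := exists_downward_path (r := r) hT A m u hA.top_mem (by
      intro y hy c₁ c₂ h1 h2
      by_contra hne
      have hyu : c₁ ≠ u := by
        rintro rfl
        exact h1.2.1.notMem_descendants hT hy
      exact hz y (hA.parent_mem y c₁ h1.2.1 h1.1 hyu) c₁ c₂ hne h1 h2)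
    refine ⟨u, e, p, hp, layable_diff_spine hT hA p.start_mem_support hA.top_mem ?_ hl⟩
    rw [sdiff_eq_empty.mpr hA.subset]
    exact ⟨fun _ => 0, fun t => by simp [activeSet]⟩

/-- A Parsons-like criterion. -/
theorem layable_succ_iff_not_hasFork [Finite V] (hT : T.IsTree) (hA : Rooted T r u A)
    (hm : 1 ≤ m) : Layable T A (m + 1) ↔ ¬ HasFork T r u A m := by
  constructor
  · exact fun h hf => hf.not_layable hT hA h
  · intro h
    obtain ⟨a, b, p, hp, hl⟩ := exists_path_of_not_hasFork hT hA h
    exact layable_of_path hT hm hp hl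

end Forks

end HuntersRabbit

namespace HuntersRabbit

open Set

/-! ### Widths zero and one -/

section Stars

universe u

variable {V : Type u} {G : SimpleGraph V}

/-- Two vertices of degree at least two, with the path between them and one further neighbour at the
end, yield a path on four vertices. In a star all edges meet the centre. -/
theorem layable_one_iff_isStar [Finite V] (hG : G.IsTree) :
    Layable G univ 1 ↔ IsStar G ∨ Nat.card V = 1 := by
  classical
  have := hG.connected.nonempty
  have hpos : 0 < Nat.card V := Nat.card_pos
  have hl := linked_univ hG.connected.preconnected
  constructor
  · intro h
    by_cases h1 : Nat.card V = 1
    · exact Or.inr h1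
    refine Or.inl ⟨hG, by omega, fun x y hx hy => ?_⟩
    by_contra hxy
    have hnbr : ∀ z w, 2 ≤ (G.neighborSet z).ncard → ∃ a, G.Adj z a ∧ a ≠ w := by
      intro z w hz
      obtain ⟨a, ha, haw⟩ := exists_ne_of_one_lt_ncard (s := G.neighborSet z) hz w
      exact ⟨a, ha, haw⟩
    obtain ⟨p, hp, -⟩ := hG.existsUnique_path x y
    match p, hp with
    | .nil, _ => exact hxy rfl
    | .cons (v := x') hxx' q, hp =>
      rw [SimpleGraph.Walk.cons_isPath_iff] at hp
      -- Either the path from `x` goes on after `x'`, or `x'` is the other vertex of degree at least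
      -- two.
      have hd : ∃ d, G.Adj x' d ∧ d ≠ x := by
        match q, hp with
        | .nil, _ => exact hnbr _ _ hy
        | .cons (v := x'') h' q', hp =>
          refine ⟨x'', h', ?_⟩
          rintro rfl
          exact hp.2 (by simp)
      obtain ⟨d, hd, hdx⟩ := hd
      obtain ⟨a, ha, hax⟩ := hnbr x x' hx
      exact not_layable_one_of_path (A := univ) trivial trivial trivial trivial ha.symm hxx' hd hax
        hdx.symm h
  · rintro (⟨-, hcard, hdeg⟩ | h1)
    · obtain ⟨c, hc⟩ : ∃ c, ∀ x, x ≠ c → (G.neighborSet x).ncard ≤ 1 := by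
        by_cases hex : ∃ c, 2 ≤ (G.neighborSet c).ncard
        · obtain ⟨c, hc⟩ := hex
          exact ⟨c, fun x hx => by by_contra hlt; exact hx (hdeg x c (by omega) hc)⟩
        · push Not at hex
          -- If no degree reaches two, any vertex serves as centre: an edge avoiding it would be a
          -- separate component.
          exact ⟨Classical.arbitrary V, fun x _ => by have := hex x; omega⟩
      refine layable_one_of_center c fun a _ b _ hab => ?_
      by_contra! hne
      have huniq : ∀ x, x ≠ c → ∀ y z, G.Adj x y → G.Adj x z → y = z := fun x hx y z hy hz =>
        (ncard_le_one (toFinite _)).mp (hc x hx) y hy z hz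
      obtain ⟨x, -, y, -, hxy, hx, hy⟩ := hl (fun w => w = a ∨ w = b) ⟨a, trivial, Or.inl rfl⟩
        ⟨c, trivial, by rintro (rfl | rfl) <;> simp at hne⟩
      rcases hx with rfl | rfl
      · exact hy (Or.inr (huniq _ hne.1 _ _ hxy hab))
      · exact hy (Or.inl (huniq _ hne.2 _ _ hxy hab.symm))
    · have hsub : Subsingleton V := (Nat.card_eq_one_iff_unique.mp h1).1
      exact layable_one_of_center (Classical.arbitrary V) fun a _ b _ _ =>
        Or.inl (Subsingleton.elim _ _)

theorem layable_zero_iff [Finite V] (hG : G.Connected) :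
    Layable G univ 0 ↔ Nat.card V = 1 := by
  have := hG.nonempty
  constructor
  · intro h
    by_contra h1
    have hnt : Nontrivial V :=
      Finite.one_lt_card_iff_nontrivial.mp (by have := Nat.card_pos (α := V); omega)
    obtain ⟨w, hw⟩ := hG.preconnected.exists_adj_of_nontrivial (Classical.arbitrary V)
    exact not_layable_zero_of_adj (A := univ) trivial trivial hw h
  · intro h1
    rw [← monotoneHunterNumber_le_iff hG]
    simp [monotoneHunterNumber, h1]

end Stars

/-! ### Components and branches as vertex sets -/

section Components

universe u

variable {V : Type u} {T : SimpleGraph V} {k : ℕ}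

theorem layable_image_val_iff [Finite V] {S : Set V} {B : Set S} :
    Layable T (Subtype.val '' B) k ↔ Layable (T.induce S) B k := by
  classical
  constructor
  · exact fun h => h.comap Subtype.val Subtype.val_injective.injOn (mapsTo_image _ _)
      (fun _ _ _ _ h => h) (toFinite _)
  · rcases B.eq_empty_or_nonempty with rfl | ⟨b, hb⟩
    · exact fun _ => ⟨fun _ => 0, fun t => by simp [activeSet]⟩
    · intro h
      refine h.comap (fun v => if hv : v ∈ S then ⟨v, hv⟩ else b) ?_ ?_ ?_ (toFinite _)
      · rintro _ ⟨x, hx, rfl⟩ _ ⟨y, hy, rfl⟩ hxy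
        have : x = y := by simpa using hxy
        rw [this]
      · rintro _ ⟨x, hx, rfl⟩
        simpa using hx
      · rintro _ ⟨x, hx, rfl⟩ _ ⟨y, hy, rfl⟩ hxy
        simpa using hxy

/-- The vertices of a component of an induced subgraph. -/
def componentVerts {S : Set V} (C : (T.induce S).ConnectedComponent) : Set V :=
  Subtype.val '' C.supp

theorem layable_toSimpleGraph_iff [Finite V] {S : Set V} (C : (T.induce S).ConnectedComponent) :
    Layable C.toSimpleGraph univ k ↔ Layable T (componentVerts C) k := by
  rw [componentVerts, layable_image_val_iff]
  exact layable_induce_iff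

theorem mhComponent_le_iff [Finite V] {S : Set V} (C : (T.induce S).ConnectedComponent) :
    monotoneHunterNumber C.toSimpleGraph ≤ k ↔ Layable T (componentVerts C) k := by
  rw [← layable_toSimpleGraph_iff]
  exact monotoneHunterNumber_le_iff C.connected_toSimpleGraph

theorem layable_of_components [Finite V] {A : Set V}
    (h : ∀ C : (T.induce A).ConnectedComponent, Layable T (componentVerts C) k) :
    Layable T A k := by
  refine layable_of_cover fun w hw =>
    ⟨componentVerts ((T.induce A).connectedComponentMk ⟨w, hw⟩), ⟨⟨w, hw⟩, rfl, rfl⟩, h _, ?_⟩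
  rintro _ ⟨a, ha, rfl⟩ b hb hab
  refine ⟨⟨b, hb⟩, ?_, rfl⟩
  rw [SimpleGraph.ConnectedComponent.mem_supp_iff] at ha ⊢
  rw [← ha, SimpleGraph.ConnectedComponent.eq]
  exact SimpleGraph.Adj.reachable (by simpa using hab.symm)

theorem componentVerts_injective {S : Set V} {C D : (T.induce S).ConnectedComponent} {x : V}
    (hC : x ∈ componentVerts C) (hD : x ∈ componentVerts D) : C = D := by
  obtain ⟨a, ha, rfl⟩ := hC
  obtain ⟨b, hb, hab⟩ := hD
  rw [Subtype.val_injective hab] at hb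
  rw [SimpleGraph.ConnectedComponent.mem_supp_iff] at ha hb
  rw [← ha, ← hb]

theorem exists_branch_componentVerts_eq {v : V} {L : Set V} (hv : v ∉ L) (hL : Linked T L)
    (hne : L.Nonempty) (hcl : ∀ a ∈ L, ∀ b, b ≠ v → T.Adj a b → b ∈ L) :
    ∃ B : Branch T v, componentVerts B = L := by
  obtain ⟨l, hl⟩ := hne
  have hne : ∀ x ∈ L, x ≠ v := by
    rintro x hx rfl
    exact hv hx
  refine ⟨(T.induce {w | w ≠ v}).connectedComponentMk ⟨l, hne l hl⟩, Subset.antisymm ?_ ?_⟩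
  · rintro _ ⟨a, ha, rfl⟩
    rw [SimpleGraph.ConnectedComponent.mem_supp_iff, SimpleGraph.ConnectedComponent.eq] at ha
    obtain ⟨w⟩ := ha.symm
    by_contra hna
    obtain ⟨d, -, h1, h2⟩ := w.exists_boundary_dart {z | z.1 ∈ L} hl hna
    exact h2 (hcl _ h1 _ d.snd.2 (by simpa using d.adj))
  · intro x hx
    refine ⟨⟨x, hne x hx⟩, ?_, rfl⟩
    rw [SimpleGraph.ConnectedComponent.mem_supp_iff, SimpleGraph.ConnectedComponent.eq]
    have h := linked_iff_preconnected.mp hL ⟨x, hx⟩ ⟨l, hl⟩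
    exact h.map (f := (⟨fun z => ⟨z.1, hne z.1 z.2⟩, fun h => h⟩ :
      T.induce L →g T.induce {w | w ≠ v}))

end Components

/-! ### The Parsons lemma for trees -/

section Parsons

universe u

variable {V : Type u} {T : SimpleGraph V} {r : V}

theorem exists_branch_of_isChild (hT : T.IsTree) {x c : V} (h : IsChild T r x c) :
    ∃ B : Branch T x, componentVerts B = descendants T r c := by
  refine exists_branch_componentVerts_eq (h.notMem_descendants hT)
    ((rooted_descendants hT c).linked hT) ⟨c, mem_descendants_self hT c⟩ fun a ha b hb hab => ?_
  by_contra hbc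
  exact hb ((isChild_of_adj_of_notMem hT hab ha hbc).2.parent_unique hT h)

theorem exists_isChild_of_branch (hT : T.IsTree) {v : V} (B : Branch T v) :
    ∃ c, IsChild T v v c ∧ componentVerts B = descendants T v c := by
  obtain ⟨b, hb⟩ := B.nonempty_supp
  have hbB : b.1 ∈ componentVerts B := ⟨b, hb, rfl⟩
  obtain ⟨c, hc, hbc⟩ := exists_isChild_mem_descendants (r := v) (x := v) (w := b.1) hT
    (by rw [descendants_root hT]; trivial) b.2
  obtain ⟨B', hB'⟩ := exists_branch_of_isChild hT hc
  refine ⟨c, hc, ?_⟩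
  rw [← hB'] at hbc ⊢
  rw [componentVerts_injective hbB hbc]

theorem rooted_univ (hT : T.IsTree) (r : V) : Rooted T r r univ := by
  rw [← descendants_root (r := r) hT]
  exact rooted_descendants hT r

/-- The branches at a vertex are the subtrees at its children and, away from the root, the rest of
the tree above it. -/
theorem hasFork_iff_branches [Finite V] (hT : T.IsTree) (r : V) {m : ℕ} (hm : 1 ≤ m) :
    HasFork T r r univ m ↔ ∃ (v : V) (B₁ B₂ B₃ : Branch T v), B₁ ≠ B₂ ∧ B₁ ≠ B₃ ∧ B₂ ≠ B₃ ∧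
      ¬ Layable T (componentVerts B₁) m ∧ ¬ Layable T (componentVerts B₂) m ∧
      ¬ Layable T (componentVerts B₃) m := by
  have hne : ∀ {v : V} {B C : Branch T v}, Disjoint (componentVerts B) (componentVerts C) →
      B ≠ C := by
    rintro v B _ hd rfl
    obtain ⟨b, hb⟩ := B.nonempty_supp
    exact disjoint_left.mp hd ⟨b, hb, rfl⟩ ⟨b, hb, rfl⟩
  constructor
  · rintro ⟨x, -, ⟨c₁, c₂, c₃, h12, h13, h23, h1, h2, h3⟩ | ⟨hxu, ⟨c₁, c₂, h12, h1, h2⟩, htop⟩⟩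
    · obtain ⟨B₁, e1⟩ := exists_branch_of_isChild hT h1.2.1
      obtain ⟨B₂, e2⟩ := exists_branch_of_isChild hT h2.2.1
      obtain ⟨B₃, e3⟩ := exists_branch_of_isChild hT h3.2.1
      refine ⟨x, B₁, B₂, B₃, hne ?_, hne ?_, hne ?_, ?_, ?_, ?_⟩
      · rw [e1, e2]; exact h1.2.1.disjoint hT h2.2.1 h12
      · rw [e1, e3]; exact h1.2.1.disjoint hT h3.2.1 h13
      · rw [e2, e3]; exact h2.2.1.disjoint hT h3.2.1 h23
      · rw [e1]; simpa using h1.2.2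
      · rw [e2]; simpa using h2.2.2
      · rw [e3]; simpa using h3.2.2
    · obtain ⟨B₁, e1⟩ := exists_branch_of_isChild hT h1.2.1
      obtain ⟨B₂, e2⟩ := exists_branch_of_isChild hT h2.2.1
      have hR := (rooted_univ hT r).diff_descendants hT (mem_univ x) hxu
      obtain ⟨B₃, e3⟩ := exists_branch_componentVerts_eq (v := x)
        (fun h => h.2 (mem_descendants_self hT x)) (hR.linked hT) ⟨r, hR.top_mem⟩
        (fun a ha b hb hab => ⟨trivial, fun hbx =>
          hb (isChild_of_adj_of_notMem hT hab.symm hbx ha.2).1⟩)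
      have hup : ∀ {c}, IsChild T r x c →
          Disjoint (descendants T r c) (univ \ descendants T r x) := fun hc =>
        disjoint_left.mpr fun y hy hy' => hy'.2 (descendants_trans hT hy hc.2)
      refine ⟨x, B₁, B₂, B₃, hne ?_, hne ?_, hne ?_, ?_, ?_, ?_⟩
      · rw [e1, e2]; exact h1.2.1.disjoint hT h2.2.1 h12
      · rw [e1, e3]; exact hup h1.2.1
      · rw [e2, e3]; exact hup h2.2.1
      · rw [e1]; simpa using h1.2.2
      · rw [e2]; simpa using h2.2.2
      · rw [e3]; exact htop
  · rintro ⟨v, B₁, B₂, B₃, h12, h13, h23, h1, h2, h3⟩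
    -- Having a fork is equivalent to needing more than `m + 1` hunters, which does not depend on
    -- the root. Rooting at `v` turns its branches into children.
    rw [← not_not (a := HasFork T r r univ m),
      ← layable_succ_iff_not_hasFork hT (rooted_univ hT r) hm,
      layable_succ_iff_not_hasFork hT (rooted_univ hT v) hm, not_not]
    obtain ⟨c₁, hc1, e1⟩ := exists_isChild_of_branch hT B₁
    obtain ⟨c₂, hc2, e2⟩ := exists_isChild_of_branch hT B₂
    obtain ⟨c₃, hc3, e3⟩ := exists_isChild_of_branch hT B₃
    have hcne : ∀ {B C : Branch T v} {c d : V}, B ≠ C → componentVerts B = descendants T v c →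
        componentVerts C = descendants T v d → c ≠ d := by
      rintro B C c d hBC h h' rfl
      have hc := mem_descendants_self (r := v) hT c
      exact hBC (componentVerts_injective (h ▸ hc) (h' ▸ hc))
    rw [e1] at h1
    rw [e2] at h2
    rw [e3] at h3
    exact ⟨v, trivial, Or.inl ⟨c₁, c₂, c₃, hcne h12 e1 e2, hcne h13 e1 e3, hcne h23 e2 e3,
      ⟨trivial, hc1, by simpa using h1⟩, ⟨trivial, hc2, by simpa using h2⟩,
      ⟨trivial, hc3, by simpa using h3⟩⟩⟩

theorem mh_eq_zero_iff [Finite V] (hT : T.IsTree) :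
    monotoneHunterNumber T = 0 ↔ Nat.card V = 1 := by
  rw [← Nat.le_zero, monotoneHunterNumber_le_iff hT.connected, layable_zero_iff hT.connected]

theorem mh_le_one_iff [Finite V] (hT : T.IsTree) :
    monotoneHunterNumber T ≤ 1 ↔ IsStar T ∨ Nat.card V = 1 := by
  rw [monotoneHunterNumber_le_iff hT.connected, layable_one_iff_isStar hT]

theorem mh_eq_one_iff [Finite V] (hT : T.IsTree) : monotoneHunterNumber T = 1 ↔ IsStar T := by
  have h0 := mh_eq_zero_iff hT
  have h1 := mh_le_one_iff hT
  have h2 : IsStar T → Nat.card V ≠ 1 := fun h => by have := h.2.1; omega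
  constructor
  · intro h
    rcases h1.mp h.le with h' | h'
    · exact h'
    · have := h0.mpr h'
      omega
  · intro h
    have := h1.mpr (Or.inl h)
    have : monotoneHunterNumber T ≠ 0 := fun h' => h2 h (h0.mp h')
    omega

theorem mh_le_two_iff [Finite V] (hT : T.IsTree) :
    monotoneHunterNumber T ≤ 2 ↔ ∃ (x y : V) (p : T.Walk x y), p.IsPath ∧
      ∀ C : (T.induce {w | w ∉ p.support}).ConnectedComponent,
        IsStar C.toSimpleGraph ∨ Nat.card C = 1 := by
  have hcomp : ∀ (S : Set V) (C : (T.induce S).ConnectedComponent),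
      (IsStar C.toSimpleGraph ∨ Nat.card C = 1) ↔ Layable T (componentVerts C) 1 := by
    intro S C
    rw [← layable_toSimpleGraph_iff]
    exact (layable_one_iff_isStar ((hT.isAcyclic.induce S).isTree_connectedComponent C)).symm
  have hdiff : ∀ S : Set V, univ \ S = {w | w ∉ S} := fun S => (compl_eq_univ_sdiff S).symm
  rw [monotoneHunterNumber_le_iff hT.connected]
  obtain ⟨r⟩ := hT.connected.nonempty
  constructor
  · intro h
    obtain ⟨a, b, p, hp, hl⟩ := exists_path_of_not_hasFork hT (rooted_univ hT r)
      ((layable_succ_iff_not_hasFork hT (rooted_univ hT r) le_rfl).mp h)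
    refine ⟨a, b, p, hp, fun C => (hcomp _ C).mpr (hl.mono ?_ le_rfl)⟩
    rintro _ ⟨w, -, rfl⟩
    exact ⟨trivial, w.2⟩
  · rintro ⟨x, y, p, hp, hC⟩
    refine layable_of_path hT le_rfl hp ?_
    rw [hdiff]
    exact layable_of_components fun C => (hcomp _ C).mp (hC C)

theorem mh_eq_two_iff [Finite V] (hT : T.IsTree) :
    monotoneHunterNumber T = 2 ↔ Nat.card V ≠ 1 ∧ ¬ IsStar T ∧
      ∃ (x y : V) (p : T.Walk x y), p.IsPath ∧
      ∀ C : (T.induce {w | w ∉ p.support}).ConnectedComponent,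
        IsStar C.toSimpleGraph ∨ Nat.card C = 1 := by
  have h1 := mh_le_one_iff hT
  rw [← mh_le_two_iff hT, ← and_assoc, ← not_or, or_comm, ← h1]
  omega

theorem le_mh_iff [Finite V] (hT : T.IsTree) (k : ℕ) (hk : 3 ≤ k) :
    k ≤ monotoneHunterNumber T ↔ ∃ (v : V) (B₁ B₂ B₃ : Branch T v),
      B₁ ≠ B₂ ∧ B₁ ≠ B₃ ∧ B₂ ≠ B₃ ∧
      k - 1 ≤ monotoneHunterNumber B₁.toSimpleGraph ∧
      k - 1 ≤ monotoneHunterNumber B₂.toSimpleGraph ∧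
      k - 1 ≤ monotoneHunterNumber B₃.toSimpleGraph := by
  obtain ⟨m, rfl⟩ : ∃ m, k = m + 2 := ⟨k - 2, by omega⟩
  obtain ⟨r⟩ := hT.connected.nonempty
  have h1 : m + 2 ≤ monotoneHunterNumber T ↔ ¬ Layable T univ (m + 1) := by
    rw [← monotoneHunterNumber_le_iff hT.connected]
    omega
  have h2 : ∀ (v : V) (B : Branch T v), m + 2 - 1 ≤ monotoneHunterNumber B.toSimpleGraph ↔
      ¬ Layable T (componentVerts B) m := by
    intro v B
    rw [← mhComponent_le_iff]
    omega
  rw [h1, layable_succ_iff_not_hasFork hT (rooted_univ hT r) (by omega), not_not,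
    hasFork_iff_branches hT r (by omega)]
  simp only [h2]

end Parsons

end HuntersRabbit

namespace HuntersRabbit

open Set

/-! ### Width and critical vertices -/

section Width

universe u

variable {V : Type u} {T : SimpleGraph V} {r u : V} {A : Set V} {k : ℕ}

/-- The least number of active vertices of a layout of the subgraph induced by `A`. -/
noncomputable def layoutWidth (T : SimpleGraph V) (A : Set V) : ℕ := sInf {k | Layable T A k}

theorem layoutWidth_le_iff [Finite V] : layoutWidth T A ≤ k ↔ Layable T A k := by
  constructor
  · exact fun h => (Nat.sInf_mem (s := {k | Layable T A k}) ⟨_, layable_card T A⟩).mono subset_rfl h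
  · exact fun h => Nat.sInf_le h

theorem layable_layoutWidth [Finite V] (T : SimpleGraph V) (A : Set V) : Layable T A (layoutWidth T A) :=
  layoutWidth_le_iff.mp le_rfl

theorem layoutWidth_mono [Finite V] {B : Set V} (h : A ⊆ B) : layoutWidth T A ≤ layoutWidth T B :=
  layoutWidth_le_iff.mpr ((layable_layoutWidth T B).mono h le_rfl)

theorem layoutWidth_eq_succ_iff [Finite V] :
    layoutWidth T A = k + 1 ↔ Layable T A (k + 1) ∧ ¬ Layable T A k := by
  rw [← layoutWidth_le_iff, ← layoutWidth_le_iff]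
  omega

theorem mhOn_eq_layoutWidth [Finite V] (h : (T.induce A).Connected) : mhOn T A = layoutWidth T A :=
  eq_of_forall_ge_iff fun k => by
    rw [mhOn, monotoneHunterNumber_le_iff h, layable_induce_iff, layoutWidth_le_iff]

theorem Rooted.mhOn_eq [Finite V] (hT : T.IsTree) (hA : Rooted T r u A) : mhOn T A = layoutWidth T A :=
  mhOn_eq_layoutWidth (hA.connected hT)

theorem mhOn_univ [Finite V] (hT : T.IsTree) : mhOn T univ = monotoneHunterNumber T := by
  obtain ⟨r⟩ := hT.connected.nonempty
  refine eq_of_forall_ge_iff fun k => ?_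
  rw [(rooted_univ hT r).mhOn_eq hT, layoutWidth_le_iff, monotoneHunterNumber_le_iff hT.connected]

/-- Criticality, phrased by means of layouts. -/
def Critical (T : SimpleGraph V) (r : V) (A : Set V) (k : ℕ) (x : V) : Prop :=
  x ∈ A ∧ layoutWidth T (descendants T r x ∩ A) = k ∧
    ((2 ≤ k ∧ ∃ v₁ v₂, v₁ ≠ v₂ ∧
        (IsChild T r x v₁ ∧ v₁ ∈ A ∧ layoutWidth T (descendants T r v₁ ∩ A) = k) ∧
        (IsChild T r x v₂ ∧ v₂ ∈ A ∧ layoutWidth T (descendants T r v₂ ∩ A) = k)) ∨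
      (k = 1 ∧ ∃! v, IsChild T r x v ∧ v ∈ A ∧ layoutWidth T (descendants T r v ∩ A) = 1))

theorem Rooted.isCritical_iff [Finite V] (hT : T.IsTree) (hA : Rooted T r u A) (x : V) :
    IsCritical T r A k x ↔ Critical T r A k x := by
  have h : ∀ v ∈ A, mhOn T (descendants T r v ∩ A) = layoutWidth T (descendants T r v ∩ A) :=
    fun v hv => (hA.inter_descendants hT hv).mhOn_eq hT
  have h' : ∀ (y v : V) (j : ℕ), (IsChild T r y v ∧ v ∈ A ∧ mhOn T (descendants T r v ∩ A) = j) ↔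
      (IsChild T r y v ∧ v ∈ A ∧ layoutWidth T (descendants T r v ∩ A) = j) := fun y v j =>
    and_congr_right fun _ => and_congr_right fun hv => by rw [h v hv]
  unfold IsCritical Critical
  refine and_congr_right fun hx => ?_
  rw [h x hx]
  simp only [h']

theorem Critical.pos {x : V} (h : Critical T r A k x) : 1 ≤ k := by
  rcases h.2.2 with h | h <;> omega

theorem Critical.exists_child {x : V} (h : Critical T r A k x) :
    ∃ v, IsChild T r x v ∧ v ∈ A ∧ layoutWidth T (descendants T r v ∩ A) = k := by
  rcases h.2.2 with ⟨-, v, -, -, hv, -⟩ | ⟨rfl, v, hv, -⟩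
  · exact ⟨v, hv⟩
  · exact ⟨v, hv⟩

/-- Criticality of `x` only concerns what lies below `x`, so it may be tested inside any subtree
whose top is an ancestor of `x`. -/
theorem critical_inter_iff (hT : T.IsTree) {c x : V} (hx : x ∈ descendants T r c) :
    Critical T r (descendants T r c ∩ A) k x ↔ Critical T r A k x := by
  have h1 : ∀ y ∈ descendants T r c,
      descendants T r y ∩ (descendants T r c ∩ A) = descendants T r y ∩ A := fun y hy => by
    rw [← inter_assoc, inter_eq_left.mpr (descendants_subset hT hy)]
  have h2 : ∀ (v : V) (j : ℕ), (IsChild T r x v ∧ v ∈ descendants T r c ∩ A ∧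
        layoutWidth T (descendants T r v ∩ (descendants T r c ∩ A)) = j) ↔
      (IsChild T r x v ∧ v ∈ A ∧ layoutWidth T (descendants T r v ∩ A) = j) := by
    intro v j
    refine and_congr_right fun hv => ?_
    have hvc := descendants_trans hT hv.2 hx
    rw [h1 v hvc]
    exact and_congr_left fun _ => ⟨fun h => h.2, fun h => ⟨hvc, h⟩⟩
  unfold Critical
  rw [h1 x hx]
  simp only [h2]
  exact and_congr_left fun _ => ⟨fun h => h.2, fun h => ⟨hx, h⟩⟩

theorem Critical.two_heavy [Finite V] {x : V} (hk : 1 ≤ k) (h : Critical T r A (k + 1) x) :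
    ∃ c₁ c₂, c₁ ≠ c₂ ∧ IsHeavyChild T r A k x c₁ ∧ IsHeavyChild T r A k x c₂ := by
  rcases h.2.2 with ⟨-, c₁, c₂, hne, h1, h2⟩ | ⟨h, -⟩
  · exact ⟨c₁, c₂, hne, ⟨h1.2.1, h1.1, (layoutWidth_eq_succ_iff.mp h1.2.2).2⟩,
      ⟨h2.2.1, h2.1, (layoutWidth_eq_succ_iff.mp h2.2.2).2⟩⟩
  · omega

theorem critical_of_two_heavy [Finite V] (hT : T.IsTree) {x c₁ c₂ : V} (hk : 1 ≤ k) (hx : x ∈ A)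
    (hw : Layable T (descendants T r x ∩ A) (k + 1)) (hne : c₁ ≠ c₂)
    (h1 : IsHeavyChild T r A k x c₁) (h2 : IsHeavyChild T r A k x c₂) :
    Critical T r A (k + 1) x := by
  have hsub : ∀ c, IsHeavyChild T r A k x c → descendants T r c ∩ A ⊆ descendants T r x ∩ A :=
    fun c hc => inter_subset_inter_left _ (descendants_subset hT hc.2.1.2)
  have hc : ∀ c, IsHeavyChild T r A k x c →
      IsChild T r x c ∧ c ∈ A ∧ layoutWidth T (descendants T r c ∩ A) = k + 1 := fun c hc =>
    ⟨hc.2.1, hc.1, layoutWidth_eq_succ_iff.mpr ⟨hw.mono (hsub c hc) le_rfl, hc.2.2⟩⟩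
  refine ⟨hx, layoutWidth_eq_succ_iff.mpr ⟨hw, fun h => h1.2.2 (h.mono (hsub _ h1) le_rfl)⟩,
    Or.inl ⟨by omega, c₁, c₂, hne, hc c₁ h1, hc c₂ h2⟩⟩

/-- Let `x ≠ y` be critical with `x` not below `y`. What remains after removing the subtree at `y`
is still heavy: it contains the subtree at `x`, or, if `y` is below `x`, a heavy child of `x` not
above `y`. With the two heavy children of `y` this is a fork. -/
theorem Critical.eq [Finite V] (hT : T.IsTree) (hA : Rooted T r u A) (hk : 1 ≤ k) (hw : Layable T A (k + 1))
    {x y : V} (hx : Critical T r A (k + 1) x) (hy : Critical T r A (k + 1) y) : x = y := by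
  have key : ∀ {x y}, Critical T r A (k + 1) x → Critical T r A (k + 1) y → x ≠ y →
      x ∉ descendants T r y → False := by
    intro x y hx hy hne hxy
    have hyu : y ≠ u := by
      rintro rfl
      exact hxy (hA.subset hx.1)
    refine HasFork.not_layable hT hA ⟨y, hy.1, Or.inr ⟨hyu, hy.two_heavy hk, fun htop => ?_⟩⟩ hw
    by_cases hyx : y ∈ descendants T r x
    · obtain ⟨c₁, c₂, h12, h1, h2⟩ := hx.two_heavy hk
      have : ∃ c, IsHeavyChild T r A k x c ∧ y ∉ descendants T r c := by
        by_cases h : y ∈ descendants T r c₁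
        · exact ⟨c₂, h2, fun h' => h12 (h1.2.1.eq_of_mem_descendants hT h2.2.1 h h')⟩
        · exact ⟨c₁, h1, h⟩
      obtain ⟨c, hc, hyc⟩ := this
      refine hc.2.2 (htop.mono (fun w hw => ⟨hw.2, fun hwy => ?_⟩) le_rfl)
      rcases descendants_chain hT hw.1 hwy with h | h
      · rcases (hc.2.1.mem_descendants_iff hT y).mp h with h | rfl
        · exact hxy h
        · exact hyc (mem_descendants_self hT y)
      · exact hyc h
    · refine (layoutWidth_eq_succ_iff.mp hx.2.1).2
        (htop.mono (fun w hw => ⟨hw.2, fun hwy => ?_⟩) le_rfl)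
      exact (descendants_chain hT hw.1 hwy).elim hxy hyx
  by_contra hne
  by_cases h : x ∈ descendants T r y
  · exact key hy hx (Ne.symm hne) fun h' => hne (descendants_antisymm hT h h')
  · exact key hx hy hne h

end Width

/-! ### Labels in recursive form -/

section HasLabel

universe u

variable {V : Type u} {T : SimpleGraph V} {r u : V} {A : Set V}

/-- The list `es`, with a starred last entry if `st`, is a label of the top `u` of the rooted
subtree `A`. -/
inductive HasLabel [Finite V] (T : SimpleGraph V) (r u : V) : Set V → List ℕ → Bool → Prop
  | plain {A : Set V} {a : ℕ} : layoutWidth T A = a → (∀ x, ¬ Critical T r A a x) →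
      HasLabel T r u A [a] false
  | starred {A : Set V} {a : ℕ} : layoutWidth T A = a → Critical T r A a u →
      HasLabel T r u A [a] true
  | cons {A : Set V} {a b : ℕ} {es : List ℕ} {st : Bool} {x : V} : layoutWidth T A = a → x ≠ u →
      Critical T r A a x → HasLabel T r u (A \ descendants T r x) (b :: es) st → b < a →
      HasLabel T r u A (a :: b :: es) st

/-- `V(A[ℓ_0, …, ℓ_{i-1}])` for a rooted subtree `A`. -/
def pruned (T : SimpleGraph V) (r : V) (A : Set V) (l : ℕ → V) (i : ℕ) : Set V :=
  {w | w ∈ A ∧ ∀ j < i, w ∉ descendants T r (l j)}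

theorem pruned_zero (l : ℕ → V) : pruned T r A l 0 = A := by
  simp [pruned]

/-- Removing the subtree of the first vertex first matches the recursion in `HasLabel.cons`. -/
theorem pruned_succ (l : ℕ → V) (i : ℕ) :
    pruned T r A l (i + 1) = pruned T r (A \ descendants T r (l 0)) (fun j => l (j + 1)) i := by
  ext w
  simp only [pruned, mem_ofPred_eq, mem_sdiff, Nat.forall_lt_succ_left]
  tauto

/-- The vertices `l` witness that `es` (with a starred last entry if `st`) is a label of the top `u`
of the rooted subtree `A`. -/
def LabelWitness (T : SimpleGraph V) (r u : V) (A : Set V) (es : List ℕ) (st : Bool) (l : ℕ → V) :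
    Prop :=
  (∀ i (h : i < es.length), mhOn T (pruned T r A l i) = es[i]) ∧
  (∀ i (h : i + 1 < es.length), l i ≠ u ∧ IsCritical T r (pruned T r A l i) es[i] (l i)) ∧
  (∀ i (h : i + 1 = es.length), l i = u ∧
    (st = false → ∀ x, ¬ IsCritical T r (pruned T r A l i) es[i] x) ∧
    (st = true → IsCritical T r (pruned T r A l i) es[i] u))

theorem isLabel_iff_exists_labelWitness {L : Label} : IsLabel T r u L ↔
    L.entries ≠ [] ∧ L.entries.Pairwise (· > ·) ∧
      ∃ l, LabelWitness T r u (descendants T r u) L.entries L.starred l :=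
  Iff.rfl

theorem HasLabel.ne_nil [Finite V] {es : List ℕ} {st : Bool} (h : HasLabel T r u A es st) :
    es ≠ [] := by
  cases h <;> simp

theorem HasLabel.pairwise [Finite V] {es : List ℕ} {st : Bool} (h : HasLabel T r u A es st) :
    es.Pairwise (· > ·) := by
  induction h with
  | plain => simp
  | starred => simp
  | cons _ _ _ _ hlt ih =>
    refine List.pairwise_cons.mpr ⟨fun e he => ?_, ih⟩
    rcases List.mem_cons.mp he with rfl | he
    · exact hlt
    · exact lt_trans ((List.pairwise_cons.mp ih).1 e he) hlt

theorem HasLabel.head?_eq [Finite V] {es : List ℕ} {st : Bool} (h : HasLabel T r u A es st) :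
    es.head? = some (layoutWidth T A) := by
  cases h <;> simp_all

theorem HasLabel.le_layoutWidth [Finite V] {es : List ℕ} {st : Bool} (h : HasLabel T r u A es st) :
    ∀ e ∈ es, e ≤ layoutWidth T A := by
  have h1 := h.head?_eq
  have h2 := h.pairwise
  match es, h1, h2 with
  | a :: es, h1, h2 =>
    simp only [List.head?_cons, Option.some.injEq] at h1
    intro e he
    rcases List.mem_cons.mp he with rfl | he
    · exact h1.le
    · exact h1 ▸ ((List.pairwise_cons.mp h2).1 e he).le

theorem HasLabel.mem_layoutWidth [Finite V] {es : List ℕ} {st : Bool}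
    (h : HasLabel T r u A es st) : layoutWidth T A ∈ es :=
  List.mem_of_mem_head? h.head?_eq

theorem HasLabel.exists_labelWitness [Finite V] (hT : T.IsTree) {es : List ℕ} {st : Bool}
    (h : HasLabel T r u A es st) (hA : Rooted T r u A) : ∃ l, LabelWitness T r u A es st l := by
  induction h with
  | @plain A a h1 h2 =>
    refine ⟨fun _ => u, ?_, ?_, ?_⟩
    · intro i hi
      obtain rfl : i = 0 := by simpa using hi
      simpa [pruned_zero, hA.mhOn_eq hT] using h1
    · intro i hi
      simp at hi
    · intro i hi
      obtain rfl : i = 0 := by simpa using hi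
      simpa [pruned_zero, hA.isCritical_iff hT] using h2
  | @starred A a h1 h2 =>
    refine ⟨fun _ => u, ?_, ?_, ?_⟩
    · intro i hi
      obtain rfl : i = 0 := by simpa using hi
      simpa [pruned_zero, hA.mhOn_eq hT] using h1
    · intro i hi
      simp at hi
    · intro i hi
      obtain rfl : i = 0 := by simpa using hi
      simpa [pruned_zero, hA.isCritical_iff hT] using h2
  | @cons A a b es st x h1 hxu hx _ _ ih =>
    obtain ⟨l, hl1, hl2, hl3⟩ := ih (hA.diff_descendants hT hx.1 hxu)
    refine ⟨fun i => Nat.casesOn i x l, ?_, ?_, ?_⟩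
    · rintro (_ | i) hi
      · simpa [pruned_zero, hA.mhOn_eq hT] using h1
      · rw [pruned_succ]
        exact hl1 i (by simpa using hi)
    · rintro (_ | i) hi
      · refine ⟨hxu, ?_⟩
        rw [pruned_zero, hA.isCritical_iff hT]
        exact hx
      · rw [pruned_succ]
        exact hl2 i (by simpa using hi)
    · rintro (_ | i) hi
      · simp at hi
      · rw [pruned_succ]
        exact hl3 i (by simpa using hi)

theorem LabelWitness.hasLabel [Finite V] (hT : T.IsTree) {es : List ℕ} {st : Bool} {l : ℕ → V}
    (h : LabelWitness T r u A es st l) (hA : Rooted T r u A) (hes : es ≠ [])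
    (hp : es.Pairwise (· > ·)) : HasLabel T r u A es st := by
  induction es generalizing A l with
  | nil => exact absurd rfl hes
  | cons a es ih =>
    obtain ⟨h1, h2, h3⟩ := h
    have hw := h1 0 (by simp)
    rw [pruned_zero, hA.mhOn_eq hT] at hw
    cases es with
    | nil =>
      obtain ⟨-, h4, h5⟩ := h3 0 (by simp)
      simp only [pruned_zero, hA.isCritical_iff hT] at h4 h5
      cases st with
      | false => exact .plain hw (h4 rfl)
      | true => exact .starred hw (h5 rfl)
    | cons b es =>
      obtain ⟨h4, h5⟩ := h2 0 (by simp)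
      rw [pruned_zero, hA.isCritical_iff hT] at h5
      refine .cons hw h4 h5 (ih (l := fun j => l (j + 1)) ⟨?_, ?_, ?_⟩
        (hA.diff_descendants hT h5.1 h4) (by simp) (List.pairwise_cons.mp hp).2)
        ((List.pairwise_cons.mp hp).1 b (by simp))
      · intro i hi
        rw [← pruned_succ]
        exact h1 (i + 1) (by simpa using hi)
      · intro i hi
        rw [← pruned_succ]
        exact h2 (i + 1) (by simpa using hi)
      · intro i hi
        rw [← pruned_succ]
        exact h3 (i + 1) (by simpa using hi)

theorem isLabel_iff_hasLabel [Finite V] (hT : T.IsTree) {L : Label} :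
    IsLabel T r u L ↔ HasLabel T r u (descendants T r u) L.entries L.starred := by
  rw [isLabel_iff_exists_labelWitness]
  constructor
  · rintro ⟨h1, h2, l, hl⟩
    exact hl.hasLabel hT (rooted_descendants hT u) h1 h2
  · exact fun h => ⟨h.ne_nil, h.pairwise, h.exists_labelWitness hT (rooted_descendants hT u)⟩

end HasLabel

end HuntersRabbit

namespace HuntersRabbit

open Set

/-! ### A vertex on top of subtrees of bounded width -/

section Pieces

universe u

variable {V : Type u} [Finite V] {T : SimpleGraph V} {r u : V} {A : Set V} {k : ℕ}

theorem Rooted.layable_descendants (hT : T.IsTree) (hA : Rooted T r u A)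
    (hP : ∀ c ∈ A, IsChild T r u c → Layable T (descendants T r c ∩ A) k) {v : V} (hv : v ∈ A)
    (hvu : v ≠ u) : Layable T (descendants T r v ∩ A) k := by
  obtain ⟨c, hc, huc, hvc⟩ := hA.exists_child hT hv hvu
  exact (hP c hc huc).mono (inter_subset_inter_left _ (descendants_subset hT hvc)) le_rfl

/-- Every vertex other than `u` lies below a child of `u`, so there are no heavy children at all,
hence no fork. -/
theorem Rooted.layable_succ (hT : T.IsTree) (hA : Rooted T r u A) (hk : 1 ≤ k)
    (hP : ∀ c ∈ A, IsChild T r u c → Layable T (descendants T r c ∩ A) k) :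
    Layable T A (k + 1) := by
  rw [layable_succ_iff_not_hasFork hT hA hk]
  have key : ∀ x ∈ A, ∀ v, ¬ IsHeavyChild T r A k x v := fun x hx v hv =>
    hv.2.2 (hA.layable_descendants hT hP hv.1 (hA.ne_top_of_isChild hT hv.2.1 hx))
  rintro ⟨x, hx, ⟨c₁, -, -, -, -, -, h1, -⟩ | ⟨-, ⟨c₁, -, -, h1, -⟩, -⟩⟩
  · exact key x hx c₁ h1
  · exact key x hx c₁ h1

/-- A critical vertex has a child of full width `k + 1`, whereas every proper subtree has width at
most `k`. -/
theorem Rooted.hasLabel_succ (hT : T.IsTree) (hA : Rooted T r u A)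
    (hP : ∀ c ∈ A, IsChild T r u c → Layable T (descendants T r c ∩ A) k)
    (h1 : ¬ Layable T A k) (h2 : Layable T A (k + 1)) : HasLabel T r u A [k + 1] false := by
  refine .plain (layoutWidth_eq_succ_iff.mpr ⟨h2, h1⟩) fun x hx => ?_
  obtain ⟨v, hxv, hv, hw⟩ := hx.exists_child
  exact (layoutWidth_eq_succ_iff.mp hw).2
    (hA.layable_descendants hT hP hv (hA.ne_top_of_isChild hT hxv hx.1))

theorem Rooted.not_layable_of_critical (hT : T.IsTree) (hA : Rooted T r u A) (hk : 1 ≤ k) {x : V}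
    (hxu : x ≠ u) (hx : Critical T r A (k + 1) x) (htop : ¬ Layable T (A \ descendants T r x) k) :
    ¬ Layable T A (k + 1) :=
  HasFork.not_layable hT hA ⟨x, hx.1, Or.inr ⟨hxu, hx.two_heavy hk, htop⟩⟩

/-- Locates the fork. Away from `u`, three heavy children would contradict the bound on the subtree
at a child of `u`; so two heavy children and a heavy part above remain, and two heavy children mean
criticality. -/
theorem Rooted.three_or_critical (hT : T.IsTree) (hA : Rooted T r u A) (hk : 1 ≤ k)
    (hP : ∀ c ∈ A, IsChild T r u c → Layable T (descendants T r c ∩ A) (k + 1))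
    (h : ¬ Layable T A (k + 1)) :
    (∃ c₁ c₂ c₃, c₁ ≠ c₂ ∧ c₁ ≠ c₃ ∧ c₂ ≠ c₃ ∧ IsHeavyChild T r A k u c₁ ∧
      IsHeavyChild T r A k u c₂ ∧ IsHeavyChild T r A k u c₃) ∨
    ∃ x, x ≠ u ∧ Critical T r A (k + 1) x ∧ ¬ Layable T (A \ descendants T r x) k := by
  rw [layable_succ_iff_not_hasFork hT hA hk, not_not] at h
  obtain ⟨x, hx, h⟩ := h
  by_cases hxu : x = u
  · subst hxu
    rcases h with h | ⟨h, -⟩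
    · exact Or.inl h
    · exact absurd rfl h
  · have hw := hA.layable_descendants hT hP hx hxu
    rcases h with ⟨c₁, c₂, c₃, h12, h13, h23, h1, h2, h3⟩ | ⟨-, ⟨c₁, c₂, h12, h1, h2⟩, htop⟩
    · exfalso
      have hmem : ∀ {c}, IsHeavyChild T r A k x c →
          IsHeavyChild T r (descendants T r x ∩ A) k x c := by
        rintro c ⟨hc, hxc, hcw⟩
        refine ⟨⟨hxc.2, hc⟩, hxc, fun h => hcw (h.mono ?_ le_rfl)⟩
        exact fun w hw => ⟨hw.1, descendants_trans hT hw.1 hxc.2, hw.2⟩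
      exact HasFork.not_layable hT (hA.inter_descendants hT hx)
        ⟨x, ⟨mem_descendants_self hT x, hx⟩,
          Or.inl ⟨c₁, c₂, c₃, h12, h13, h23, hmem h1, hmem h2, hmem h3⟩⟩ hw
    · exact Or.inr ⟨x, hxu, critical_of_two_heavy hT hk hx hw h12 h1 h2, htop⟩

end Pieces

/-! ### Unfolding a label into truncated subtrees -/

section Truncation

universe u

variable {V : Type u} {T : SimpleGraph V} {r c : V} {A : Set V}

theorem hasCritical_singleton {m a : ℕ} {st : Bool} :
    Label.hasCritical m ⟨[a], st⟩ = true ↔ m = a ∧ st = true := by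
  simp only [Label.hasCritical, List.dropLast_singleton, List.not_mem_nil, decide_false,
    List.getLast?_singleton, Option.some.injEq, Bool.false_or, Bool.and_eq_true, decide_eq_true_eq]
  rw [eq_comm]

theorem hasCritical_cons {m a b : ℕ} {es : List ℕ} {st : Bool} :
    Label.hasCritical m ⟨a :: b :: es, st⟩ = true ↔
      m = a ∨ Label.hasCritical m ⟨b :: es, st⟩ = true := by
  simp [Label.hasCritical, or_assoc]

theorem mem_of_hasCritical {m : ℕ} {L : Label} (h : L.hasCritical m = true) : m ∈ L.entries := by
  simp only [Label.hasCritical, Bool.or_eq_true, decide_eq_true_eq, Bool.and_eq_true] at h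
  rcases h with h | h
  · exact List.mem_of_mem_dropLast h
  · exact List.mem_of_getLast? h.1

/-- `B m` is what is left of the rooted subtree `A` after removal of the pieces that belong to the
entries of the label `L` exceeding `m`. -/
structure Truncation [Finite V] (T : SimpleGraph V) (r c : V) (L : Label) (A : Set V)
    (B : ℕ → Set V) : Prop where
  subset : ∀ m, B m ⊆ A
  rooted : ∀ m, (B m).Nonempty → Rooted T r c (B m)
  eq_empty : 0 ∉ L.entries → B 0 = ∅
  eq_pred : ∀ m, m + 1 ∉ L.entries → B (m + 1) = B m
  width : ∀ m ∈ L.entries, (B m).Nonempty ∧ layoutWidth T (B m) = m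
  critical : ∀ m, L.hasCritical (m + 1) = true →
    ∃ x, Critical T r (B (m + 1)) (m + 1) x ∧ B m = B (m + 1) \ descendants T r x
  not_critical : ∀ m, m + 1 ∈ L.entries → L.hasCritical (m + 1) = false →
    (∀ x, ¬ Critical T r (B (m + 1)) (m + 1) x) ∧ B m = ∅
  eq_self : ∀ m, (∀ e ∈ L.entries, e ≤ m) → B m = A

/-- `B m` is constant between consecutive entries and drops at each entry by the subtree of its
critical vertex. Below the last entry it is empty: a starred last entry has the top itself as
critical vertex, and after an unstarred one nothing is recorded any more. -/
theorem HasLabel.exists_truncation [Finite V] (hT : T.IsTree) {es : List ℕ} {st : Bool}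
    (h : HasLabel T r c A es st) (hA : Rooted T r c A) :
    ∃ B, Truncation T r c ⟨es, st⟩ A B := by
  have single : ∀ (A : Set V) (a : ℕ) (st : Bool), Rooted T r c A → layoutWidth T A = a →
      (st = true → Critical T r A a c) → (st = false → ∀ x, ¬ Critical T r A a x) →
      ∃ B, Truncation T r c ⟨[a], st⟩ A B := by
    intro A a st hA hw h1 h2
    refine ⟨fun m => if a ≤ m then A else ∅, ?_, ?_, ?_, ?_, ?_, ?_, ?_, ?_⟩
    · intro m
      split <;> simp
    · intro m
      split
      · exact fun _ => hA
      · exact fun h => absurd h not_nonempty_empty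
    · intro h
      have : a ≠ 0 := by simpa [eq_comm] using h
      simp [this]
    · intro m h
      have : a ≠ m + 1 := by simpa [eq_comm] using h
      have : a ≤ m + 1 ↔ a ≤ m := by omega
      simp [this]
    · intro m h
      obtain rfl : m = a := by simpa using h
      simpa using ⟨⟨c, hA.top_mem⟩, hw⟩
    · intro m h
      obtain ⟨rfl, hst⟩ := hasCritical_singleton.mp h
      refine ⟨c, by simpa using h1 hst, ?_⟩
      simpa using (sdiff_eq_empty.mpr hA.subset).symm
    · intro m h h'
      obtain rfl : m + 1 = a := by simpa using h
      have hst : st = false := by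
        by_contra hst
        rw [Bool.not_eq_false] at hst
        rw [hasCritical_singleton.mpr ⟨rfl, hst⟩] at h'
        simp at h'
      simpa using h2 hst
    · intro m h
      have : a ≤ m := by simpa using h
      simp [this]
  induction h with
  | @plain A a h1 h2 => exact single A a false hA h1 (by simp) fun _ => h2
  | @starred A a h1 h2 => exact single A a true hA h1 (fun _ => h2) (by simp)
  | @cons A a b es st x h1 hxc hx hL hlt ih =>
    obtain ⟨B, hB⟩ := ih (hA.diff_descendants hT hx.1 hxc)
    have hle : ∀ e ∈ b :: es, e ≤ b := by
      intro e he
      rcases List.mem_cons.mp he with rfl | he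
      · exact le_rfl
      · exact ((List.pairwise_cons.mp hL.pairwise).1 e he).le
    have hself : ∀ m, b ≤ m → B m = A \ descendants T r x := fun m hm =>
      hB.eq_self m fun e he => (hle e he).trans hm
    have hmem : ∀ m, m ∈ a :: b :: es ↔ m = a ∨ m ∈ b :: es := fun m => List.mem_cons
    refine ⟨fun m => if a ≤ m then A else B m, ?_, ?_, ?_, ?_, ?_, ?_, ?_, ?_⟩
    · intro m
      split
      · exact subset_rfl
      · exact (hB.subset m).trans sdiff_subset
    · intro m
      split
      · exact fun _ => hA
      · exact hB.rooted m
    · intro h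
      simp only [hmem, not_or] at h
      have : ¬ a ≤ 0 := by omega
      simpa [this] using hB.eq_empty h.2
    · intro m h
      simp only [hmem, not_or] at h
      have : a ≤ m + 1 ↔ a ≤ m := by omega
      simp only [this, hB.eq_pred m h.2]
    · intro m h
      simp only [hmem] at h
      by_cases hm : a ≤ m
      · obtain rfl : m = a := by
          rcases h with h | h
          · exact h
          · have := hle m h
            omega
        simpa using ⟨⟨c, hA.top_mem⟩, h1⟩
      · simpa [hm] using hB.width m (h.resolve_left (by omega))
    · intro m h
      rw [hasCritical_cons] at h
      by_cases hm : m + 1 = a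
      · subst hm
        refine ⟨x, by simpa using hx, ?_⟩
        simpa using hself m (by omega)
      · replace h := h.resolve_left hm
        have := hle _ (mem_of_hasCritical h)
        have h3 : ¬ a ≤ m + 1 := by omega
        have h4 : ¬ a ≤ m := by omega
        simpa [h3, h4] using hB.critical m h
    · intro m h h'
      rw [← Bool.not_eq_true, hasCritical_cons, not_or, Bool.not_eq_true] at h'
      simp only [hmem] at h
      replace h := h.resolve_left h'.1
      have := hle _ h
      have h3 : ¬ a ≤ m + 1 := by omega
      have h4 : ¬ a ≤ m := by omega
      simpa [h3, h4] using hB.not_critical m h h'.2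
    · intro m h
      have : a ≤ m := h a (by simp)
      simp [this]

namespace Truncation

variable [Finite V] {L : Label} {B : ℕ → Set V}

/-- At an entry the width is exact; between entries the set does not change, so the bound carries
upwards. -/
theorem layable (h : Truncation T r c L A B) (m : ℕ) : Layable T (B m) m := by
  have hmem : ∀ m ∈ L.entries, Layable T (B m) m := fun m hm =>
    layoutWidth_le_iff.mp (h.width m hm).2.le
  induction m with
  | zero =>
    by_cases h0 : 0 ∈ L.entries
    · exact hmem 0 h0
    · rw [h.eq_empty h0]
      exact ⟨fun _ => 0, fun t => by simp [activeSet]⟩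
  | succ m ih =>
    by_cases hm : m + 1 ∈ L.entries
    · exact hmem _ hm
    · rw [h.eq_pred m hm]
      exact ih.mono subset_rfl (Nat.le_succ m)

theorem layable_of_notMem (h : Truncation T r c L A B) {m : ℕ} (hm : m + 1 ∉ L.entries) :
    Layable T (B (m + 1)) m := by
  rw [h.eq_pred m hm]
  exact h.layable m

theorem not_layable (h : Truncation T r c L A B) {m : ℕ} (hm : m + 1 ∈ L.entries) :
    ¬ Layable T (B (m + 1)) m :=
  (layoutWidth_eq_succ_iff.mp (h.width _ hm).2).2

end Truncation

end Truncation

end HuntersRabbit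

namespace HuntersRabbit

open Set

/-! ### One iteration of the loop for values at least two -/

section Merge

universe u

variable {V : Type u} {T : SimpleGraph V} {r u : V} {lab : V → Label} {B : V → ℕ → Set V}

/-- The vertex `u` together with what is left of the subtrees at its children. -/
def merged (T : SimpleGraph V) (r u : V) (B : V → ℕ → Set V) (m : ℕ) : Set V :=
  {w | w = u ∨ ∃ c, IsChild T r u c ∧ w ∈ B c m}

theorem exists_children_finset {cs : List V} (hnd : cs.Nodup)
    (hcs : ∀ c, c ∈ cs ↔ IsChild T r u c) (lab : V → Label) (m : ℕ) :
    ∃ H : Finset V, (∀ c, c ∈ H ↔ IsChild T r u c ∧ m ∈ (lab c).entries) ∧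
      (cs.map lab).countP (Label.contains m) = H.card := by
  classical
  refine ⟨(cs.filter fun c => Label.contains m (lab c)).toFinset, fun c => ?_, ?_⟩
  · simp [hcs, Label.contains]
  · rw [List.toFinset_card_of_nodup (hnd.filter _), List.countP_map, List.countP_eq_length_filter]
    rfl

theorem any_hasCritical_iff {cs : List V} (hcs : ∀ c, c ∈ cs ↔ IsChild T r u c) (lab : V → Label)
    (m : ℕ) : (cs.map lab).any (Label.hasCritical m) = true ↔
      ∃ c, IsChild T r u c ∧ (lab c).hasCritical m = true := by
  simp [hcs]

/-- The sets `B c m` are truncations of the subtrees at the children `c` of `u`. -/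
def ChildTruncations [Finite V] (T : SimpleGraph V) (r u : V) (lab : V → Label)
    (B : V → ℕ → Set V) : Prop :=
  ∀ c, IsChild T r u c → Truncation T r c (lab c) (descendants T r c) (B c)

namespace ChildTruncations

variable [Finite V]

theorem top_notMem (hT : T.IsTree) (hB : ChildTruncations T r u lab B) {c : V} {m : ℕ}
    (hc : IsChild T r u c) : u ∉ B c m :=
  fun h => hc.notMem_descendants hT ((hB c hc).subset m h)

theorem rooted (hT : T.IsTree) (hB : ChildTruncations T r u lab B) (m : ℕ) :
    Rooted T r u (merged T r u B m) where
  top_mem := Or.inl rfl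
  subset := by
    rintro w (rfl | ⟨c, hc, hw⟩)
    · exact mem_descendants_self hT w
    · exact descendants_trans hT ((hB c hc).subset m hw) hc.2
  parent_mem := by
    rintro x w hxw (rfl | ⟨c, hc, hw⟩) hwu
    · exact absurd rfl hwu
    · by_cases hwc : w = c
      · subst hwc
        exact Or.inl (hxw.parent_unique hT hc)
      · exact Or.inr ⟨c, hc, ((hB c hc).rooted m ⟨w, hw⟩).parent_mem x w hxw hw hwc⟩

theorem inter_merged (hT : T.IsTree) (hB : ChildTruncations T r u lab B) {c : V} (m : ℕ)
    (hc : IsChild T r u c) : descendants T r c ∩ merged T r u B m = B c m := by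
  ext w
  constructor
  · rintro ⟨hw, rfl | ⟨d, hd, hwd⟩⟩
    · exact absurd hw (hc.notMem_descendants hT)
    · rwa [hc.eq_of_mem_descendants hT hd hw ((hB d hd).subset m hwd)]
  · exact fun hw => ⟨(hB c hc).subset m hw, Or.inr ⟨c, hc, hw⟩⟩

theorem mem_merged (hB : ChildTruncations T r u lab B) {c : V} {m : ℕ}
    (hc : IsChild T r u c) (hne : (B c m).Nonempty) : c ∈ merged T r u B m :=
  Or.inr ⟨c, hc, ((hB c hc).rooted m hne).top_mem⟩

theorem pieces (hT : T.IsTree) (hB : ChildTruncations T r u lab B) (m : ℕ) :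
    ∀ c ∈ merged T r u B m, IsChild T r u c →
      Layable T (descendants T r c ∩ merged T r u B m) m := by
  intro c _ hc
  rw [hB.inter_merged hT m hc]
  exact (hB c hc).layable m

/-- This is why counting labels that contain `k + 1` is the same as counting heavy children of `u`.
-/
theorem isHeavyChild_iff (hT : T.IsTree) (hB : ChildTruncations T r u lab B) {c : V} {k : ℕ} :
    IsHeavyChild T r (merged T r u B (k + 1)) k u c ↔
      IsChild T r u c ∧ k + 1 ∈ (lab c).entries := by
  constructor
  · rintro ⟨-, hc, hw⟩
    rw [hB.inter_merged hT _ hc] at hw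
    refine ⟨hc, ?_⟩
    by_contra hno
    exact hw ((hB c hc).layable_of_notMem hno)
  · rintro ⟨hc, hm⟩
    refine ⟨hB.mem_merged hc ((hB c hc).width _ hm).1, hc, ?_⟩
    rw [hB.inter_merged hT _ hc]
    exact (hB c hc).not_layable hm

theorem critical_iff (hT : T.IsTree) (hB : ChildTruncations T r u lab B) {c x : V} {m k : ℕ}
    (hc : IsChild T r u c) (hx : x ∈ descendants T r c) :
    Critical T r (merged T r u B m) k x ↔ Critical T r (B c m) k x := by
  rw [← critical_inter_iff hT hx, hB.inter_merged hT m hc]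

/-- The vertex lies below some child `c`. Being critical it forces width `k + 1` on `B c (k + 1)`,
so `k + 1` is an entry of the label of `c`; an entry not marked critical would exclude it. -/
theorem exists_hasCritical_of_critical (hT : T.IsTree) (hB : ChildTruncations T r u lab B)
    {x : V} {k : ℕ} (hxu : x ≠ u) (hx : Critical T r (merged T r u B (k + 1)) (k + 1) x) :
    ∃ c, IsChild T r u c ∧ x ∈ descendants T r c ∧ (lab c).hasCritical (k + 1) = true := by
  obtain ⟨c, -, hc, hxc⟩ := (hB.rooted hT _).exists_child hT hx.1 hxu
  refine ⟨c, hc, hxc, ?_⟩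
  have hx' := (hB.critical_iff hT hc hxc).mp hx
  have hmem : k + 1 ∈ (lab c).entries := by
    by_contra hno
    refine (layoutWidth_eq_succ_iff.mp hx'.2.1).2 (((hB c hc).layable_of_notMem hno).mono ?_ le_rfl)
    exact inter_subset_right
  by_contra hno
  exact ((hB c hc).not_critical k hmem (by simpa using hno)).1 x hx'

theorem merged_succ_eq (hB : ChildTruncations T r u lab B) {k : ℕ}
    (h : ∀ c, IsChild T r u c → k + 1 ∉ (lab c).entries) :
    merged T r u B (k + 1) = merged T r u B k := by
  ext w
  refine or_congr_right (exists_congr fun c => and_congr_right fun hc => ?_)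
  rw [(hB c hc).eq_pred k (h c hc)]

/-- What a critical vertex below a child cuts off. -/
theorem exists_critical (hT : T.IsTree) (hB : ChildTruncations T r u lab B) {c : V} {k : ℕ}
    (hc : IsChild T r u c) (h : (lab c).hasCritical (k + 1) = true) :
    ∃ x, x ≠ u ∧ x ∈ descendants T r c ∧ Critical T r (merged T r u B (k + 1)) (k + 1) x ∧
      ((∀ d, IsChild T r u d → k + 1 ∈ (lab d).entries → d = c) →
        merged T r u B (k + 1) \ descendants T r x = merged T r u B k) := by
  obtain ⟨x, hx, hBx⟩ := (hB c hc).critical k h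
  have hxc := (hB c hc).subset _ hx.1
  have hxu : u ∉ descendants T r x := fun hu =>
    hc.notMem_descendants hT (descendants_trans hT hu hxc)
  refine ⟨x, ?_, hxc, (hB.critical_iff hT hc hxc).mpr hx, fun huniq => ?_⟩
  · rintro rfl
    exact hc.notMem_descendants hT hxc
  · ext w
    constructor
    · rintro ⟨rfl | ⟨d, hd, hw⟩, hwx⟩
      · exact Or.inl rfl
      · refine Or.inr ⟨d, hd, ?_⟩
        by_cases hdc : d = c
        · subst hdc
          rw [hBx]
          exact ⟨hw, hwx⟩
        · rwa [← (hB d hd).eq_pred k fun h' => hdc (huniq d hd h')]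
    · rintro (rfl | ⟨d, hd, hw⟩)
      · exact ⟨Or.inl rfl, hxu⟩
      · by_cases hdc : d = c
        · subst hdc
          rw [hBx] at hw
          exact ⟨Or.inr ⟨d, hd, hw.1⟩, hw.2⟩
        · refine ⟨Or.inr ⟨d, hd, ?_⟩, fun hwx => ?_⟩
          · rwa [(hB d hd).eq_pred k fun h' => hdc (huniq d hd h')]
          · exact hdc (hd.eq_of_mem_descendants hT hc ((hB d hd).subset k hw)
              (descendants_trans hT hwx hxc))

/-- All pieces have width at most `k + 1`, so `merged (k + 1)` has width at most `k + 2`, and as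
soon as `k + 1` does not suffice the label is `(k + 2)`. Failure means three heavy children of `u`,
or a critical vertex with a heavy remainder. -/
theorem hasLabel_labelStep (hT : T.IsTree) (hB : ChildTruncations T r u lab B) {k : ℕ}
    (hk : 1 ≤ k) {cs : List V} (hnd : cs.Nodup) (hcs : ∀ c, c ∈ cs ↔ IsChild T r u c) {L : Label}
    (hL : HasLabel T r u (merged T r u B k) L.entries L.starred) :
    HasLabel T r u (merged T r u B (k + 1)) (labelStep (cs.map lab) L (k + 1)).entries
      (labelStep (cs.map lab) L (k + 1)).starred := by
  obtain ⟨H, hH, hcard⟩ := exists_children_finset hnd hcs lab (k + 1)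
  have hcrit := any_hasCritical_iff hcs lab (k + 1)
  have hA := hB.rooted hT (k + 1)
  have hpieces := hB.pieces hT (k + 1)
  have hheavy : ∀ {c}, c ∈ H ↔ IsHeavyChild T r (merged T r u B (k + 1)) k u c := fun {c} => by
    rw [hH, hB.isHeavyChild_iff hT]
  have hcritH : ∀ {c}, IsChild T r u c → (lab c).hasCritical (k + 1) = true → c ∈ H :=
    fun hc h => (hH _).mpr ⟨hc, mem_of_hasCritical h⟩
  have hsucc := hA.layable_succ hT (by omega) hpieces
  have hbig : ¬ Layable T (merged T r u B (k + 1)) (k + 1) →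
      HasLabel T r u (merged T r u B (k + 1)) [k + 1 + 1] false := fun h =>
    hA.hasLabel_succ hT hpieces h hsucc
  have hwidth : Layable T (merged T r u B (k + 1)) (k + 1) → ∀ {c}, c ∈ H →
      layoutWidth T (merged T r u B (k + 1)) = k + 1 := fun h c hc =>
    layoutWidth_eq_succ_iff.mpr
      ⟨h, fun h' => (hheavy.mp hc).2.2 (h'.mono inter_subset_right le_rfl)⟩
  have hthree : 3 ≤ H.card → ¬ Layable T (merged T r u B (k + 1)) (k + 1) := by
    intro h3
    obtain ⟨a, b, c, ha, hb, hc, hab, hac, hbc⟩ := Finset.two_lt_card_iff.mp h3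
    exact HasFork.not_layable hT hA ⟨u, hA.top_mem, Or.inl ⟨a, b, c, hab, hac, hbc, hheavy.mp ha,
      hheavy.mp hb, hheavy.mp hc⟩⟩
  have hsmall : H.card < 3 → (∀ x, x ≠ u → Critical T r (merged T r u B (k + 1)) (k + 1) x →
      Layable T (merged T r u B (k + 1) \ descendants T r x) k) →
      Layable T (merged T r u B (k + 1)) (k + 1) := by
    intro h3 hx
    by_contra h
    rcases hA.three_or_critical hT hk hpieces h with
      ⟨a, b, c, hab, hac, hbc, ha, hb, hc⟩ | ⟨x, hxu, hxc, htop⟩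
    · exact absurd (Finset.two_lt_card_iff.mpr ⟨a, b, c, hheavy.mpr ha, hheavy.mpr hb,
        hheavy.mpr hc, hab, hac, hbc⟩) (by omega)
    · exact htop (hx x hxu hxc)
  have hnocrit : (cs.map lab).any (Label.hasCritical (k + 1)) = false → ∀ x, x ≠ u →
      ¬ Critical T r (merged T r u B (k + 1)) (k + 1) x := by
    intro h x hxu hx
    obtain ⟨c, hc, -, h'⟩ := hB.exists_hasCritical_of_critical hT hxu hx
    rw [hcrit.mpr ⟨c, hc, h'⟩] at h
    simp at h
  unfold labelStep
  simp only [hcard, Nat.add_eq_zero_iff, one_ne_zero, and_false, if_false,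
    show ¬ k + 1 = 1 by omega]
  split_ifs with c1 c2 c3 c4 c5 c6
  · exact hbig (hthree c1)
  -- The second heavy child lies outside the critical subtree, so the remainder is heavy.
  · obtain ⟨c, hc, hcc⟩ := hcrit.mp c2.2
    obtain ⟨x, hxu, hxc, hx, -⟩ := hB.exists_critical hT hc hcc
    obtain ⟨d, hd, hdc⟩ := Finset.exists_mem_ne (by omega : 1 < H.card) c
    refine hbig (hA.not_layable_of_critical hT hk hxu hx fun htop => ?_)
    refine (hheavy.mp hd).2.2 (htop.mono (fun w hw => ⟨hw.2, fun hwx => ?_⟩) le_rfl)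
    exact hdc (((hH d).mp hd).1.eq_of_mem_descendants hT hc hw.1 (descendants_trans hT hwx hxc))
  -- Two heavy children and nothing critical below: `u` itself is the critical vertex.
  · have hlay := hsmall (by omega) fun x hxu hx => absurd hx (hnocrit c3.2 x hxu)
    obtain ⟨a, b, ha, hb, hab⟩ := Finset.one_lt_card_iff.mp (by omega : 1 < H.card)
    exact .starred (hwidth hlay ha) (critical_of_two_heavy hT hk hA.top_mem
      (hlay.mono inter_subset_right le_rfl) hab (hheavy.mp ha) (hheavy.mp hb))
  -- With only one heavy child, removing the critical subtree leaves exactly `merged k`, whose width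
  -- is read off the current label and is at least `k + 1`.
  · obtain ⟨c, hc, hcc⟩ := hcrit.mp c4.2.1
    obtain ⟨x, hxu, hxc, hx, hcut⟩ := hB.exists_critical hT hc hcc
    obtain ⟨d, hd⟩ := Finset.card_eq_one.mp c4.1
    have huniq : ∀ e, IsChild T r u e → k + 1 ∈ (lab e).entries → e = c := by
      intro e he hme
      have h1 := (hH e).mpr ⟨he, hme⟩
      have h2 := hcritH hc hcc
      rw [hd, Finset.mem_singleton] at h1 h2
      rw [h1, h2]
    refine hbig (hA.not_layable_of_critical hT hk hxu hx fun htop => ?_)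
    rw [hcut huniq] at htop
    have h1 := hL.le_layoutWidth (k + 1) (by simpa [Label.contains] using c4.2.2)
    have h2 := layoutWidth_le_iff.mpr htop
    omega
  -- The remainder is `merged k` again. Its width is at most `k + 1` and heads the current label,
  -- which does not contain `k + 1`; so it is at most `k`, and the label is extended at the front.
  · obtain ⟨c, hc, hcc⟩ := hcrit.mp c5.2.1
    obtain ⟨x, hxu, hxc, hx, hcut⟩ := hB.exists_critical hT hc hcc
    obtain ⟨d, hd⟩ := Finset.card_eq_one.mp c5.1
    have huniq : ∀ e, IsChild T r u e → k + 1 ∈ (lab e).entries → e = c := by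
      intro e he hme
      have h1 := (hH e).mpr ⟨he, hme⟩
      have h2 := hcritH hc hcc
      rw [hd, Finset.mem_singleton] at h1 h2
      rw [h1, h2]
    have hne : layoutWidth T (merged T r u B k) ≠ k + 1 := by
      intro h
      have := hL.mem_layoutWidth
      rw [h] at this
      simp [Label.contains, this] at c5
    have hle : layoutWidth T (merged T r u B k) ≤ k + 1 := layoutWidth_le_iff.mpr
      ((hB.rooted hT k).layable_succ hT hk (hB.pieces hT k))
    have hlt : Layable T (merged T r u B k) k := layoutWidth_le_iff.mp (by omega)
    have hlay : Layable T (merged T r u B (k + 1)) (k + 1) := by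
      refine hsmall (by omega) fun y hyu hy => ?_
      obtain ⟨e, he, hye, hcre⟩ := hB.exists_hasCritical_of_critical hT hyu hy
      obtain rfl := huniq e he (mem_of_hasCritical hcre)
      rw [hB.critical_iff hT he hye] at hy
      have hx' := (hB.critical_iff hT he hxc).mp hx
      rw [Critical.eq hT ((hB e he).rooted _ ⟨y, hy.1⟩) hk ((hB e he).layable _) hy hx',
        hcut huniq]
      exact hlt
    have hhead := hL.head?_eq
    match hes : L.entries, hL, hhead with
    | b :: es, hL, hhead =>
      simp only [List.head?_cons, Option.some.injEq] at hhead
      refine .cons (hwidth hlay (hcritH hc hcc)) hxu hx (by rwa [hcut huniq]) ?_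
      have := layoutWidth_le_iff.mpr hlt
      omega
  · have hlay := hsmall (by omega) fun x hxu hx => absurd hx (hnocrit c6.2 x hxu)
    obtain ⟨a, ha⟩ := Finset.card_eq_one.mp c6.1
    refine .plain (hwidth hlay (by rw [ha]; simp : a ∈ H)) fun x hx => ?_
    by_cases hxu : x = u
    · subst hxu
      obtain ⟨a, b, hab, h1, h2⟩ := hx.two_heavy hk
      have := Finset.one_lt_card_iff.mpr ⟨a, b, hheavy.mpr h1, hheavy.mpr h2, hab⟩
      omega
    · exact hnocrit c6.2 x hxu hx
  -- Only the case of no heavy child is left, in which `merged` does not change.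
  · have hH0 : H.card = 0 := by
      rcases Bool.eq_false_or_eq_true ((cs.map lab).any (Label.hasCritical (k + 1))) with h | h <;>
      rcases Bool.eq_false_or_eq_true (Label.contains (k + 1) L) with h' | h' <;>
      simp only [h, h', and_true, and_false, reduceCtorEq, not_false_eq_true] at * <;> omega
    rw [Finset.card_eq_zero] at hH0
    rw [hB.merged_succ_eq fun c hc hm => by simpa [hH0] using (hH c).mpr ⟨hc, hm⟩]
    exact hL

end ChildTruncations

end Merge

end HuntersRabbit

namespace HuntersRabbit

open Set

/-! ### Iterations zero and one, and correctness of the algorithm -/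

section Algorithm

universe u

variable {V : Type u} {T : SimpleGraph V} {r u : V} {lab : V → Label} {B : V → ℕ → Set V}

theorem layable_zero_of_isolated {A : Set V} (h : ∀ a ∈ A, ∀ b ∈ A, ¬ T.Adj a b) :
    Layable T A 0 :=
  ⟨fun _ => 0, fun t => by
    rw [(eq_empty_iff_forall_notMem (s := activeSet T A _ t)).mpr]
    · simp
    · rintro x ⟨hx, -, y, hy, hxy, -⟩
      exact h x hx y hy hxy⟩

theorem Rooted.exists_child_of_not_layable [Finite V] (hT : T.IsTree) {c : V} {A : Set V}
    (hA : Rooted T r c A) (h : ¬ Layable T A 0) : ∃ w ∈ A, IsChild T r c w := by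
  by_contra! hno
  refine h (layable_zero_of_isolated fun a ha b hb hab => ?_)
  have key : ∀ w ∈ A, w = c := by
    intro w hw
    by_contra hwc
    obtain ⟨d, hd, hcd, -⟩ := hA.exists_child hT hw hwc
    exact hno d hd hcd
  rw [key a ha, key b hb] at hab
  exact hab.ne rfl

namespace ChildTruncations

variable [Finite V]

/-- All pieces are edgeless, hence single vertices: `merged 0` is `u` alone or a star centred at
`u`. -/
theorem hasLabel_labelStep_zero (hT : T.IsTree) (hB : ChildTruncations T r u lab B) {cs : List V}
    (hnd : cs.Nodup) (hcs : ∀ c, c ∈ cs ↔ IsChild T r u c) (L : Label) :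
    HasLabel T r u (merged T r u B 0) (labelStep (cs.map lab) L 0).entries
      (labelStep (cs.map lab) L 0).starred := by
  obtain ⟨H, hH, hcard⟩ := exists_children_finset hnd hcs lab 0
  have hA := hB.rooted hT 0
  simp only [labelStep, hcard, if_true]
  split_ifs with h1
  · refine hA.hasLabel_succ hT (hB.pieces hT 0) ?_ ?_
    · obtain ⟨c, hc⟩ := Finset.card_pos.mp h1
      obtain ⟨hc, hm⟩ := (hH c).mp hc
      exact not_layable_zero_of_adj hA.top_mem (hB.mem_merged hc ((hB c hc).width 0 hm).1) hc.1
    · refine layable_one_of_center u ?_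
      have key : ∀ a ∈ merged T r u B 0, ∀ b ∈ merged T r u B 0, IsChild T r a b → a = u := by
        intro a ha b hb hab
        by_contra hau
        obtain ⟨c, hcA, hc, hac⟩ := hA.exists_child hT ha hau
        exact not_layable_zero_of_adj (A := descendants T r c ∩ merged T r u B 0) ⟨hac, ha⟩
          ⟨descendants_trans hT hab.2 hac, hb⟩ hab.1 (hB.pieces hT 0 c hcA hc)
      intro a ha b hb hab
      rcases isChild_or_isChild (r := r) hT hab with h | h
      · exact Or.inl (key a ha b hb h)
      · exact Or.inr (key b hb a ha h)
  · refine .plain (Nat.le_zero.mp (layoutWidth_le_iff.mpr ?_)) fun x hx => absurd hx.pos (by omega)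
    have key : ∀ w ∈ merged T r u B 0, w = u := by
      rintro w (h | ⟨c, hc, hw⟩)
      · exact h
      · exfalso
        have h0 : 0 ∉ (lab c).entries := fun hm =>
          h1 (Finset.card_pos.mpr ⟨c, (hH c).mpr ⟨hc, hm⟩⟩)
        rw [(hB c hc).eq_empty h0] at hw
        exact hw
    refine layable_zero_of_isolated fun a ha b hb hab => ?_
    rw [key a ha, key b hb] at hab
    exact hab.ne rfl

/-- The case in which the subtree at `u` is a star and `u` is one of its leaves. -/
theorem hasLabel_one (hT : T.IsTree) (hB : ChildTruncations T r u lab B) {c : V}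
    (hc : IsChild T r u c) (hm : 1 ∈ (lab c).entries) (hncr : (lab c).hasCritical 1 = false)
    (huniq : ∀ d, IsChild T r u d → (B d 1).Nonempty → d = c) :
    HasLabel T r u (merged T r u B 1) [1] true := by
  have hA := hB.rooted hT 1
  have hne := ((hB c hc).width 1 hm).1
  have hS := (hB c hc).rooted 1 hne
  have hSl := (hB c hc).layable 1
  have hcA := hB.mem_merged hc hne
  have hu : ∀ w ∈ merged T r u B 1, w ≠ u → w ∈ B c 1 := by
    rintro w (h | ⟨d, hd, hw⟩) hwu
    · exact absurd h hwu
    · rwa [← huniq d hd ⟨w, hw⟩]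
  have hncrit := ((hB c hc).not_critical 0 hm hncr).1 c
  -- The piece is a star with centre `c`. Otherwise some child `v` of `c` would have a child `w`; a
  -- second child of `c` would give a path on four vertices, so `v` would be the only one and `c`
  -- would be 1-critical.
  have hleaf : ∀ a ∈ B c 1, ∀ b ∈ B c 1, IsChild T r a b → a = c := by
    intro a ha b hb hab
    by_contra hac
    obtain ⟨v, hv, hcv, hav⟩ := hS.exists_child hT ha hac
    have hDv : ¬ Layable T (descendants T r v ∩ B c 1) 0 :=
      not_layable_zero_of_adj ⟨hav, ha⟩ ⟨descendants_trans hT hab.2 hav, hb⟩ hab.1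
    obtain ⟨w, hw, hvw⟩ := (hS.inter_descendants hT hv).exists_child_of_not_layable hT hDv
    refine hncrit ⟨hS.top_mem, ?_, Or.inr ⟨rfl, v, ⟨hcv, hv, ?_⟩, ?_⟩⟩
    · rw [inter_eq_right.mpr hS.subset]
      exact ((hB c hc).width 1 hm).2
    · exact layoutWidth_eq_succ_iff.mpr ⟨hSl.mono inter_subset_right le_rfl, hDv⟩
    · rintro v' ⟨hcv', hv', -⟩
      by_contra hne
      refine not_layable_one_of_path hw.2 hv hS.top_mem hv' hvw.1.symm hcv.1.symm hcv'.1 ?_ ?_ hSl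
      · rintro rfl
        exact hcv.notMem_descendants hT hw.1
      · exact Ne.symm hne
  have hkey : ∀ a ∈ merged T r u B 1, ∀ b ∈ merged T r u B 1, IsChild T r a b →
      a = c ∨ b = c := by
    intro a ha b hb hab
    have hbS := hu b hb (hA.ne_top_of_isChild hT hab ha)
    by_cases hau : a = u
    · subst hau
      exact Or.inr (hab.eq_of_mem_descendants hT hc (mem_descendants_self hT b) (hS.subset hbS))
    · exact Or.inl (hleaf a (hu a ha hau) b hbS hab)
  have hlay : Layable T (merged T r u B 1) 1 := by
    refine layable_one_of_center c fun a ha b hb hab => ?_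
    rcases isChild_or_isChild (r := r) hT hab with h | h
    · exact hkey a ha b hb h
    · exact (hkey b hb a ha h).symm
  have hw : layoutWidth T (merged T r u B 1) = 1 := layoutWidth_eq_succ_iff.mpr
    ⟨hlay, not_layable_zero_of_adj hA.top_mem hcA hc.1⟩
  refine .starred hw ⟨hA.top_mem, ?_, Or.inr ⟨rfl, c, ⟨hc, hcA, ?_⟩, ?_⟩⟩
  · rwa [inter_eq_right.mpr hA.subset]
  · rw [hB.inter_merged hT 1 hc]
    exact ((hB c hc).width 1 hm).2
  · rintro d ⟨hd, hdA, -⟩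
    refine huniq d hd ⟨d, ?_⟩
    rw [← hB.inter_merged hT 1 hd]
    exact ⟨mem_descendants_self hT d, hdA⟩

/-- A path on four vertices rules out width 1. A 1-critical vertex lies on a descending path of
three vertices and its parent precedes it; otherwise the path runs from a child of `c` through `c`
and `u` to `d`. -/
theorem hasLabel_two (hT : T.IsTree) (hB : ChildTruncations T r u lab B) {c : V}
    (hc : IsChild T r u c) (hm : 1 ∈ (lab c).entries)
    (h : (∃ d, IsChild T r u d ∧ (lab d).hasCritical 1 = true) ∨
      ∃ d, IsChild T r u d ∧ d ≠ c ∧ (B d 1).Nonempty) :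
    HasLabel T r u (merged T r u B 1) [2] false := by
  have hA := hB.rooted hT 1
  have hpieces := hB.pieces hT 1
  refine hA.hasLabel_succ hT hpieces ?_ (hA.layable_succ hT le_rfl hpieces)
  have hmem : ∀ {d w}, IsChild T r u d → w ∈ B d 1 → w ∈ merged T r u B 1 := fun hd hw =>
    Or.inr ⟨_, hd, hw⟩
  rcases h with ⟨d, hd, hcr⟩ | ⟨d, hd, hdc, hne⟩
  · obtain ⟨x, hxu, hxd, hx, -⟩ := hB.exists_critical hT hd hcr
    obtain ⟨v, hxv, hv, hvw⟩ := hx.exists_child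
    obtain ⟨w, hw, hvw⟩ := (hA.inter_descendants hT hv).exists_child_of_not_layable hT
      (layoutWidth_eq_succ_iff.mp hvw).2
    obtain ⟨y, hyx⟩ := exists_parent (r := r) (w := x) hT (by
      rintro rfl
      exact hxu ((root_mem_descendants_iff hT).mp (hA.subset hx.1)).symm)
    have hy := hA.parent_mem y x hyx hx.1 hxu
    refine not_layable_one_of_path hy hx.1 hv hw.2 hyx.1 hxv.1 hvw.1 ?_ ?_
    · rintro rfl
      exact hyx.notMem_descendants hT hxv.2
    · rintro rfl
      exact hxv.notMem_descendants hT hw.1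
  · obtain ⟨w, hw, hcw⟩ := ((hB c hc).rooted 1 ((hB c hc).width 1 hm).1).exists_child_of_not_layable
      hT ((hB c hc).not_layable hm)
    refine not_layable_one_of_path (hmem hc hw)
      (hmem hc ((hB c hc).rooted 1 ⟨w, hw⟩).top_mem) hA.top_mem
      (hmem hd ((hB d hd).rooted 1 hne).top_mem) hcw.1.symm hc.1.symm hd.1 ?_ hdc.symm
    rintro rfl
    exact hB.top_notMem hT hc hw

/-- The label after iteration 0 tells whether 0 occurs at some child. So `n(1) = 1` together with
the list `(0)` says that exactly one child has a nonempty piece. -/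
theorem hasLabel_labelStep_one (hT : T.IsTree) (hB : ChildTruncations T r u lab B) {cs : List V}
    (hnd : cs.Nodup) (hcs : ∀ c, c ∈ cs ↔ IsChild T r u c) (L₀ : Label) :
    HasLabel T r u (merged T r u B 1)
      (labelStep (cs.map lab) (labelStep (cs.map lab) L₀ 0) 1).entries
      (labelStep (cs.map lab) (labelStep (cs.map lab) L₀ 0) 1).starred := by
  obtain ⟨H₀, hH₀, hcard₀⟩ := exists_children_finset hnd hcs lab 0
  obtain ⟨H, hH, hcard⟩ := exists_children_finset hnd hcs lab 1
  have hcrit := any_hasCritical_iff hcs lab 1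
  have hL := hB.hasLabel_labelStep_zero hT hnd hcs L₀
  have hL0 : labelStep (cs.map lab) L₀ 0 = if 1 ≤ H₀.card then ⟨[1], false⟩ else ⟨[0], false⟩ := by
    simp [labelStep, hcard₀]
  generalize labelStep (cs.map lab) L₀ 0 = L at hL hL0 ⊢
  unfold labelStep
  simp only [hcard, one_ne_zero, if_false, if_true]
  split_ifs with c1 c2
  · obtain ⟨h1, h2, h3, -⟩ := c1
    obtain ⟨c, hcH⟩ := Finset.card_eq_one.mp h1
    obtain ⟨hc, hm⟩ := (hH c).mp (by simp [hcH])
    have hncr : ∀ d, IsChild T r u d → (lab d).hasCritical 1 = false := by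
      intro d hd
      by_contra hno
      rw [hcrit.mpr ⟨d, hd, by simpa using hno⟩] at h2
      simp at h2
    have h0 : H₀ = ∅ := by
      rw [← Finset.card_eq_zero]
      by_contra hpos
      rw [hL0, if_pos (by omega)] at h3
      simp at h3
    refine hB.hasLabel_one hT hc hm (hncr c hc) fun d hd hne => ?_
    by_contra hdc
    have h1d : 0 + 1 ∉ (lab d).entries := fun h => by
      have := (hH d).mpr ⟨hd, h⟩
      rw [hcH, Finset.mem_singleton] at this
      exact hdc this
    have h0d : 0 ∉ (lab d).entries := fun h => by simpa [h0] using (hH₀ d).mpr ⟨hd, h⟩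
    rw [← zero_add 1, (hB d hd).eq_pred 0 h1d, (hB d hd).eq_empty h0d] at hne
    exact not_nonempty_empty hne
  · obtain ⟨c, hcH⟩ := Finset.card_pos.mp c2
    obtain ⟨hc, hm⟩ := (hH c).mp hcH
    refine hB.hasLabel_two hT hc hm ?_
    by_cases hcr : (cs.map lab).any (Label.hasCritical 1) = true
    · exact Or.inl (hcrit.mp hcr)
    · rw [Bool.not_eq_true] at hcr
      right
      by_cases h2 : H.card = 1
      · have h0 : H₀.Nonempty := by
          rw [← Finset.card_pos]
          by_contra hno
          rw [if_neg (show ¬ 1 ≤ H₀.card from hno)] at hL0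
          exact c1 ⟨h2, hcr, by rw [hL0], by rw [hL0]⟩
        obtain ⟨d, hd⟩ := h0
        obtain ⟨hd, hdm⟩ := (hH₀ d).mp hd
        have hBd := ((hB d hd).width 0 hdm).1
        -- The entry 1 of `c` is not critical, so nothing is left of `c` at level 0, whereas `d`
        -- still has a vertex there.
        have hdc : d ≠ c := by
          rintro rfl
          have hncr : (lab d).hasCritical 1 = false := by
            by_contra hno
            rw [hcrit.mpr ⟨d, hd, by simpa using hno⟩] at hcr
            simp at hcr
          rw [((hB d hd).not_critical 0 hm hncr).2] at hBd
          exact not_nonempty_empty hBd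
        refine ⟨d, hd, hdc, ?_⟩
        rwa [← zero_add 1, (hB d hd).eq_pred 0]
        intro hdm1
        obtain ⟨e, he⟩ := Finset.card_eq_one.mp h2
        have h3 := (hH d).mpr ⟨hd, hdm1⟩
        rw [he, Finset.mem_singleton] at h3 hcH
        exact hdc (h3.trans hcH.symm)
      · obtain ⟨d, hd, hdc⟩ := Finset.exists_mem_ne (by omega : 1 < H.card) c
        obtain ⟨hd, hdm⟩ := (hH d).mp hd
        exact ⟨d, hd, hdc, ((hB d hd).width 1 hdm).1⟩
  · have hH0 : H = ∅ := Finset.card_eq_zero.mp (by omega)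
    rw [← zero_add 1, hB.merged_succ_eq fun c hc hm => by simpa [hH0] using (hH c).mpr ⟨hc, hm⟩]
    exact hL

theorem hasLabel_foldl (hT : T.IsTree) (hB : ChildTruncations T r u lab B) {cs : List V}
    (hnd : cs.Nodup) (hcs : ∀ c, c ∈ cs ↔ IsChild T r u c) (L₀ : Label) (k : ℕ) :
    HasLabel T r u (merged T r u B k)
      ((List.range (k + 1)).foldl (labelStep (cs.map lab)) L₀).entries
      ((List.range (k + 1)).foldl (labelStep (cs.map lab)) L₀).starred := by
  induction k with
  | zero => simpa using hB.hasLabel_labelStep_zero hT hnd hcs L₀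
  | succ k ih =>
    rw [List.range_succ, List.foldl_append]
    rcases Nat.eq_zero_or_pos k with rfl | hk
    · simpa using hB.hasLabel_labelStep_one hT hnd hcs L₀
    · exact hB.hasLabel_labelStep hT hk hnd hcs ih

end ChildTruncations

/-- The largest entry of the given labels. -/
def maxEntry (ls : List Label) : ℕ := (ls.flatMap Label.entries).foldr max 0

theorem le_maxEntry {ls : List Label} {L : Label} (hL : L ∈ ls) {e : ℕ} (he : e ∈ L.entries) :
    e ≤ maxEntry ls := by
  have key : ∀ l : List ℕ, ∀ e ∈ l, e ≤ l.foldr max 0 := by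
    intro l
    induction l with
    | nil => simp
    | cons a l ih =>
      simp only [List.mem_cons, forall_eq_or_imp, List.foldr_cons]
      exact ⟨le_max_left _ _, fun e he => (ih e he).trans (le_max_right _ _)⟩
  exact key _ e (List.mem_flatMap.mpr ⟨L, hL, he⟩)

/-- A leaf needs no separate treatment: iteration 0 on the empty list gives `(0)`. -/
theorem labelAlgorithm_eq_foldl (ls : List Label) :
    labelAlgorithm ls = (List.range (maxEntry ls + 1)).foldl (labelStep ls) ⟨[], false⟩ := by
  cases ls with
  | nil => simp [labelAlgorithm, maxEntry, labelStep]
  | cons L ls => simp [labelAlgorithm, maxEntry]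

/-- At the largest entry no truncation takes place, so the merged set is the whole subtree at `u`.
-/
theorem isLabel_labelAlgorithm [Finite V] (hT : T.IsTree) {cs : List V} (hnd : cs.Nodup)
    (hcs : ∀ c, c ∈ cs ↔ IsChild T r u c) (h : ∀ c ∈ cs, IsLabel T r c (lab c)) :
    IsLabel T r u (labelAlgorithm (cs.map lab)) := by
  have hex : ∀ c, ∃ B, IsChild T r u c → Truncation T r c (lab c) (descendants T r c) B := by
    intro c
    by_cases hc : IsChild T r u c
    · obtain ⟨B, hB⟩ := ((isLabel_iff_hasLabel hT).mp (h c ((hcs c).mpr hc))).exists_truncation hT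
        (rooted_descendants hT c)
      exact ⟨B, fun _ => hB⟩
    · exact ⟨fun _ => ∅, fun h => absurd h hc⟩
  choose B hB using hex
  have hB' : ChildTruncations T r u lab B := hB
  rw [isLabel_iff_hasLabel hT, labelAlgorithm_eq_foldl]
  convert hB'.hasLabel_foldl hT hnd hcs ⟨[], false⟩ (maxEntry (cs.map lab)) using 1
  ext w
  have hBc : ∀ c, IsChild T r u c → B c (maxEntry (cs.map lab)) = descendants T r c := fun c hc =>
    (hB c hc).eq_self _ fun e he => le_maxEntry (List.mem_map.mpr ⟨c, (hcs c).mpr hc, rfl⟩) he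
  constructor
  · intro hw
    by_cases hwu : w = u
    · exact Or.inl hwu
    · obtain ⟨c, hc, hwc⟩ := exists_isChild_mem_descendants hT hw hwu
      exact Or.inr ⟨c, hc, by rwa [hBc c hc]⟩
  · rintro (rfl | ⟨c, hc, hwc⟩)
    · exact mem_descendants_self hT w
    · rw [hBc c hc] at hwc
      exact descendants_trans hT hwc hc.2

theorem exists_map_eq_of_forall₂ {α β : Type*} {R : α → β → Prop} {l : List α} {l' : List β}
    [Nonempty β] (h : List.Forall₂ R l l') (hnd : l.Nodup) :
    ∃ f : α → β, l' = l.map f ∧ ∀ a ∈ l, R a (f a) := by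
  classical
  induction h with
  | nil => exact ⟨fun _ => Classical.arbitrary β, rfl, by simp⟩
  | @cons a b l l' hab _ ih =>
    rw [List.nodup_cons] at hnd
    obtain ⟨f, rfl, hf⟩ := ih hnd.2
    have hne : ∀ x ∈ l, x ≠ a := by
      rintro x hx rfl
      exact hnd.1 hx
    refine ⟨Function.update f a b, ?_, ?_⟩
    · rw [List.map_cons, Function.update_self]
      exact congrArg _ (List.map_congr_left fun x hx => by rw [Function.update_of_ne (hne x hx)])
    · simp only [List.mem_cons, forall_eq_or_imp, Function.update_self]
      exact ⟨hab, fun x hx => by rw [Function.update_of_ne (hne x hx)]; exact hf x hx⟩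

/-- Induction over a rooted tree, from the leaves to the root. -/
theorem leaf_induction [Finite V] (hT : T.IsTree) (r : V) {P : V → Prop}
    (h : ∀ v, (∀ c, IsChild T r v c → P c) → P v) (v : V) : P v := by
  induction hn : (descendants T r v).ncard using Nat.strong_induction_on generalizing v with
  | _ n ih =>
    refine h v fun c hc => ih _ ?_ c rfl
    rw [← hn]
    exact ncard_lt_ncard ⟨descendants_subset hT hc.2, fun hs =>
      hc.notMem_descendants hT (hs (mem_descendants_self hT v))⟩ (toFinite _)

theorem IsLabel.head?_eq [Finite V] (hT : T.IsTree) {L : Label} (h : IsLabel T r r L) :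
    L.entries.head? = some (monotoneHunterNumber T) := by
  rw [isLabel_iff_hasLabel hT] at h
  rw [h.head?_eq, ← (rooted_descendants hT r).mhOn_eq hT, descendants_root hT, mhOn_univ hT]

theorem isLabel_of_recursion [Finite V] (hT : T.IsTree) {children : V → List V} {lab : V → Label}
    (hch : ∀ v, (children v).Nodup ∧ ∀ c, c ∈ children v ↔ IsChild T r v c)
    (hlab : ∀ v, lab v = labelAlgorithm ((children v).map lab)) (v : V) :
    IsLabel T r v (lab v) := by
  refine leaf_induction hT r (P := fun v => IsLabel T r v (lab v)) (fun v ih => ?_) v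
  rw [hlab v]
  exact isLabel_labelAlgorithm hT (hch v).1 (hch v).2 fun c hc => ih c (((hch v).2 c).mp hc)

end Algorithm

end HuntersRabbit

namespace HuntersRabbit

/-! ### A language of bounded loops and its compilation -/

section ForLanguage

/-- Expressions over the input size, loop counters and array cells. -/
inductive Expr where
  | const (c : ℕ)
  | size
  | ctr (j : ℕ)
  | read (a : ℕ) (e : Expr)
  | add (e f : Expr)
  | sub (e f : Expr)
  | mulSize (e : Expr)
  | ite (c e f : Expr)

/-- Statements: array assignments, composition, and loops whose counter runs through the numbers
below the input size. -/
inductive Stmt where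
  | assign (a : ℕ) (i e : Expr)
  | seq (s t : Stmt)
  | loop (s : Stmt)

namespace Expr

/-- The value of an expression, where `ρ 0` is the input size and `ρ (j + 1)` is the counter of the
loop at depth `j`. -/
def eval (ρ : ℕ → ℕ) (arr : ℕ → ℕ → ℕ) : Expr → ℕ
  | const c => c
  | size => ρ 0
  | ctr j => ρ (j + 1)
  | read a e => arr a (e.eval ρ arr)
  | add e f => e.eval ρ arr + f.eval ρ arr
  | sub e f => e.eval ρ arr - f.eval ρ arr
  | mulSize e => e.eval ρ arr * ρ 0
  | ite c e f => if c.eval ρ arr ≠ 0 then e.eval ρ arr else f.eval ρ arr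

/-- Only the counters of the loops at depth less than `d` occur. -/
def Closed (d : ℕ) : Expr → Prop
  | const _ => True
  | size => True
  | ctr j => j < d
  | read _ e => e.Closed d
  | add e f => e.Closed d ∧ f.Closed d
  | sub e f => e.Closed d ∧ f.Closed d
  | mulSize e => e.Closed d
  | ite c e f => c.Closed d ∧ e.Closed d ∧ f.Closed d

/-- The program that writes the value of an expression to register `x`. -/
def compile : Expr → ℕ → Program
  | const c, x => .instr (.const x c)
  | size, x => .instr (.copy x 0)
  | ctr j, x => .instr (.copy x (j + 1))
  | read a e, x => .seq (e.compile x) (.instr (.load x a x))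
  | add e f, x => .seq (e.compile x) (.seq (f.compile (x + 1)) (.instr (.add x x (x + 1))))
  | sub e f, x => .seq (e.compile x) (.seq (f.compile (x + 1)) (.instr (.sub x x (x + 1))))
  -- Repeated addition: register `x + 1` counts down from the size, `x + 2` accumulates, and `x + 3`
  -- holds the constant 1.
  | mulSize e, x => .seq (e.compile x) (.seq (.instr (.copy (x + 1) 0))
      (.seq (.instr (.const (x + 2) 0)) (.seq (.instr (.const (x + 3) 1))
      (.seq (.loop (x + 1) (.seq (.instr (.add (x + 2) (x + 2) x))
        (.instr (.sub (x + 1) (x + 1) (x + 3))))) (.instr (.copy x (x + 2)))))))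
  | ite c e f, x => .seq (c.compile x) (.cond x (e.compile x) (f.compile x))

/-- A bound for the time needed to evaluate an expression. -/
noncomputable def cost : Expr → Polynomial ℕ
  | const _ => 1
  | size => 1
  | ctr _ => 1
  | read _ e => e.cost + 1
  | add e f => e.cost + (f.cost + 1)
  | sub e f => e.cost + (f.cost + 1)
  | mulSize e => e.cost + (3 * Polynomial.X + 5)
  | ite c e f => c.cost + (e.cost + f.cost + 1)

theorem eval_congr {d : ℕ} {ρ ρ' : ℕ → ℕ} (arr : ℕ → ℕ → ℕ) (h : ∀ x ≤ d, ρ x = ρ' x) {e : Expr}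
    (he : e.Closed d) : e.eval ρ arr = e.eval ρ' arr := by
  induction e with
  | const c => rfl
  | size => exact h 0 (Nat.zero_le _)
  | ctr j => exact h (j + 1) he
  | read a e ih => simp only [eval, ih he]
  | add e f ihe ihf => simp only [eval, ihe he.1, ihf he.2]
  | sub e f ihe ihf => simp only [eval, ihe he.1, ihf he.2]
  | mulSize e ih => simp only [eval, ih he, h 0 (Nat.zero_le _)]
  | ite c e f ihc ihe ihf => simp only [eval, ihc he.1, ihe he.2.1, ihf he.2.2]

end Expr

/-- The program runs from `σ` in at most `b` steps to a memory satisfying `Q`. -/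
def RunsTo (P : Program) (σ : Memory) (b : ℕ) (Q : Memory → Prop) : Prop :=
  ∃ t σ', Exec P σ t σ' ∧ t ≤ b ∧ Q σ'

namespace RunsTo

variable {P P' : Program} {σ : Memory} {b b' : ℕ} {Q Q' : Memory → Prop}

theorem instr {i : Instr} (hb : 1 ≤ b) (h : Q (i.apply σ)) : RunsTo (.instr i) σ b Q :=
  ⟨1, _, .instr i σ, hb, h⟩

theorem seq (h : RunsTo P σ b Q) (h' : ∀ σ', Q σ' → RunsTo P' σ' b' Q') :
    RunsTo (.seq P P') σ (b + b') Q' := by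
  obtain ⟨t, σ', he, ht, hQ⟩ := h
  obtain ⟨t', σ'', he', ht', hQ'⟩ := h' σ' hQ
  exact ⟨_, _, .seq he he', add_le_add ht ht', hQ'⟩

theorem mono (h : RunsTo P σ b Q) (hb : b ≤ b') (hQ : ∀ σ', Q σ' → Q' σ') : RunsTo P σ b' Q' := by
  obtain ⟨t, σ', he, ht, h⟩ := h
  exact ⟨t, σ', he, ht.trans hb, hQ σ' h⟩

theorem cond {x : ℕ} (h1 : σ.reg x ≠ 0 → RunsTo P σ b Q) (h2 : σ.reg x = 0 → RunsTo P' σ b Q) :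
    RunsTo (.cond x P P') σ (b + 1) Q := by
  by_cases h : σ.reg x = 0
  · obtain ⟨t, σ', he, ht, hQ⟩ := h2 h
    exact ⟨_, _, .cond_zero h he, by omega, hQ⟩
  · obtain ⟨t, σ', he, ht, hQ⟩ := h1 h
    exact ⟨_, _, .cond_nonzero h he, by omega, hQ⟩

/-- A loop that is executed `n` times. -/
theorem loop {x n : ℕ} (I : ℕ → Memory → Prop) (hreg : ∀ j ≤ n, ∀ σ, I j σ → σ.reg x = n - j)
    (hbody : ∀ j < n, ∀ σ, I j σ → RunsTo P σ b (I (j + 1))) (h : I 0 σ) :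
    RunsTo (.loop x P) σ (n * (b + 1) + 1) (I n) := by
  have key : ∀ k j σ, j + k = n → I j σ → RunsTo (.loop x P) σ (k * (b + 1) + 1) (I n) := by
    intro k
    induction k with
    | zero =>
      rintro j σ rfl h
      exact ⟨1, σ, .loop_zero (by rw [hreg j le_rfl σ h]; omega), by omega, h⟩
    | succ k ih =>
      intro j σ hj h
      obtain ⟨t, σ', he, ht, h'⟩ := hbody j (by omega) σ h
      obtain ⟨t', σ'', he', ht', h''⟩ := ih (j + 1) σ' (by omega) h'
      refine ⟨_, _, .loop_nonzero (by rw [hreg j (by omega) σ h]; omega) he he', ?_, h''⟩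
      rw [Nat.succ_mul]
      omega
  exact key n 0 σ (by omega) h

end RunsTo

/-- Registers below `x` survive, in particular the size and the loop counters, so a second operand
has the same value after the first has been computed. -/
theorem Expr.compile_runsTo {d : ℕ} (e : Expr) (he : e.Closed d) :
    ∀ (x : ℕ) (σ : Memory), d < x → RunsTo (e.compile x) σ (e.cost.eval (σ.reg 0)) fun σ' =>
      σ'.arr = σ.arr ∧ (∀ y < x, σ'.reg y = σ.reg y) ∧ σ'.reg x = e.eval σ.reg σ.arr := by
  induction e with
  | const c =>
    intro x σ hx
    refine .instr (by simp [cost]) ⟨rfl, fun y hy => ?_, ?_⟩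
    · simp [Instr.apply, hy.ne]
    · simp [Instr.apply, eval]
  | size =>
    intro x σ hx
    refine .instr (by simp [cost]) ⟨rfl, fun y hy => ?_, ?_⟩
    · simp [Instr.apply, hy.ne]
    · simp [Instr.apply, eval]
  | ctr j =>
    intro x σ hx
    refine .instr (by simp [cost]) ⟨rfl, fun y hy => ?_, ?_⟩
    · simp [Instr.apply, hy.ne]
    · simp [Instr.apply, eval]
  | read a e ih =>
    intro x σ hx
    simp only [cost, Polynomial.eval_add, Polynomial.eval_one]
    refine (ih he x σ hx).seq fun σ' ⟨h1, h2, h3⟩ => .instr le_rfl ⟨h1, fun y hy => ?_, ?_⟩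
    · simp [Instr.apply, hy.ne, h2 y hy]
    · simp [Instr.apply, eval, h1, h3]
  | add e f ihe ihf =>
    intro x σ hx
    simp only [cost, Polynomial.eval_add, Polynomial.eval_one]
    refine (ihe he.1 x σ hx).seq fun σ' ⟨h1, h2, h3⟩ => ?_
    rw [← h2 0 (by omega)]
    refine (ihf he.2 (x + 1) σ' (by omega)).seq fun σ'' ⟨h4, h5, h6⟩ =>
      .instr le_rfl ⟨h4.trans h1, fun y hy => ?_, ?_⟩
    · simp [Instr.apply, hy.ne, h5 y (by omega), h2 y hy]
    · have := eval_congr σ.arr (fun y hy => h2 y (by omega)) he.2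
      simp [Instr.apply, eval, h5 x (by omega), h3, h6, h1, this]
  | sub e f ihe ihf =>
    intro x σ hx
    simp only [cost, Polynomial.eval_add, Polynomial.eval_one]
    refine (ihe he.1 x σ hx).seq fun σ' ⟨h1, h2, h3⟩ => ?_
    rw [← h2 0 (by omega)]
    refine (ihf he.2 (x + 1) σ' (by omega)).seq fun σ'' ⟨h4, h5, h6⟩ =>
      .instr le_rfl ⟨h4.trans h1, fun y hy => ?_, ?_⟩
    · simp [Instr.apply, hy.ne, h5 y (by omega), h2 y hy]
    · have := eval_congr σ.arr (fun y hy => h2 y (by omega)) he.2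
      simp [Instr.apply, eval, h5 x (by omega), h3, h6, h1, this]
  | mulSize e ih =>
    intro x σ hx
    let Q : Memory → Prop := fun σ' => σ'.arr = σ.arr ∧ (∀ y < x, σ'.reg y = σ.reg y) ∧
      σ'.reg x = e.eval σ.reg σ.arr
    let I : ℕ → Memory → Prop := fun j σ' => Q σ' ∧ σ'.reg (x + 1) = σ.reg 0 - j ∧
      σ'.reg (x + 2) = e.eval σ.reg σ.arr * j ∧ σ'.reg (x + 3) = 1
    have hQ : ∀ (σ' : Memory) (y v : ℕ), x < y → Q σ' →
        Q { σ' with reg := Function.update σ'.reg y v } := by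
      rintro σ' y v hy ⟨h1, h2, h3⟩
      refine ⟨h1, fun z hz => ?_, ?_⟩
      · simp [show z ≠ y by omega, h2 z hz]
      · simp [show x ≠ y by omega, h3]
    have hloop : ∀ σ', I 0 σ' → RunsTo (.loop (x + 1) (.seq (.instr (.add (x + 2) (x + 2) x))
        (.instr (.sub (x + 1) (x + 1) (x + 3))))) σ' (σ.reg 0 * (1 + 1 + 1) + 1)
          (I (σ.reg 0)) := by
      intro σ' h0
      refine RunsTo.loop I (fun j _ σ h => h.2.1) ?_ h0
      rintro j hj σ₁ ⟨h1, h2, h3, h4⟩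
      refine RunsTo.seq (Q := fun σ₂ => Q σ₂ ∧ σ₂.reg (x + 1) = σ.reg 0 - j ∧
        σ₂.reg (x + 2) = e.eval σ.reg σ.arr * (j + 1) ∧ σ₂.reg (x + 3) = 1)
        (.instr le_rfl ⟨hQ _ _ _ (by omega) h1, ?_, ?_, ?_⟩) ?_
      · simpa [Instr.apply] using h2
      · simp [Instr.apply, h3, h1.2.2, Nat.mul_succ]
      · simpa [Instr.apply] using h4
      · rintro σ₂ ⟨h5, h6, h7, h8⟩
        refine .instr le_rfl ⟨hQ _ _ _ (by omega) h5, ?_, ?_, ?_⟩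
        · simp only [Instr.apply, Function.update_self, h6, h8]
          omega
        · simpa [Instr.apply] using h7
        · simpa [Instr.apply] using h8
    refine RunsTo.mono (RunsTo.seq (ih he x σ hx) (Q' := fun σ' => σ'.arr = σ.arr ∧
      (∀ y < x, σ'.reg y = σ.reg y) ∧ σ'.reg x = (mulSize e).eval σ.reg σ.arr)
      (b' := 1 + (1 + (1 + (σ.reg 0 * (1 + 1 + 1) + 1 + 1)))) fun σ₁ h1 => ?_) ?_ fun _ h => h
    · refine RunsTo.seq (Q := fun σ' => Q σ' ∧ σ'.reg (x + 1) = σ.reg 0)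
        (.instr le_rfl ⟨hQ _ _ _ (by omega) h1, ?_⟩) fun σ₂ ⟨h2, h3⟩ => ?_
      · simp [Instr.apply, h1.2.1 0 (by omega)]
      refine RunsTo.seq (Q := fun σ' => Q σ' ∧ σ'.reg (x + 1) = σ.reg 0 ∧ σ'.reg (x + 2) = 0)
        (.instr le_rfl ⟨hQ _ _ _ (by omega) h2, ?_, ?_⟩) fun σ₃ ⟨h4, h5, h6⟩ => ?_
      · simpa [Instr.apply] using h3
      · simp [Instr.apply]
      refine RunsTo.seq (Q := I 0)
        (.instr le_rfl ⟨hQ _ _ _ (by omega) h4, ?_, ?_, ?_⟩) fun σ₄ h7 => ?_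
      · simpa [Instr.apply] using h5
      · simpa [Instr.apply] using h6
      · simp [Instr.apply]
      refine (hloop σ₄ h7).seq fun σ₅ h8 => .instr le_rfl ⟨h8.1.1, fun y hy => ?_, ?_⟩
      · simp [Instr.apply, hy.ne, h8.1.2.1 y hy]
      · simp [Instr.apply, h8.2.2.1, eval]
    · simp only [cost, Polynomial.eval_add, Polynomial.eval_mul, Polynomial.eval_X,
        Polynomial.eval_ofNat]
      omega
  | ite c e f ihc ihe ihf =>
    intro x σ hx
    simp only [cost, Polynomial.eval_add, Polynomial.eval_one]
    refine (ihc he.1 x σ hx).seq fun σ' ⟨h1, h2, h3⟩ => ?_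
    have h0 := h2 0 (by omega)
    refine .cond (fun hc => ?_) (fun hc => ?_)
    · rw [h3] at hc
      refine (ihe he.2.1 x σ' hx).mono (by rw [h0]; omega) fun σ'' ⟨h4, h5, h6⟩ =>
        ⟨h4.trans h1, fun y hy => (h5 y hy).trans (h2 y hy), ?_⟩
      rw [h6, h1, eval, if_pos hc]
      exact eval_congr σ.arr (fun y hy => h2 y (by omega)) he.2.1
    · rw [h3] at hc
      refine (ihf he.2.2 x σ' hx).mono (by rw [h0]; omega) fun σ'' ⟨h4, h5, h6⟩ =>
        ⟨h4.trans h1, fun y hy => (h5 y hy).trans (h2 y hy), ?_⟩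
      rw [h6, h1, eval, if_neg (not_not.mpr hc)]
      exact eval_congr σ.arr (fun y hy => h2 y (by omega)) he.2.2

namespace Stmt

/-- The effect on the arrays of a statement at loop depth `d`. -/
def run : Stmt → ℕ → (ℕ → ℕ) → (ℕ → ℕ → ℕ) → ℕ → ℕ → ℕ
  | assign a i e, _, ρ, arr =>
      Function.update arr a (Function.update (arr a) (i.eval ρ arr) (e.eval ρ arr))
  | seq s t, d, ρ, arr => t.run d ρ (s.run d ρ arr)
  | loop s, d, ρ, arr => (List.range (ρ 0)).foldl
      (fun arr j => s.run (d + 1) (Function.update ρ (d + 1) j) arr) arr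

/-- Only the counters of the surrounding loops occur. -/
def Closed : Stmt → ℕ → Prop
  | assign _ i e, d => i.Closed d ∧ e.Closed d
  | seq s t, d => s.Closed d ∧ t.Closed d
  | loop s, d => s.Closed (d + 1)

/-- The program for a statement at loop depth `d`. -/
def compile : Stmt → ℕ → Program
  | assign a i e, d => .seq (i.compile (d + 1)) (.seq (e.compile (d + 2))
      (.instr (.store a (d + 1) (d + 2))))
  | seq s t, d => .seq (s.compile d) (t.compile d)
  -- Register `d + 1` is the counter and `d + 2` the test, equal to the size minus the counter. The
  -- body may overwrite `d + 2`, its own counter or scratch register, so the test is recomputed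
  -- after each round.
  | loop s, d => .seq (.instr (.const (d + 1) 0)) (.seq (.instr (.copy (d + 2) 0))
      (.loop (d + 2) (.seq (s.compile (d + 1)) (.seq (.instr (.const (d + 2) 1))
        (.seq (.instr (.add (d + 1) (d + 1) (d + 2))) (.instr (.sub (d + 2) 0 (d + 1))))))))

/-- A bound for the running time of a statement. -/
noncomputable def cost : Stmt → Polynomial ℕ
  | assign _ i e => i.cost + (e.cost + 1)
  | seq s t => s.cost + t.cost
  | loop s => 1 + (1 + (Polynomial.X * (s.cost + (1 + (1 + 1)) + 1) + 1))

theorem run_congr {s : Stmt} {d : ℕ} (hs : s.Closed d) {ρ ρ' : ℕ → ℕ}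
    (h : ∀ x ≤ d, ρ x = ρ' x) (arr : ℕ → ℕ → ℕ) : s.run d ρ arr = s.run d ρ' arr := by
  induction s generalizing d ρ ρ' arr with
  | assign a i e => simp only [run, Expr.eval_congr arr h hs.1, Expr.eval_congr arr h hs.2]
  | seq s t ihs iht => simp only [run, ihs hs.1 h, iht hs.2 h]
  | loop s ih =>
    simp only [run, h 0 (Nat.zero_le _)]
    congr 1
    funext arr j
    refine ih hs (fun x hx => ?_) arr
    by_cases hxd : x = d + 1
    · subst hxd
      simp
    · simp [hxd, h x (by omega)]

theorem compile_runsTo (s : Stmt) : ∀ (d : ℕ) (σ : Memory), s.Closed d →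
    RunsTo (s.compile d) σ (s.cost.eval (σ.reg 0)) fun σ' =>
      σ'.arr = s.run d σ.reg σ.arr ∧ ∀ x ≤ d, σ'.reg x = σ.reg x := by
  induction s with
  | assign a i e =>
    intro d σ hs
    simp only [cost, Polynomial.eval_add, Polynomial.eval_one]
    refine (i.compile_runsTo hs.1 (d + 1) σ (by omega)).seq fun σ' ⟨h1, h2, h3⟩ => ?_
    rw [← h2 0 (by omega)]
    refine (e.compile_runsTo hs.2 (d + 2) σ' (by omega)).seq fun σ'' ⟨h4, h5, h6⟩ =>
      .instr le_rfl ⟨?_, fun x hx => ?_⟩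
    · have := Expr.eval_congr σ.arr (fun y hy => h2 y (by omega)) hs.2
      simp [Instr.apply, run, h4, h1, h5 (d + 1) (by omega), h3, h6, this]
    · simp only [Instr.apply]
      rw [h5 x (by omega), h2 x (by omega)]
  | seq s t ihs iht =>
    intro d σ hs
    simp only [cost, Polynomial.eval_add]
    refine (ihs d σ hs.1).seq fun σ' ⟨h1, h2⟩ => ?_
    rw [← h2 0 (by omega)]
    refine (iht d σ' hs.2).mono le_rfl fun σ'' ⟨h3, h4⟩ => ⟨?_, fun x hx => ?_⟩
    · rw [h3, h1, run]
      exact run_congr hs.2 h2 _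
    · rw [h4 x hx, h2 x hx]
  | loop s ih =>
    intro d σ hs
    simp only [cost, Polynomial.eval_add, Polynomial.eval_one, Polynomial.eval_mul,
      Polynomial.eval_X]
    let arr : ℕ → ℕ → ℕ → ℕ := fun j => (List.range j).foldl
      (fun arr j => s.run (d + 1) (Function.update σ.reg (d + 1) j) arr) σ.arr
    let J : ℕ → (ℕ → ℕ → ℕ) → Memory → Prop := fun j a σ' =>
      σ'.arr = a ∧ (∀ x ≤ d, σ'.reg x = σ.reg x) ∧ σ'.reg (d + 1) = j
    have hJ : ∀ (j : ℕ) (a : ℕ → ℕ → ℕ) (σ' : Memory) (v : ℕ), J j a σ' →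
        J j a { σ' with reg := Function.update σ'.reg (d + 2) v } := by
      rintro j a σ' v ⟨h1, h2, h3⟩
      refine ⟨h1, fun x hx => ?_, by simpa using h3⟩
      simp [show x ≠ d + 2 by omega, h2 x hx]
    refine RunsTo.seq (Q := J 0 σ.arr) (.instr le_rfl ⟨rfl, fun x hx => ?_, ?_⟩) fun σ₁ h1 => ?_
    · simp [Instr.apply, show x ≠ d + 1 by omega]
    · simp [Instr.apply]
    refine RunsTo.seq (Q := fun σ' => J 0 σ.arr σ' ∧ σ'.reg (d + 2) = σ.reg 0)
      (.instr le_rfl ⟨hJ _ _ _ _ h1, ?_⟩) fun σ₂ h2 => ?_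
    · simp [Instr.apply, h1.2.1 0 (Nat.zero_le _)]
    refine RunsTo.mono (RunsTo.loop (n := σ.reg 0)
      (fun j σ' => J j (arr j) σ' ∧ σ'.reg (d + 2) = σ.reg 0 - j) (fun j _ σ' h => h.2)
      (fun j hj σ₃ h3 => ?_) h2) le_rfl fun σ' h => ⟨h.1.1, h.1.2.1⟩
    obtain ⟨⟨h4, h5, h6⟩, -⟩ := h3
    have h0 := h5 0 (Nat.zero_le _)
    rw [← h0]
    refine RunsTo.seq (Q := J j (arr (j + 1))) ((ih (d + 1) σ₃ hs).mono le_rfl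
      fun σ' ⟨h7, h8⟩ => ⟨?_, fun x hx => ?_, ?_⟩) fun σ₄ h4 => ?_
    · rw [h7, h4]
      simp only [arr, List.range_succ, List.foldl_append, List.foldl_cons, List.foldl_nil]
      refine run_congr (s := s) (d := d + 1) hs (fun x hx => ?_) _
      by_cases hxd : x = d + 1
      · subst hxd
        simp [h6]
      · simp [hxd, h5 x (by omega)]
    · rw [h8 x (by omega), h5 x hx]
    · rw [h8 _ le_rfl, h6]
    refine RunsTo.seq (Q := fun σ' => J j (arr (j + 1)) σ' ∧ σ'.reg (d + 2) = 1)
      (.instr le_rfl ⟨hJ _ _ _ _ h4, ?_⟩) fun σ₅ ⟨h5, h6⟩ => ?_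
    · simp [Instr.apply]
    refine RunsTo.seq (Q := J (j + 1) (arr (j + 1)))
      (.instr le_rfl ⟨h5.1, fun x hx => ?_, ?_⟩) fun σ₆ h7 => .instr le_rfl ⟨hJ _ _ _ _ h7, ?_⟩
    · simp [Instr.apply, show x ≠ d + 1 by omega, h5.2.1 x hx]
    · simp [Instr.apply, h5.2.2, h6]
    · simp [Instr.apply, h7.2.2, h7.2.1 0 (Nat.zero_le _), h0]

end Stmt

end ForLanguage

end HuntersRabbit

namespace HuntersRabbit

/-! ### Labels as bit vectors -/

section LabelBits

/-- Whether `m` is an entry, as a number. -/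
def conBit (L : Label) (m : ℕ) : ℕ := if Label.contains m L = true then 1 else 0

/-- Whether `m` is an entry other than an unstarred last one, as a number. -/
def critBit (L : Label) (m : ℕ) : ℕ := if Label.hasCritical m L = true then 1 else 0

/-- Which of the updates of `codeLabel` an iteration of the labelling algorithm performs. -/
def stepCode (cnt crt m x₀ x : ℕ) : ℕ :=
  if m ≠ 0 then
    if m - 1 ≠ 0 then
      if cnt - 2 ≠ 0 then 3
      else if cnt - 1 ≠ 0 then if crt ≠ 0 then 3 else 2
      else if cnt ≠ 0 then if crt ≠ 0 then if x ≠ 0 then 3 else 4 else 1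
      else 0
    else if cnt ≠ 0 then
      if cnt - 1 ≠ 0 then 3 else if crt ≠ 0 then 3 else if x₀ ≠ 0 then 2 else 3
    else 0
  else if cnt ≠ 0 then 3 else 1

/-- The possible updates of the label in iteration `m` of the labelling algorithm. -/
def codeLabel (m : ℕ) (L : Label) : ℕ → Label
  | 0 => L
  | 1 => ⟨[m], false⟩
  | 2 => ⟨[m], true⟩
  | 3 => ⟨[m + 1], false⟩
  | _ => ⟨m :: L.entries, L.starred⟩

/-- The effect of an update on `conBit`. -/
def newCon (code m j x : ℕ) : ℕ :=
  if code ≠ 0 then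
    if code - 1 ≠ 0 then
      if code - 2 ≠ 0 then
        if code - 3 ≠ 0 then if j = m then 1 else x
        else if j = m + 1 then 1 else 0
      else if j = m then 1 else 0
    else if j = m then 1 else 0
  else x

/-- The effect of an update on `critBit`. -/
def newCrit (code m j x : ℕ) : ℕ :=
  if code ≠ 0 then
    if code - 1 ≠ 0 then
      if code - 2 ≠ 0 then
        if code - 3 ≠ 0 then if j = m then 1 else x
        else 0
      else if j = m then 1 else 0
    else 0
  else x

theorem stepCode_le (cnt crt m x₀ x : ℕ) : stepCode cnt crt m x₀ x ≤ 4 := by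
  unfold stepCode
  split_ifs <;> omega

/-- In iteration 1 the current label is `(0)` or `(1)`, so the test for `(0)` reduces to the single
bit at 0. -/
theorem labelStep_eq_codeLabel {ls : List Label} {L : Label} {cnt crt m x₀ x : ℕ}
    (hcnt : cnt = ls.countP (Label.contains m))
    (hcrt : crt ≠ 0 ↔ ls.any (Label.hasCritical m) = true)
    (hx₀ : m = 1 → (x₀ ≠ 0 ↔ 0 ∈ L.entries)) (hx : 2 ≤ m → (x ≠ 0 ↔ Label.contains m L = true))
    (hL : m = 1 → L = ⟨[0], false⟩ ∨ L = ⟨[1], false⟩) :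
    labelStep ls L m = codeLabel m L (stepCode cnt crt m x₀ x) := by
  subst hcnt
  unfold labelStep stepCode
  generalize ls.countP (Label.contains m) = n at *
  rcases Nat.lt_trichotomy m 1 with hm | rfl | hm
  · obtain rfl : m = 0 := by omega
    by_cases hn : n = 0
    · simp [hn, codeLabel]
    · simp [hn, codeLabel, Nat.one_le_iff_ne_zero]
  · replace hx₀ := hx₀ rfl
    replace hL := hL rfl
    cases hb : ls.any (Label.hasCritical 1)
    · have hcrt0 : crt = 0 := by simpa [hb] using hcrt
      rcases hL with rfl | rfl
      · have : x₀ ≠ 0 := hx₀.mpr (by simp)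
        rcases Nat.lt_trichotomy n 1 with hn | rfl | hn
        · obtain rfl : n = 0 := by omega
          simp [codeLabel]
        · simp [hcrt0, this, codeLabel]
        · simp [show n ≠ 1 by omega, show n ≠ 0 by omega, show n - 1 ≠ 0 by omega,
            show 1 ≤ n by omega, codeLabel]
      · have : x₀ = 0 := by simpa using hx₀
        rcases Nat.lt_trichotomy n 1 with hn | rfl | hn
        · obtain rfl : n = 0 := by omega
          simp [codeLabel]
        · simp [hcrt0, this, codeLabel]
        · simp [show n ≠ 0 by omega, show n - 1 ≠ 0 by omega,
            show 1 ≤ n by omega, codeLabel]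
    · have hcrt0 : crt ≠ 0 := hcrt.mpr hb
      by_cases hn : n = 0
      · simp [hn, codeLabel]
      · simp [hn, hcrt0, show 1 ≤ n by omega, codeLabel]
  · replace hx := hx hm
    have h0 : m ≠ 0 := by omega
    have h1 : m ≠ 1 := by omega
    have h2 : m - 1 ≠ 0 := by omega
    have hcases : n = 0 ∨ n = 1 ∨ n = 2 ∨ 3 ≤ n := by omega
    cases hb : ls.any (Label.hasCritical m)
    · have hcrt0 : crt = 0 := by simpa [hb] using hcrt
      rcases hcases with rfl | rfl | rfl | hn
      · simp [h0, h1, h2, codeLabel]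
      · simp [h0, h1, h2, hcrt0, codeLabel]
      · simp [h0, h1, h2, hcrt0, codeLabel]
      · simp [h0, h1, h2, hn, show n - 2 ≠ 0 by omega, codeLabel]
    · have hcrt0 : crt ≠ 0 := hcrt.mpr hb
      rcases hcases with rfl | rfl | rfl | hn
      · simp [h0, h1, h2, codeLabel]
      · cases hc : Label.contains m L
        · have : x = 0 := by simpa [hc] using hx
          simp [h0, h1, h2, hcrt0, this, codeLabel]
        · have : x ≠ 0 := hx.mpr hc
          simp [h0, h1, h2, hcrt0, this, codeLabel]
      · simp [h0, h1, h2, hcrt0, codeLabel]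
      · simp [h0, h1, h2, hn, show n - 2 ≠ 0 by omega, codeLabel]

theorem conBit_codeLabel {L : Label} {m code : ℕ} (hc : code ≤ 4) (j : ℕ) :
    conBit (codeLabel m L code) j = newCon code m j (conBit L j) := by
  interval_cases code <;> simp [conBit, codeLabel, newCon, Label.contains]
  by_cases h : j = m <;> simp [h]

/-- Prepending to an empty list would make `m` the last entry, and not a critical one without a
star; hence the hypothesis on code 4. -/
theorem critBit_codeLabel {L : Label} {m code : ℕ} (hc : code ≤ 4)
    (hL : code = 4 → L.entries ≠ []) (j : ℕ) :
    critBit (codeLabel m L code) j = newCrit code m j (critBit L j) := by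
  interval_cases code
  · simp [codeLabel, newCrit]
  · simp [critBit, codeLabel, newCrit, hasCritical_singleton]
  · simp [critBit, codeLabel, newCrit, hasCritical_singleton]
  · simp [critBit, codeLabel, newCrit, hasCritical_singleton]
  · obtain ⟨es, st⟩ := L
    cases es with
    | nil => exact absurd rfl (hL rfl)
    | cons b es =>
      simp only [critBit, codeLabel, newCrit, hasCritical_cons]
      by_cases h : j = m <;> simp [h]

end LabelBits

section LabelFold

theorem labelStep_of_countP_eq_zero {ls : List Label} {L : Label} {m : ℕ} (hm : 1 ≤ m)
    (h : ls.countP (Label.contains m) = 0) : labelStep ls L m = L := by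
  unfold labelStep
  simp only [h]
  rw [if_neg (by omega : ¬ m = 0)]
  simp

/-- The label after the iterations for the values below `j`. -/
def labelFold (ls : List Label) (j : ℕ) : Label :=
  (List.range j).foldl (labelStep ls) ⟨[], false⟩

theorem labelFold_succ (ls : List Label) (j : ℕ) :
    labelFold ls (j + 1) = labelStep ls (labelFold ls j) j := by
  simp [labelFold, List.range_succ]

theorem labelFold_one (ls : List Label) :
    labelFold ls 1 = ⟨[0], false⟩ ∨ labelFold ls 1 = ⟨[1], false⟩ := by
  simp only [labelFold_succ, labelStep, if_true]
  split_ifs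
  · exact Or.inr rfl
  · exact Or.inl rfl

/-- Iterations beyond the largest entry find no label containing their value and change nothing, so
the loop may run to `n`. -/
theorem labelFold_eq_labelAlgorithm {ls : List Label} {n : ℕ}
    (h : ∀ L ∈ ls, ∀ e ∈ L.entries, e < n) (hn : 1 ≤ n) : labelFold ls n = labelAlgorithm ls := by
  have hmax : maxEntry ls < n := by
    have key : ∀ l : List ℕ, (∀ e ∈ l, e < n) → l.foldr max 0 < n := by
      intro l
      induction l with
      | nil => exact fun _ => hn
      | cons a l ih =>
        simp only [List.mem_cons, forall_eq_or_imp, List.foldr_cons]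
        exact fun h => max_lt h.1 (ih h.2)
    refine key _ fun e he => ?_
    obtain ⟨L, hL, he⟩ := List.mem_flatMap.mp he
    exact h L hL e he
  rw [labelAlgorithm_eq_foldl]
  change _ = labelFold ls (maxEntry ls + 1)
  obtain ⟨d, rfl⟩ := Nat.exists_eq_add_of_le (Nat.succ_le_of_lt hmax)
  clear h hn hmax
  induction d with
  | zero => rfl
  | succ d ih =>
    rw [← ih, ← add_assoc, labelFold_succ]
    refine labelStep_of_countP_eq_zero (by omega) ?_
    rw [List.countP_eq_zero]
    intro L hL hc
    have := le_maxEntry hL (e := maxEntry ls + 1 + d) (by simpa [Label.contains] using hc)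
    omega

end LabelFold

/-! ### The program for trees and its effect on the arrays -/

section Statements

open HuntersRabbit.Expr HuntersRabbit.Stmt

/-- `if e = f then a else b` -/
def Expr.ifEq (e f a b : Expr) : Expr := ite (add (sub e f) (sub f e)) b a

theorem Expr.eval_ifEq (ρ : ℕ → ℕ) (arr : ℕ → ℕ → ℕ) (e f a b : Expr) :
    (Expr.ifEq e f a b).eval ρ arr =
      if e.eval ρ arr = f.eval ρ arr then a.eval ρ arr else b.eval ρ arr := by
  have key : ∀ x y u w : ℕ, (if x - y + (y - x) ≠ 0 then w else u) = if x = y then u else w := by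
    intro x y u w
    split_ifs <;> omega
  exact key _ _ _ _

/-- The position of the entry `m` of row `(v, p)` of a table. -/
def cell (v p m : Expr) : Expr := add (mulSize (add (mulSize v) p)) m

/-- The value of `e` if the vertex `ctr 4` is a neighbour of `ctr 1` other than `ctr 2`. -/
def ifChild (e : Expr) : Expr :=
  ite (read 0 (add (mulSize (ctr 1)) (ctr 4))) (Expr.ifEq (ctr 4) (ctr 2) (const 0) e) (const 0)

/-- Count the children whose label contains `ctr 3`, and those where it is critical. -/
def countStmt : Stmt :=
  seq (assign 5 (const 0) (const 0)) (seq (assign 5 (const 1) (const 0))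
    (loop (seq
      (assign 5 (const 0)
        (add (read 5 (const 0)) (ifChild (read 1 (cell (ctr 4) (ctr 1) (ctr 3))))))
      (assign 5 (const 1)
        (add (read 5 (const 1)) (ifChild (read 2 (cell (ctr 4) (ctr 1) (ctr 3)))))))))

/-- Store the code of the update for the value `ctr 3`. -/
def codeStmt : Stmt :=
  assign 5 (const 2)
    (ite (ctr 3)
      (ite (sub (ctr 3) (const 1))
        (ite (sub (read 5 (const 0)) (const 2)) (const 3)
          (ite (sub (read 5 (const 0)) (const 1))
            (ite (read 5 (const 1)) (const 3) (const 2))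
            (ite (read 5 (const 0))
              (ite (read 5 (const 1)) (ite (read 3 (ctr 3)) (const 3) (const 4)) (const 1))
              (const 0))))
        (ite (read 5 (const 0))
          (ite (sub (read 5 (const 0)) (const 1)) (const 3)
            (ite (read 5 (const 1)) (const 3) (ite (read 3 (const 0)) (const 2) (const 3))))
          (const 0)))
      (ite (read 5 (const 0)) (const 3) (const 1)))

/-- Update the bits for `ctr 4` of the current label. -/
def updateBody : Stmt :=
  seq
    (assign 3 (ctr 4)
      (ite (read 5 (const 2)) (ite (sub (read 5 (const 2)) (const 1))
        (ite (sub (read 5 (const 2)) (const 2)) (ite (sub (read 5 (const 2)) (const 3))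
          (Expr.ifEq (ctr 4) (ctr 3) (const 1) (read 3 (ctr 4)))
          (Expr.ifEq (ctr 4) (add (ctr 3) (const 1)) (const 1) (const 0)))
          (Expr.ifEq (ctr 4) (ctr 3) (const 1) (const 0)))
          (Expr.ifEq (ctr 4) (ctr 3) (const 1) (const 0)))
          (read 3 (ctr 4))))
    (assign 4 (ctr 4)
      (ite (read 5 (const 2)) (ite (sub (read 5 (const 2)) (const 1))
        (ite (sub (read 5 (const 2)) (const 2)) (ite (sub (read 5 (const 2)) (const 3))
          (Expr.ifEq (ctr 4) (ctr 3) (const 1) (read 4 (ctr 4)))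
          (const 0))
          (Expr.ifEq (ctr 4) (ctr 3) (const 1) (const 0)))
          (const 0))
          (read 4 (ctr 4))))

/-- Update the bits of the current label. -/
def updateStmt : Stmt := loop updateBody

/-- Compute the bits of the label of `ctr 1` with parent `ctr 2`. -/
def labelStmt : Stmt := loop (seq countStmt (seq codeStmt updateStmt))

/-- Copy the current label to row `(ctr 1, ctr 2)` of the tables. -/
def copyStmt : Stmt :=
  loop (seq (assign 1 (cell (ctr 1) (ctr 2) (ctr 3)) (read 3 (ctr 3)))
    (assign 2 (cell (ctr 1) (ctr 2) (ctr 3)) (read 4 (ctr 3))))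

/-- Recompute all rows of the tables. -/
def sweepStmt : Stmt := loop (loop (seq labelStmt copyStmt))

/-- Find the largest entry of row `(0, 0)`. -/
def outputStmt : Stmt :=
  seq (assign 5 (const 0) (const 0))
    (loop (assign 5 (const 0)
      (ite (read 1 (cell (const 0) (const 0) (ctr 0))) (ctr 0) (read 5 (const 0)))))

/-- Compute the monotone hunter number of a tree. -/
def treeStmt : Stmt := seq (loop sweepStmt) outputStmt

theorem treeStmt_closed : treeStmt.Closed 0 := by
  simp [treeStmt, sweepStmt, labelStmt, copyStmt, outputStmt, countStmt, codeStmt, updateStmt,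
    updateBody, cell,
    ifChild, Expr.ifEq, Stmt.Closed, Expr.Closed]

/-- The invariant rule by which every loop below is analysed. -/
theorem run_loop_induction {s : Stmt} {d n : ℕ} {ρ : ℕ → ℕ} {a : ℕ → ℕ → ℕ} (hn : ρ 0 = n)
    (P : ℕ → (ℕ → ℕ → ℕ) → Prop) (h0 : P 0 a)
    (hs : ∀ j < n, ∀ a, P j a → P (j + 1) (s.run (d + 1) (Function.update ρ (d + 1) j) a)) :
    P n ((loop s).run d ρ a) := by
  subst hn
  have key : ∀ j ≤ ρ 0, P j ((List.range j).foldl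
      (fun arr j => s.run (d + 1) (Function.update ρ (d + 1) j) arr) a) := by
    intro j
    induction j with
    | zero => exact fun _ => h0
    | succ j ih =>
      intro hj
      rw [List.range_succ, List.foldl_append]
      exact hs j (by omega) _ (ih (by omega))
  exact key _ le_rfl

/-- The sum of the entries `m` of the rows of the children of `v`, if `p` is the parent of `v`. -/
def sumChildren (adj tbl : ℕ → ℕ) (n v p m : ℕ) : ℕ → ℕ := fun k =>
  ∑ c ∈ Finset.range k,
    if adj (v * n + c) ≠ 0 then if c = p then 0 else tbl ((c * n + v) * n + m) else 0

theorem countStmt_run {n : ℕ} {ρ : ℕ → ℕ} (hn : ρ 0 = n) (a : ℕ → ℕ → ℕ) :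
    (∀ b ≠ 5, countStmt.run 4 ρ a b = a b) ∧
    countStmt.run 4 ρ a 5 0 = sumChildren (a 0) (a 1) n (ρ 2) (ρ 3) (ρ 4) n ∧
    countStmt.run 4 ρ a 5 1 = sumChildren (a 0) (a 2) n (ρ 2) (ρ 3) (ρ 4) n := by
  refine run_loop_induction hn (fun j a' => (∀ b ≠ 5, a' b = a b) ∧
    a' 5 0 = sumChildren (a 0) (a 1) n (ρ 2) (ρ 3) (ρ 4) j ∧
    a' 5 1 = sumChildren (a 0) (a 2) n (ρ 2) (ρ 3) (ρ 4) j) ⟨fun b hb => ?_, ?_, ?_⟩ ?_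
  · simp [run, hb]
  · simp [run, sumChildren, eval]
  · simp [run, sumChildren, eval]
  · rintro j - a' ⟨h1, h2, h3⟩
    refine ⟨fun b hb => ?_, ?_, ?_⟩
    · simp [run, hb, h1 b hb]
    · simp only [sumChildren] at h2
      simp [run, eval, sumChildren, Finset.sum_range_succ, ifChild, cell, Expr.eval_ifEq, h2, hn,
        h1 0, h1 1]
    · simp only [sumChildren] at h3
      simp [run, eval, sumChildren, Finset.sum_range_succ, ifChild, cell, Expr.eval_ifEq, h3, hn,
        h1 0, h1 2]

theorem codeStmt_run (ρ : ℕ → ℕ) (a : ℕ → ℕ → ℕ) :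
    (∀ b ≠ 5, codeStmt.run 4 ρ a b = a b) ∧
    codeStmt.run 4 ρ a 5 2 = stepCode (a 5 0) (a 5 1) (ρ 4) (a 3 0) (a 3 (ρ 4)) := by
  refine ⟨fun b hb => ?_, ?_⟩
  · simp [codeStmt, run, hb]
  · simp only [codeStmt, run, eval, Function.update_self, stepCode]
    rfl

theorem updateStmt_run {n : ℕ} {ρ : ℕ → ℕ} (hn : ρ 0 = n) (a : ℕ → ℕ → ℕ) :
    (∀ b < 3, updateStmt.run 4 ρ a b = a b) ∧
    ∀ j < n, updateStmt.run 4 ρ a 3 j = newCon (a 5 2) (ρ 4) j (a 3 j) ∧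
      updateStmt.run 4 ρ a 4 j = newCrit (a 5 2) (ρ 4) j (a 4 j) := by
  have key := run_loop_induction (s := updateBody) (d := 4) (a := a) hn
    (fun k a' => (∀ b < 3, a' b = a b) ∧
      a' 5 = a 5 ∧ ∀ j,
        a' 3 j = (if j < k then newCon (a 5 2) (ρ 4) j (a 3 j) else a 3 j) ∧
        a' 4 j = (if j < k then newCrit (a 5 2) (ρ 4) j (a 4 j) else a 4 j)) (by simp) ?_
  · refine ⟨key.1, fun j hj => ?_⟩
    have h := key.2.2 j
    simp only [hj, if_true] at h
    exact h
  · rintro k - a' ⟨h1, h2, h3⟩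
    refine ⟨fun b hb => ?_, ?_, fun j => ?_⟩
    · simp [updateBody, run, show b ≠ 3 by omega, show b ≠ 4 by omega, h1 b hb]
    · simp [updateBody, run, h2]
    · obtain ⟨h4, h5⟩ := h3 j
      by_cases hjk : j = k
      · subst hjk
        simp only [lt_irrefl, if_false] at h4 h5
        simp [updateBody, run, eval, Expr.eval_ifEq, h2, h4, h5, newCon, newCrit]
      · have : j < k + 1 ↔ j < k := by omega
        simp [updateBody, run, eval, hjk, h4, h5, this]

end Statements

end HuntersRabbit

namespace HuntersRabbit

/-! ### Computing and storing one row -/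

section LabelStatement

/-- Codes 1 and 3 overwrite every bit, so the first iteration does not depend on what the arrays
held before. -/
theorem stepCode_zero (cnt crt x₀ x : ℕ) :
    stepCode cnt crt 0 x₀ x = 3 ∨ stepCode cnt crt 0 x₀ x = 1 := by
  unfold stepCode
  split_ifs <;> simp_all

theorem labelFold_ne_nil {ls : List Label} {j : ℕ} (hj : j ≠ 0) : (labelFold ls j).entries ≠ [] := by
  obtain ⟨j, rfl⟩ := Nat.exists_eq_succ_of_ne_zero hj
  clear hj
  induction j with
  | zero => rcases labelFold_one ls with h | h <;> simp [h]
  | succ j ih =>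
    rw [Nat.succ_eq_add_one, labelFold_succ]
    unfold labelStep
    dsimp only
    split_ifs <;> first | exact ih | simp

/-- One iteration of `labelStmt` leaves the tables unchanged and updates the current label. -/
theorem labelBody_run {n : ℕ} {ρ : ℕ → ℕ} (hn : ρ 0 = n) (a : ℕ → ℕ → ℕ) {cnt crt : ℕ}
    (hcnt : sumChildren (a 0) (a 1) n (ρ 2) (ρ 3) (ρ 4) n = cnt)
    (hcrt : sumChildren (a 0) (a 2) n (ρ 2) (ρ 3) (ρ 4) n = crt) :
    (∀ b < 3, (Stmt.seq countStmt (.seq codeStmt updateStmt)).run 4 ρ a b = a b) ∧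
    ∀ j < n, (Stmt.seq countStmt (.seq codeStmt updateStmt)).run 4 ρ a 3 j =
        newCon (stepCode cnt crt (ρ 4) (a 3 0) (a 3 (ρ 4))) (ρ 4) j (a 3 j) ∧
      (Stmt.seq countStmt (.seq codeStmt updateStmt)).run 4 ρ a 4 j =
        newCrit (stepCode cnt crt (ρ 4) (a 3 0) (a 3 (ρ 4))) (ρ 4) j (a 4 j) := by
  obtain ⟨h1, h2, h3⟩ := countStmt_run hn a
  obtain ⟨h4, h5⟩ := codeStmt_run ρ (countStmt.run 4 ρ a)
  obtain ⟨h6, h7⟩ := updateStmt_run hn (codeStmt.run 4 ρ (countStmt.run 4 ρ a))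
  simp only [h2, h3, hcnt, hcrt, h1 3 (by omega)] at h5
  refine ⟨fun b hb => ?_, fun j hj => ?_⟩
  · exact (h6 b hb).trans ((h4 b (by omega)).trans (h1 b (by omega)))
  · have h8 := h7 j hj
    rw [h5, h4 3 (by omega), h1 3 (by omega), h4 4 (by omega), h1 4 (by omega)] at h8
    exact h8

theorem labelStmt_run_of_lt {n : ℕ} {ρ : ℕ → ℕ} (hn : ρ 0 = n) (a : ℕ → ℕ → ℕ) :
    ∀ b < 3, labelStmt.run 3 ρ a b = a b := by
  refine run_loop_induction hn (fun _ a' => ∀ b < 3, a' b = a b) (fun _ _ => rfl) ?_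
  intro j _ a' h b hb
  rw [← h b hb]
  exact (labelBody_run (by simpa using hn) a' rfl rfl).1 b hb

theorem labelStmt_run {n : ℕ} {ρ : ℕ → ℕ} (hn : ρ 0 = n) (hpos : n ≠ 0) {a : ℕ → ℕ → ℕ}
    {ls : List Label}
    (hcnt : ∀ m < n,
      sumChildren (a 0) (a 1) n (ρ 2) (ρ 3) m n = ls.countP (Label.contains m))
    (hcrt : ∀ m < n,
      (sumChildren (a 0) (a 2) n (ρ 2) (ρ 3) m n ≠ 0 ↔ ls.any (Label.hasCritical m) = true)) :
    ∀ j < n, labelStmt.run 3 ρ a 3 j = conBit (labelFold ls n) j ∧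
      labelStmt.run 3 ρ a 4 j = critBit (labelFold ls n) j := by
  -- Arrays 3 and 4 are not initialised and may hold the previous row, so nothing is claimed of them
  -- at `k = 0`.
  refine (run_loop_induction hn (fun k a' => (∀ b < 3, a' b = a b) ∧ (k ≠ 0 → ∀ j < n,
    a' 3 j = conBit (labelFold ls k) j ∧ a' 4 j = critBit (labelFold ls k) j))
    ⟨fun _ _ => rfl, fun h => absurd rfl h⟩ ?_).2 hpos
  rintro k hk a' ⟨h1, h2⟩
  obtain ⟨h3, h4⟩ := labelBody_run (ρ := Function.update ρ (3 + 1) k) (by simpa using hn) a' rfl rfl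
  refine ⟨fun b hb => (h3 b hb).trans (h1 b hb), fun _ j hj => ?_⟩
  have h5 := h4 j hj
  simp only [show (2 : ℕ) ≠ 3 + 1 by omega, show (3 : ℕ) ≠ 3 + 1 by omega, ne_eq,
    not_false_eq_true, Function.update_of_ne, Function.update_self, h1 0 (by omega),
    h1 1 (by omega), h1 2 (by omega), hcnt k hk] at h5
  set crt := sumChildren (a 0) (a 2) n (ρ 2) (ρ 3) k n
  set code := stepCode (ls.countP (Label.contains k)) crt k (a' 3 0) (a' 3 k) with hcode
  have hle : code ≤ 4 := stepCode_le _ _ _ _ _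
  have hbit : ∀ (L : Label) (m : ℕ), conBit L m ≠ 0 ↔ Label.contains m L = true := by
    intro L m
    simp [conBit]
  have hstep : labelFold ls (k + 1) = codeLabel k (labelFold ls k) code := by
    rw [labelFold_succ]
    refine labelStep_eq_codeLabel rfl (hcrt k hk) (fun hk1 => ?_) (fun hk2 => ?_) (fun hk1 => ?_)
    · rw [(h2 (by omega) 0 (by omega)).1, hbit]
      simp [Label.contains]
    · rw [(h2 (by omega) k hk).1, hbit]
    · rw [hk1]
      exact labelFold_one ls
  have h6 : k = 0 → code ≠ 4 := by
    rintro rfl hc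
    rcases stepCode_zero (ls.countP (Label.contains 0)) crt (a' 3 0) (a' 3 0) with h | h <;> omega
  rw [hstep, conBit_codeLabel hle, critBit_codeLabel hle fun hc => labelFold_ne_nil fun hk0 =>
    h6 hk0 hc]
  by_cases hk0 : k = 0
  · subst hk0
    rcases stepCode_zero (ls.countP (Label.contains 0)) crt (a' 3 0) (a' 3 0) with h | h <;>
    · rw [← hcode] at h
      rw [h] at h5 ⊢
      exact h5
  · rw [← (h2 hk0 j hj).1, ← (h2 hk0 j hj).2]
    exact h5

end LabelStatement

section CopyStatement

/-- Uniqueness of digits in base `n`; the leading digit needs no bound. -/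
theorem cell_injective {n v p m v' p' m' : ℕ} (hp : p < n) (hm : m < n) (hp' : p' < n)
    (hm' : m' < n) (h : (v * n + p) * n + m = (v' * n + p') * n + m') : v = v' ∧ p = p' ∧ m = m' := by
  have key : ∀ {x y x' y' : ℕ}, y < n → y' < n → x * n + y = x' * n + y' → x = x' ∧ y = y' := by
    intro x y x' y' hy hy' h
    have h1 := congrArg (· / n) h
    have h2 := congrArg (· % n) h
    simp only [mul_comm _ n] at h1 h2
    rw [Nat.mul_add_div (by omega), Nat.mul_add_div (by omega), Nat.div_eq_of_lt hy,
      Nat.div_eq_of_lt hy'] at h1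
    rw [Nat.mul_add_mod, Nat.mul_add_mod, Nat.mod_eq_of_lt hy, Nat.mod_eq_of_lt hy'] at h2
    omega
  obtain ⟨h1, rfl⟩ := key hm hm' h
  obtain ⟨rfl, rfl⟩ := key hp hp' h1
  exact ⟨rfl, rfl, rfl⟩

theorem copyStmt_run {n : ℕ} {ρ : ℕ → ℕ} (hn : ρ 0 = n) (hp : ρ 3 < n) (a : ℕ → ℕ → ℕ) :
    copyStmt.run 3 ρ a 0 = a 0 ∧
    (∀ m < n, copyStmt.run 3 ρ a 1 ((ρ 2 * n + ρ 3) * n + m) = a 3 m ∧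
      copyStmt.run 3 ρ a 2 ((ρ 2 * n + ρ 3) * n + m) = a 4 m) ∧
    ∀ v p, p < n → (v ≠ ρ 2 ∨ p ≠ ρ 3) → ∀ m < n,
      copyStmt.run 3 ρ a 1 ((v * n + p) * n + m) = a 1 ((v * n + p) * n + m) ∧
      copyStmt.run 3 ρ a 2 ((v * n + p) * n + m) = a 2 ((v * n + p) * n + m) := by
  have key : (∀ b, b ≠ 1 → b ≠ 2 → copyStmt.run 3 ρ a b = a b) ∧
      (∀ m < n, copyStmt.run 3 ρ a 1 ((ρ 2 * n + ρ 3) * n + m) = a 3 m ∧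
        copyStmt.run 3 ρ a 2 ((ρ 2 * n + ρ 3) * n + m) = a 4 m) ∧
      ∀ x, (∀ m < n, x ≠ (ρ 2 * n + ρ 3) * n + m) →
        copyStmt.run 3 ρ a 1 x = a 1 x ∧ copyStmt.run 3 ρ a 2 x = a 2 x := by
    refine run_loop_induction hn (fun k a' => (∀ b, b ≠ 1 → b ≠ 2 → a' b = a b) ∧
      (∀ m < k, a' 1 ((ρ 2 * n + ρ 3) * n + m) = a 3 m ∧
        a' 2 ((ρ 2 * n + ρ 3) * n + m) = a 4 m) ∧
      ∀ x, (∀ m < n, x ≠ (ρ 2 * n + ρ 3) * n + m) → a' 1 x = a 1 x ∧ a' 2 x = a 2 x)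
      (by simp) ?_
    rintro k hk a' ⟨h1, h2, h3⟩
    refine ⟨fun b hb hb' => ?_, fun m hm => ?_, fun x hx => ?_⟩
    · simp [Stmt.run, hb, hb', h1 b hb hb']
    · by_cases hmk : m = k
      · subst hmk
        simp [Stmt.run, Expr.eval, cell, hn, h1 3, h1 4]
      · simp [Stmt.run, Expr.eval, cell, hn, hmk, h2 m (by omega)]
    · simp [Stmt.run, Expr.eval, cell, hn, hx k hk, h3 x hx]
  refine ⟨key.1 0 (by omega) (by omega), key.2.1, fun v p hpn hvp m hm => key.2.2 _ ?_⟩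
  intro m' hm' h
  have := cell_injective hpn hm hp hm' h
  omega

/-- The counter increases, so the last index written is the largest one whose bit is set. -/
theorem outputStmt_run {n : ℕ} {ρ : ℕ → ℕ} (hn : ρ 0 = n) {a : ℕ → ℕ → ℕ} {M : ℕ} (hM : M < n)
    (h1 : a 1 M ≠ 0) (h2 : ∀ m < n, a 1 m ≠ 0 → m ≤ M) : outputStmt.run 0 ρ a 5 0 = M := by
  have key : outputStmt.run 0 ρ a 1 = a 1 ∧ (M < n → outputStmt.run 0 ρ a 5 0 = M) := by
    refine run_loop_induction hn (fun k a' => a' 1 = a 1 ∧ (M < k → a' 5 0 = M)) ?_ ?_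
    · simp [Stmt.run]
    · rintro k hk a' ⟨h3, h4⟩
      refine ⟨by simp [Stmt.run, h3], fun hMk => ?_⟩
      rcases (Nat.lt_succ_iff.mp hMk).eq_or_lt with rfl | hlt
      · simp [Stmt.run, Expr.eval, cell, h3, h1]
      · have : a 1 k = 0 := by
          by_contra h
          exact absurd (h2 k hk h) (by omega)
        simp [Stmt.run, Expr.eval, cell, h3, this, h4 hlt]
  exact key.2 hM

end CopyStatement

end HuntersRabbit

namespace HuntersRabbit

open Set

/-! ### Sweeps over the tables and the final program -/

section TreeStatement

/-- Give the vertices distinct times; the last one is never active, as none of its neighbours waits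
that long. Hence all entries are below `n` and fit into the rows. -/
theorem layable_univ_pred {V : Type*} [Finite V] [Nonempty V] (T : SimpleGraph V) :
    Layable T univ (Nat.card V - 1) := by
  obtain ⟨e⟩ : Nonempty (V ≃ Fin (Nat.card V)) := ⟨Finite.equivFin V⟩
  have hpos : 0 < Nat.card V := Nat.card_pos
  set z := e.symm ⟨Nat.card V - 1, by omega⟩ with hz
  refine ⟨fun v => e v, fun t => ?_⟩
  have hcard : (univ \ {z}).ncard = Nat.card V - 1 := by
    rw [ncard_sdiff_singleton_of_mem (mem_univ z), ncard_univ]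
  suffices h : activeSet T univ (fun v => e v) t ⊆ univ \ {z} from
    (ncard_le_ncard h (toFinite _)).trans hcard.le
  refine fun x hx => ⟨mem_univ x, ?_⟩
  rintro rfl
  obtain ⟨-, hxt, y, -, hxy, hty⟩ := hx
  have hez : (e z : ℕ) = Nat.card V - 1 := by simp [hz]
  have : (e y : ℕ) = e z := by
    have := (e y).isLt
    dsimp only at hxt hty
    omega
  exact hxy.ne (e.injective (Fin.ext this)).symm

theorem IsLabel.entry_lt {V : Type*} [Finite V] {T : SimpleGraph V} (hT : T.IsTree) {r u : V}
    {L : Label} (h : IsLabel T r u L) : ∀ e ∈ L.entries, e < Nat.card V := by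
  intro e he
  have := hT.connected.nonempty
  have hpos : 0 < Nat.card V := Nat.card_pos
  have h1 := ((isLabel_iff_hasLabel hT).mp h).le_layoutWidth e he
  have h2 := layoutWidth_mono (T := T) (subset_univ (descendants T r u))
  have h3 := layoutWidth_le_iff.mpr (layable_univ_pred T)
  omega

theorem ncard_descendants_lt {V : Type*} [Finite V] {T : SimpleGraph V} (hT : T.IsTree)
    {r v c : V} (h : IsChild T r v c) :
    (descendants T r c).ncard < (descendants T r v).ncard :=
  ncard_lt_ncard ⟨descendants_subset hT h.2, fun hs =>
    h.notMem_descendants hT (hs (mem_descendants_self hT v))⟩ (toFinite _)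

/-- The labelling algorithm can be run from the leaves to the root. -/
theorem exists_labelling {V : Type*} [Finite V] {T : SimpleGraph V} (hT : T.IsTree) {r : V}
    {children : V → List V} (hch : ∀ v c, c ∈ children v → IsChild T r v c) :
    ∃ lab : V → Label, ∀ v, lab v = labelAlgorithm ((children v).map lab) := by
  let wf := (measure fun v : V => (descendants T r v).ncard).wf
  let F : ∀ v, (∀ c, (descendants T r c).ncard < (descendants T r v).ncard → Label) → Label :=
    fun v rec => labelAlgorithm
      ((children v).attach.map fun c : {c // c ∈ children v} =>
        rec c.1 (ncard_descendants_lt hT (hch v c.1 c.2)))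
  refine ⟨wf.fix F, fun v => ?_⟩
  rw [wf.fix_eq]
  exact congrArg labelAlgorithm List.attach_map_val

/-- `p` is the parent of `v`, where the root counts as its own parent. -/
def IsParent {V : Type*} (T : SimpleGraph V) (r v p : V) : Prop := (v = r ∧ p = r) ∨ IsChild T r p v

/-- Lets the program recognise children without knowing the root: they are the neighbours other than
the parent. The root, as its own parent, excludes none of its neighbours. -/
theorem IsParent.isChild_iff {V : Type*} {T : SimpleGraph V} (hT : T.IsTree) {r v p c : V}
    (h : IsParent T r v p) : IsChild T r v c ↔ T.Adj v c ∧ c ≠ p := by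
  rcases h with ⟨rfl, rfl⟩ | h
  · refine ⟨fun h => ⟨h.1, h.ne.symm⟩, fun h => ⟨h.1, ?_⟩⟩
    rw [descendants_root hT]
    exact mem_univ c
  · constructor
    · refine fun hc => ⟨hc.1, ?_⟩
      rintro rfl
      exact h.ne (descendants_antisymm hT hc.2 h.2)
    · rintro ⟨hadj, hne⟩
      exact (isChild_or_isChild hT hadj).resolve_right fun hc => hne (hc.parent_unique hT h)

variable {n : ℕ} {T : SimpleGraph (Fin n)} {r : Fin n} {lab : Fin n → Label}

/-- Row `(v, p)` of the tables represents the label of `v`. -/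
def RowCorrect (lab : Fin n → Label) (a : ℕ → ℕ → ℕ) (v p : Fin n) : Prop :=
  ∀ m < n, a 1 ((v * n + p) * n + m) = conBit (lab v) m ∧
    a 2 ((v * n + p) * n + m) = critBit (lab v) m

/-- The array `0` holds the adjacency matrix of `T`. -/
def HoldsAdj (T : SimpleGraph (Fin n)) (a : ℕ → ℕ → ℕ) : Prop :=
  ∀ i j : Fin n, a 0 (i * n + j) ≠ 0 ↔ T.Adj i j

open Classical in
theorem sumChildren_eq (hT : T.IsTree) {a : ℕ → ℕ → ℕ} (ha : HoldsAdj T a) {v p : Fin n}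
    (hp : IsParent T r v p) (tbl : ℕ → ℕ) (m : ℕ) :
    sumChildren (a 0) tbl n v p m n =
      ∑ c : Fin n, if IsChild T r v c then tbl ((c * n + v) * n + m) else 0 := by
  rw [sumChildren, ← Fin.sum_univ_eq_sum_range
    (fun c => if a 0 (v * n + c) ≠ 0 then if c = p then 0 else tbl ((c * n + v) * n + m) else 0)]
  refine Finset.sum_congr rfl fun c _ => ?_
  by_cases h1 : T.Adj v c
  · rw [if_pos ((ha v c).mpr h1)]
    by_cases h2 : c = p
    · rw [if_pos (congrArg Fin.val h2), if_neg fun h => ((hp.isChild_iff hT).mp h).2 h2]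
    · rw [if_neg fun h => h2 (Fin.ext h), if_pos ((hp.isChild_iff hT).mpr ⟨h1, h2⟩)]
  · rw [if_neg fun h => h1 ((ha v c).mp h), if_neg fun h => h1 h.1]

theorem sumChildren_conBit (hT : T.IsTree) {a : ℕ → ℕ → ℕ} (ha : HoldsAdj T a) {v p : Fin n}
    (hp : IsParent T r v p) {cs : List (Fin n)} (hnd : cs.Nodup)
    (hcs : ∀ c, c ∈ cs ↔ IsChild T r v c) (hrow : ∀ c, IsChild T r v c → RowCorrect lab a c v)
    {m : ℕ} (hm : m < n) :
    sumChildren (a 0) (a 1) n v p m n = (cs.map lab).countP (Label.contains m) := by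
  classical
  obtain ⟨H, hH, hcard⟩ := exists_children_finset hnd hcs lab m
  rw [hcard, sumChildren_eq hT ha hp, Finset.card_eq_sum_ones,
    ← Finset.sum_ite_mem_eq (s := H)]
  refine Finset.sum_congr rfl fun c _ => ?_
  by_cases hc : IsChild T r v c
  · rw [if_pos hc, (hrow c hc m hm).1]
    simp [conBit, Label.contains, hH, hc]
  · rw [if_neg hc, if_neg fun h => hc ((hH c).mp h).1]

theorem sumChildren_critBit (hT : T.IsTree) {a : ℕ → ℕ → ℕ} (ha : HoldsAdj T a) {v p : Fin n}
    (hp : IsParent T r v p) {cs : List (Fin n)} (hcs : ∀ c, c ∈ cs ↔ IsChild T r v c)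
    (hrow : ∀ c, IsChild T r v c → RowCorrect lab a c v) {m : ℕ} (hm : m < n) :
    sumChildren (a 0) (a 2) n v p m n ≠ 0 ↔
      (cs.map lab).any (Label.hasCritical m) = true := by
  classical
  rw [any_hasCritical_iff hcs, sumChildren_eq hT ha hp, ne_eq, Finset.sum_eq_zero_iff]
  push Not
  refine exists_congr fun c => ?_
  by_cases hc : IsChild T r v c
  · rw [if_pos hc, (hrow c hc m hm).2]
    simp [critBit, hc]
  · simp [hc]

/-- The row of every vertex for which `S` holds is correct. -/
def TablesCorrect (T : SimpleGraph (Fin n)) (r : Fin n) (lab : Fin n → Label)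
    (S : Fin n → Fin n → Prop) (a : ℕ → ℕ → ℕ) : Prop :=
  HoldsAdj T a ∧ ∀ v p, IsParent T r v p → S v p → RowCorrect lab a v p

theorem TablesCorrect.mono {S S' : Fin n → Fin n → Prop} {a : ℕ → ℕ → ℕ}
    (h : TablesCorrect T r lab S a) (hS : ∀ v p, S' v p → S v p) : TablesCorrect T r lab S' a :=
  ⟨h.1, fun v p hp hs => h.2 v p hp (hS v p hs)⟩

/-- Recomputing one row of the tables. -/
theorem TablesCorrect.row {S S' : Fin n → Fin n → Prop} {a : ℕ → ℕ → ℕ}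
    (h : TablesCorrect T r lab S a) (hT : T.IsTree) {children : Fin n → List (Fin n)}
    (hch : ∀ v, (children v).Nodup ∧ ∀ c, c ∈ children v ↔ IsChild T r v c)
    (hlab : ∀ v, lab v = labelFold ((children v).map lab) n) {ρ : ℕ → ℕ} {v p : Fin n}
    (h0 : ρ 0 = n) (h2 : ρ 2 = v) (h3 : ρ 3 = p)
    (hS : ∀ v' p', S' v' p' → S v' p' ∨ v' = v ∧ p' = p)
    (hvp : S' v p → ∀ c, IsChild T r v c → S c v) :
    TablesCorrect T r lab S' ((Stmt.seq labelStmt copyStmt).run 3 ρ a) := by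
  obtain ⟨c1, c2, c3⟩ := copyStmt_run h0 (h3 ▸ p.isLt) (labelStmt.run 3 ρ a)
  have hlt := labelStmt_run_of_lt h0 a
  refine ⟨fun i j => ?_, fun v' p' hp' hs m hm => ?_⟩
  · rw [← h.1 i j, ← hlt 0 (by omega), ← c1]
    rfl
  · by_cases heq : v' = v ∧ p' = p
    -- The row is computed from the rows `(c, v')` of the children, so those of false parents do not
    -- matter.
    · obtain ⟨rfl, rfl⟩ := heq
      have hrow : ∀ c, IsChild T r v' c → RowCorrect lab a c v' := fun c hc =>
        h.2 c v' (Or.inr hc) (hvp hs c hc)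
      have hl := labelStmt_run (ls := (children v').map lab) h0 (by omega) (a := a)
        (fun m hm => by
          rw [h2, h3]; exact sumChildren_conBit hT h.1 hp' (hch v').1 (hch v').2 hrow hm)
        (fun m hm => by
          rw [h2, h3]; exact sumChildren_critBit hT h.1 hp' (hch v').2 hrow hm) m hm
      rw [← hlab v'] at hl
      rw [← hl.1, ← hl.2, ← h2, ← h3]
      exact c2 m hm
    · have hne : (v' : ℕ) ≠ ρ 2 ∨ (p' : ℕ) ≠ ρ 3 := by
        rw [h2, h3]
        by_contra hno
        push Not at hno
        exact heq ⟨Fin.ext hno.1, Fin.ext hno.2⟩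
      have hc := c3 v' p' p'.isLt hne m hm
      rw [hlt 1 (by omega), hlt 2 (by omega)] at hc
      have hr := h.2 v' p' hp' ((hS v' p' hs).resolve_right heq) m hm
      exact ⟨hc.1.trans hr.1, hc.2.trans hr.2⟩

/-- One sweep extends the correct part of the tables by one level. -/
theorem TablesCorrect.sweep {a : ℕ → ℕ → ℕ} {h : ℕ}
    (ha : TablesCorrect T r lab (fun v _ => (descendants T r v).ncard ≤ h) a) (hT : T.IsTree)
    {children : Fin n → List (Fin n)}
    (hch : ∀ v, (children v).Nodup ∧ ∀ c, c ∈ children v ↔ IsChild T r v c)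
    (hlab : ∀ v, lab v = labelFold ((children v).map lab) n) {ρ : ℕ → ℕ} (h0 : ρ 0 = n) :
    TablesCorrect T r lab (fun v _ => (descendants T r v).ncard ≤ h + 1) (sweepStmt.run 1 ρ a) := by
  -- During a sweep, small subtrees have correct rows throughout, and those one size larger from the
  -- moment they are processed. Rewriting a correct row does no harm, since its children are smaller
  -- still.
  let S : (Fin n → Fin n → Prop) → Fin n → Fin n → Prop := fun R v p =>
    (descendants T r v).ncard ≤ h ∨ ((descendants T r v).ncard ≤ h + 1 ∧ R v p)
  have hfull : TablesCorrect T r lab (S fun v _ => (v : ℕ) < n) (sweepStmt.run 1 ρ a) := by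
    refine run_loop_induction h0 (fun j a' => TablesCorrect T r lab (S fun v _ => (v : ℕ) < j) a')
      (ha.mono fun v p hs => hs.resolve_right fun hs => absurd hs.2 (Nat.not_lt_zero _)) ?_
    intro j hj a' ha'
    refine TablesCorrect.mono (S := S fun v p => (v : ℕ) < j ∨ (v : ℕ) = j ∧ (p : ℕ) < n)
      (run_loop_induction (by simpa using h0) (fun k a' => TablesCorrect T r lab
        (S fun v p => (v : ℕ) < j ∨ (v : ℕ) = j ∧ (p : ℕ) < k) a') (ha'.mono ?_) ?_) ?_
    · rintro v p (hs | ⟨hs, hs' | hs'⟩)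
      · exact Or.inl hs
      · exact Or.inr ⟨hs, hs'⟩
      · exact absurd hs'.2 (Nat.not_lt_zero _)
    · intro k hk a'' ha''
      refine ha''.row hT hch hlab (v := ⟨j, hj⟩) (p := ⟨k, hk⟩) (by simpa using h0) (by simp)
        (by simp) ?_ ?_
      · rintro v p (hs | ⟨hs, hs' | ⟨hs', hs''⟩⟩)
        · exact Or.inl (Or.inl hs)
        · exact Or.inl (Or.inr ⟨hs, Or.inl hs'⟩)
        · rcases (Nat.lt_succ_iff.mp hs'').eq_or_lt with he | hlt
          · exact Or.inr ⟨Fin.ext hs', Fin.ext he⟩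
          · exact Or.inl (Or.inr ⟨hs, Or.inr ⟨hs', hlt⟩⟩)
      · intro hs c hc
        have := ncard_descendants_lt hT hc
        refine Or.inl ?_
        rcases hs with hs | ⟨hs, -⟩ <;> omega
    · rintro v p (hs | ⟨hs, hs'⟩)
      · exact Or.inl hs
      · have := p.isLt
        exact Or.inr ⟨hs, by omega⟩
  exact hfull.mono fun v p hs => Or.inr ⟨hs, v.isLt⟩

theorem treeStmt_run (hT : T.IsTree) {ρ : ℕ → ℕ} (h0 : ρ 0 = n) {a : ℕ → ℕ → ℕ}
    (ha : HoldsAdj T a) : treeStmt.run 0 ρ a 5 0 = monotoneHunterNumber T := by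
  classical
  obtain ⟨v₀⟩ := hT.connected.nonempty
  have hpos : 0 < n := v₀.pos
  -- Vertex 0 is the root, so its row `(0, 0)` occupies the first cells of the table.
  let r : Fin n := ⟨0, hpos⟩
  let children : Fin n → List (Fin n) := fun v => (List.finRange n).filter fun c => IsChild T r v c
  have hch : ∀ v, (children v).Nodup ∧ ∀ c, c ∈ children v ↔ IsChild T r v c := fun v =>
    ⟨(List.nodup_finRange n).filter _, fun c => by simp [children]⟩
  obtain ⟨lab, hlab⟩ := exists_labelling (r := r) hT fun v c => ((hch v).2 c).mp
  have hL := isLabel_of_recursion hT hch hlab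
  have hent : ∀ v, ∀ e ∈ (lab v).entries, e < n := fun v e he => by
    simpa using (hL v).entry_lt hT e he
  have hfold : ∀ v, lab v = labelFold ((children v).map lab) n := by
    intro v
    rw [hlab v, labelFold_eq_labelAlgorithm _ hpos]
    simp only [List.mem_map, forall_exists_index, and_imp, forall_apply_eq_imp_iff₂]
    exact fun c _ => hent c
  have htab : TablesCorrect T r lab (fun v _ => (descendants T r v).ncard ≤ n)
      ((Stmt.loop sweepStmt).run 0 ρ a) := by
    refine run_loop_induction h0 (fun h a' => TablesCorrect T r lab
      (fun v _ => (descendants T r v).ncard ≤ h) a') ⟨ha, fun v p _ hs => ?_⟩ ?_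
    · have : 0 < (descendants T r v).ncard :=
        (ncard_pos (toFinite _)).mpr ⟨v, mem_descendants_self hT v⟩
      omega
    · exact fun h _ a' ha' => ha'.sweep hT hch hfold (by simpa using h0)
  have hrow := htab.2 r r (Or.inl ⟨rfl, rfl⟩) (by simpa using ncard_le_card (descendants T r r))
  have hbit : ∀ m < n, (Stmt.loop sweepStmt).run 0 ρ a 1 m ≠ 0 ↔ m ∈ (lab r).entries := by
    intro m hm
    have h1 := (hrow m hm).1
    simp only [r, zero_mul, zero_add] at h1
    rw [h1]
    simp [conBit, Label.contains, r]
  have hhead := (hL r).head?_eq hT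
  have hmem : monotoneHunterNumber T ∈ (lab r).entries := List.mem_of_mem_head? hhead
  have hlt := hent r _ hmem
  refine outputStmt_run h0 hlt ((hbit _ hlt).mpr hmem) fun m hm h => ?_
  have h1 := ((isLabel_iff_hasLabel hT).mp (hL r))
  have h2 := h1.le_layoutWidth m ((hbit m hm).mp h)
  rw [h1.head?_eq, Option.some.injEq] at hhead
  omega

end TreeStatement

/-- The monotone hunter number of trees is computable in polynomial time. -/
theorem exists_program_monotoneHunterNumber : ∃ P : Program,
    ComputesInPolyTime P (fun _ T => T.IsTree) (fun _ T => monotoneHunterNumber T) := by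
  -- Two more steps move the result from cell 0 of array 5 to register 0, which has held the size
  -- until then.
  refine ⟨.seq (treeStmt.compile 0) (.seq (.instr (.const 1 0)) (.instr (.load 0 5 1))),
    treeStmt.cost + 2, fun n T hT => ?_⟩
  have ha : HoldsAdj T (inputMemory T).arr := by
    intro i j
    simp only [inputMemory, true_and, ne_eq, ite_eq_right_iff, one_ne_zero, imp_false, not_not]
    constructor
    · rintro ⟨i', j', h, hadj⟩
      have := cell_injective (v := 0) (v' := 0) (p := i) (p' := i') (m := j) (m' := j') i.isLt
        j.isLt i'.isLt j'.isLt (by simpa using h)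
      rwa [Fin.ext this.2.1, Fin.ext this.2.2]
    · exact fun h => ⟨i, j, rfl, h⟩
  have h0 : (inputMemory T).reg 0 = n := rfl
  have h := (treeStmt.compile_runsTo 0 (inputMemory T) treeStmt_closed).seq
    (P' := .seq (.instr (.const 1 0)) (.instr (.load 0 5 1))) (b' := 2)
    (Q' := fun σ => σ.reg 0 = monotoneHunterNumber T) fun σ ⟨h1, _⟩ =>
      (RunsTo.instr (b := 1) le_rfl (Q := fun σ' => σ'.arr = σ.arr ∧ σ'.reg 1 = 0)
        ⟨rfl, by simp [Instr.apply]⟩).seq fun σ' ⟨h2, h3⟩ => .instr le_rfl (by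
          simp only [Instr.apply, Function.update_self, h2, h3, h1]
          exact treeStmt_run hT h0 ha)
  obtain ⟨t, σ, he, ht, hσ⟩ := h
  exact ⟨t, σ, he, by simpa [h0] using ht, hσ⟩

end HuntersRabbit

theorem mainTheorem8 :
    -- the monotone hunter number of trees is computable in polynomial time
    (∃ P : HuntersRabbit.Program,
      HuntersRabbit.ComputesInPolyTime P (fun _ T => T.IsTree)
        (fun _ T => HuntersRabbit.monotoneHunterNumber T)) ∧
    -- the Parsons-like lemma
    (∀ (V : Type*) [Finite V] (T : SimpleGraph V), T.IsTree →
      (HuntersRabbit.monotoneHunterNumber T = 0 ↔ Nat.card V = 1) ∧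
      (HuntersRabbit.monotoneHunterNumber T = 1 ↔ HuntersRabbit.IsStar T) ∧
      (HuntersRabbit.monotoneHunterNumber T = 2 ↔
        Nat.card V ≠ 1 ∧ ¬ HuntersRabbit.IsStar T ∧
        ∃ (x y : V) (p : T.Walk x y), p.IsPath ∧
          ∀ C : (T.induce {w | w ∉ p.support}).ConnectedComponent,
            HuntersRabbit.IsStar C.toSimpleGraph ∨ Nat.card C = 1) ∧
      (∀ k : ℕ, 3 ≤ k →
        (k ≤ HuntersRabbit.monotoneHunterNumber T ↔
          ∃ (v : V) (B₁ B₂ B₃ : HuntersRabbit.Branch T v),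
            B₁ ≠ B₂ ∧ B₁ ≠ B₃ ∧ B₂ ≠ B₃ ∧
            k - 1 ≤ HuntersRabbit.monotoneHunterNumber B₁.toSimpleGraph ∧
            k - 1 ≤ HuntersRabbit.monotoneHunterNumber B₂.toSimpleGraph ∧
            k - 1 ≤ HuntersRabbit.monotoneHunterNumber B₃.toSimpleGraph))) ∧
    -- the labelling algorithm is correct at every vertex, and run bottom-up it yields `mh(T)`
    (∀ (V : Type*) [Finite V] (T : SimpleGraph V), T.IsTree → ∀ r : V,
      (∀ (v : V) (cs : List V) (ls : List HuntersRabbit.Label),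
        cs.Nodup → (∀ c, c ∈ cs ↔ HuntersRabbit.IsChild T r v c) →
        List.Forall₂ (fun c l => HuntersRabbit.IsLabel T r c l) cs ls →
        HuntersRabbit.IsLabel T r v (HuntersRabbit.labelAlgorithm ls)) ∧
      (∀ (children : V → List V) (lab : V → HuntersRabbit.Label),
        (∀ v, (children v).Nodup ∧ ∀ c, c ∈ children v ↔ HuntersRabbit.IsChild T r v c) →
        (∀ v, lab v = HuntersRabbit.labelAlgorithm ((children v).map lab)) →
        (∀ v, HuntersRabbit.IsLabel T r v (lab v)) ∧
        (lab r).entries.head? = some (HuntersRabbit.monotoneHunterNumber T))) := by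
  refine ⟨HuntersRabbit.exists_program_monotoneHunterNumber, ?_, ?_⟩
  · intro V _ T hT
    exact ⟨HuntersRabbit.mh_eq_zero_iff hT, HuntersRabbit.mh_eq_one_iff hT,
      HuntersRabbit.mh_eq_two_iff hT, HuntersRabbit.le_mh_iff hT⟩
  · intro V _ T hT r
    refine ⟨?_, ?_⟩
    · intro v cs ls hnd hcs hls
      have : Nonempty HuntersRabbit.Label := ⟨⟨[], false⟩⟩
      obtain ⟨f, rfl, hf⟩ := HuntersRabbit.exists_map_eq_of_forall₂ hls hnd
      exact HuntersRabbit.isLabel_labelAlgorithm hT hnd hcs hf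
    · intro children lab hch hlab
      have h := HuntersRabbit.isLabel_of_recursion hT hch hlab
      exact ⟨h, (h r).head?_eq hT⟩
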